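/- **Theorem (simulating short-time adiabatic evolution).** Fix integers $\mathfrak d\ge 1$ and $k\ge 0$. There are a classical deterministic algorithm and a polynomial $p$, both depending only on $\mathfrak d$ and $k$, such that the following holds for every number $n$ of qubits. Let $H_0=\sum_{X\in S}a_X h_X$ and $H_1=\sum_{X\in S}b_X h_X$, where the $h_X$ are distinct non-identity Pauli strings on $n$ qubits, each acting nontrivially on at most $k$ qubits, and $a_X,b_X\in[-1,1]$ (a coefficient may be $0$). Assume that the interaction graph (vertices: the terms $h_X$; two different terms are adjacent if their supports intersect) has maximal degree at most $\mathfrak d$. Put $H(s)=(1-s)H_0+sH_1$ and let $U(t)=\mathcal T e^{-i\int_0^t H(s)\,ds}=\sum_{m\ge0}(-i)^m\int_{t\ge s_1\ge\cdots\ge s_m\ge0}H(s_1)\cdots H(s_m)\,ds_m\cdots ds_1$. Let $O$ be a Hermitian operator acting on at most $k$ qubits, $\psi$ a product state of $n$ qubits, and $\epsilon>0$. Then for every time $0\le t<t^*:=\frac{1}{2\sqrt{e\mathfrak d}}$ the algorithm outputs a real number $\langle O\rangle'$ with $$\bigl|\langle O\rangle'-\langle\psi|U(t)^\dagger O\,U(t)|\psi\rangle\bigr|\le\epsilon$$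 after at most $$p\left(\left(\frac{\|O\|}{\epsilon}\,t^2e^{t^2}\right)^{\frac{\log\left(\frac{\epsilon}{\|O\|}\left(1-t/t^*\right)\right)}{\log(t/t^*)}}\right)$$ steps, where $\|O\|$ is the operator norm. (If $t=0$ or $O=0$, the exponent is read as $0$ and the power as $1$.) Here an algorithm is a program of a real random access machine with unit-cost field operations and comparisons on reals, unit-cost addition, truncated subtraction and comparison of natural numbers, unit-cost memory access, rational constants and no rounding. The input in its memory consists of $n$, $t$, $\epsilon$; for each term, its coefficients $a_X,b_X$, its support and its Pauli letters; for each qubit, the list of the terms acting on it and the two amplitudes of its factor of $\psi$; and the qubits and the matrix entries of $O$. -/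

import Mathlib

/-! ## Qubit systems -/

namespace AdiabaticSim

/-- State space of `n` qubits; computational basis states are bit strings `Fin n → Fin 2`. -/
abbrev Qubits (n : ℕ) : Type := EuclideanSpace ℂ (Fin n → Fin 2)

/-- Operators on `n` qubits, with composition, adjoint and operator norm. -/
abbrev QOp (n : ℕ) : Type := Qubits n →L[ℂ] Qubits n

/-- The Pauli matrices, numbered `0 ↦ I`, `1 ↦ X`, `2 ↦ Y`, `3 ↦ Z`. -/
noncomputable def pauli : Fin 4 → Matrix (Fin 2) (Fin 2) ℂ :=
  ![1, !![0, 1; 1, 0], !![0, -Complex.I; Complex.I, 0], !![1, 0; 0, -1]]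

/-- The operator `σ_{P 0} ⊗ ⋯ ⊗ σ_{P (n-1)}` of a Pauli string `P`. -/
noncomputable def pauliOp {n : ℕ} (P : Fin n → Fin 4) : QOp n :=
  Matrix.toEuclideanCLM (𝕜 := ℂ)
    (Matrix.of fun x y : Fin n → Fin 2 => ∏ i, pauli (P i) (x i) (y i))

/-- The qubits on which a Pauli string acts nontrivially, in increasing order. -/
def siteList {n : ℕ} (P : Fin n → Fin 4) : List (Fin n) :=
  (List.finRange n).filter fun i => P i ≠ 0

/-- Two local Hamiltonians `H₀ = ∑ⱼ aⱼ hⱼ`, `H₁ = ∑ⱼ bⱼ hⱼ` on `n` qubits, written over a common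
list of distinct non-identity Pauli terms, each acting on at most `k` qubits, with coefficients of
modulus at most one. A term that is absent from one of them has coefficient zero there. -/
structure AdiabaticHamiltonian (n k : ℕ) where
  numTerms : ℕ
  term : Fin numTerms → (Fin n → Fin 4)
  term_injective : Function.Injective term
  term_ne_identity : ∀ j, term j ≠ 0
  term_local : ∀ j, (siteList (term j)).length ≤ k
  coeff₀ : Fin numTerms → ℝ
  coeff₁ : Fin numTerms → ℝ
  abs_coeff₀_le : ∀ j, |coeff₀ j| ≤ 1
  abs_coeff₁_le : ∀ j, |coeff₁ j| ≤ 1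

namespace AdiabaticHamiltonian

variable {n k : ℕ} (H : AdiabaticHamiltonian n k)

/-- The initial Hamiltonian. -/
noncomputable def initial : QOp n := ∑ j, (H.coeff₀ j : ℂ) • pauliOp (H.term j)

/-- The target Hamiltonian. -/
noncomputable def target : QOp n := ∑ j, (H.coeff₁ j : ℂ) • pauliOp (H.term j)

/-- `H(s) = (1 - s) H₀ + s H₁`. -/
noncomputable def ham (s : ℝ) : QOp n :=
  ((1 - s : ℝ) : ℂ) • H.initial + (s : ℂ) • H.target

/-- The interaction graph: terms are vertices, and two different terms are adjacent when their
supports overlap. -/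
def interactionGraph : SimpleGraph (Fin H.numTerms) where
  Adj i j := i ≠ j ∧ ∃ q, H.term i q ≠ 0 ∧ H.term j q ≠ 0
  symm := ⟨fun _ _ h => ⟨h.1.symm, h.2.imp fun _ hq => ⟨hq.2, hq.1⟩⟩⟩
  loopless := ⟨fun _ h => h.1 rfl⟩

open Classical in
/-- The maximal degree of the interaction graph. -/
noncomputable def maxDegree : ℕ := H.interactionGraph.maxDegree

/-- The order-`m` term of the Dyson series,
`(-i)^m ∫_{t ≥ s₁ ≥ ⋯ ≥ s_m ≥ 0} H(s₁) ⋯ H(s_m)`. -/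
noncomputable def dysonTerm : ℕ → ℝ → QOp n
  | 0, _ => 1
  | m + 1, t => ∫ s in (0 : ℝ)..t, (-Complex.I) • (H.ham s * dysonTerm m s)

/-- `U(t) = 𝒯 exp(-i ∫₀ᵗ H(s) ds)`, the sum of the Dyson series. -/
noncomputable def evolution (t : ℝ) : QOp n := ∑' m, H.dysonTerm m t

/-- The terms that act nontrivially on the qubit `q`. -/
def termsAt (q : Fin n) : List (Fin H.numTerms) :=
  (List.finRange H.numTerms).filter fun j => H.term j q ≠ 0

end AdiabaticHamiltonian

/-- A Hermitian matrix on at most `k` of the `n` qubits. -/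
structure LocalObservable (n k : ℕ) where
  numSites : ℕ
  numSites_le : numSites ≤ k
  site : Fin numSites ↪ Fin n
  mat : Matrix (Fin numSites → Fin 2) (Fin numSites → Fin 2) ℂ
  isHermitian : mat.IsHermitian

open Classical in
/-- The observable as an operator on all qubits: `mat` on the sites, tensored with the identity
on the other qubits. -/
noncomputable def LocalObservable.op {n k : ℕ} (O : LocalObservable n k) : QOp n :=
  Matrix.toEuclideanCLM (𝕜 := ℂ) (Matrix.of fun x y : Fin n → Fin 2 =>
    if ∀ q, q ∉ Set.range O.site → x q = y q
    then O.mat (fun l => x (O.site l)) (fun l => y (O.site l)) else 0)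

/-- A product state: one unit vector of `ℂ²` for each qubit. -/
structure ProductState (n : ℕ) where
  factor : Fin n → EuclideanSpace ℂ (Fin 2)
  norm_factor : ∀ q, ‖factor q‖ = 1

/-- The tensor product of the single-qubit states. -/
noncomputable def ProductState.vec {n : ℕ} (ψ : ProductState n) : Qubits n :=
  WithLp.toLp 2 fun x => ∏ q, ψ.factor q (x q)

/-- `⟨ψ| U(t)† O U(t) |ψ⟩`. -/
noncomputable def expectation {n k : ℕ} (H : AdiabaticHamiltonian n k)
    (O : LocalObservable n k) (ψ : ProductState n) (t : ℝ) : ℂ :=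
  inner ℂ ψ.vec
    ((ContinuousLinearMap.adjoint (H.evolution t) * O.op * H.evolution t) ψ.vec)

/-! ## The machine model

A real random access machine: finite programs over two-index arrays of natural numbers and of real
numbers. Addition and truncated subtraction of natural numbers, the field operations on reals
(with `x / 0 = 0`), comparisons, memory accesses and assignments cost one step each. There is no
rounding operation, and the only real constants of a program are rational. -/

/-- The memory: `nat a i j` is entry `(i, j)` of the array with name `a`, and similarly `real`. -/
structure Mem where
  nat : ℕ → ℕ → ℕ → ℕ
  real : ℕ → ℕ → ℕ → ℝ

/-- Expressions with a natural-number value; array names are static, indices are computed. -/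
inductive NExp where
  | const (c : ℕ)
  | get (a : ℕ) (i j : NExp)
  | add (x y : NExp)
  | sub (x y : NExp)

/-- Expressions with a real value. -/
inductive RExp where
  | const (c : ℚ)
  | ofNat (x : NExp)
  | get (a : ℕ) (i j : NExp)
  | add (x y : RExp)
  | sub (x y : RExp)
  | mul (x y : RExp)
  | div (x y : RExp)

/-- Tests. -/
inductive BExp where
  | natLe (x y : NExp)
  | realLe (x y : RExp)
  | not (b : BExp)
  | and (b c : BExp)

/-- Programs. -/
inductive Prog where
  | skip
  | setNat (a : ℕ) (i j : NExp) (e : NExp)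
  | setReal (a : ℕ) (i j : NExp) (e : RExp)
  | seq (p q : Prog)
  | ite (b : BExp) (p q : Prog)
  | loop (b : BExp) (p : Prog)

/-- The value of an expression. -/
def NExp.eval (μ : Mem) : NExp → ℕ
  | .const c => c
  | .get a i j => μ.nat a (i.eval μ) (j.eval μ)
  | .add x y => x.eval μ + y.eval μ
  | .sub x y => x.eval μ - y.eval μ

/-- The number of operations in an expression. -/
def NExp.cost : NExp → ℕ
  | .const _ => 1
  | .get _ i j => i.cost + j.cost + 1
  | .add x y => x.cost + y.cost + 1
  | .sub x y => x.cost + y.cost + 1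

/-- The value of an expression. -/
noncomputable def RExp.eval (μ : Mem) : RExp → ℝ
  | .const c => c
  | .ofNat x => x.eval μ
  | .get a i j => μ.real a (i.eval μ) (j.eval μ)
  | .add x y => x.eval μ + y.eval μ
  | .sub x y => x.eval μ - y.eval μ
  | .mul x y => x.eval μ * y.eval μ
  | .div x y => x.eval μ / y.eval μ

/-- The number of operations in an expression. -/
def RExp.cost : RExp → ℕ
  | .const _ => 1
  | .ofNat x => x.cost + 1
  | .get _ i j => i.cost + j.cost + 1
  | .add x y => x.cost + y.cost + 1
  | .sub x y => x.cost + y.cost + 1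
  | .mul x y => x.cost + y.cost + 1
  | .div x y => x.cost + y.cost + 1

/-- The truth value of a test. -/
def BExp.eval (μ : Mem) : BExp → Prop
  | .natLe x y => x.eval μ ≤ y.eval μ
  | .realLe x y => x.eval μ ≤ y.eval μ
  | .not b => ¬ b.eval μ
  | .and b c => b.eval μ ∧ c.eval μ

/-- The number of operations in a test. -/
def BExp.cost : BExp → ℕ
  | .natLe x y => x.cost + y.cost + 1
  | .realLe x y => x.cost + y.cost + 1
  | .not b => b.cost + 1
  | .and b c => b.cost + c.cost + 1

open Classical in
/-- Overwrite one natural-number entry. -/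
noncomputable def Mem.setNat (μ : Mem) (a i j v : ℕ) : Mem where
  nat a' i' j' := if a' = a ∧ i' = i ∧ j' = j then v else μ.nat a' i' j'
  real := μ.real

open Classical in
/-- Overwrite one real entry. -/
noncomputable def Mem.setReal (μ : Mem) (a i j : ℕ) (v : ℝ) : Mem where
  nat := μ.nat
  real a' i' j' := if a' = a ∧ i' = i ∧ j' = j then v else μ.real a' i' j'

/-- `Exec p μ ν s`: started in memory `μ`, the program `p` halts in memory `ν` after exactly
`s` steps. `loop b p` repeats `p` as long as the test `b` holds. -/
inductive Exec : Prog → Mem → Mem → ℕ → Prop where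
  | skip (μ : Mem) : Exec .skip μ μ 1
  | setNat (a : ℕ) (i j e : NExp) (μ : Mem) :
      Exec (.setNat a i j e) μ (μ.setNat a (i.eval μ) (j.eval μ) (e.eval μ))
        (i.cost + j.cost + e.cost + 1)
  | setReal (a : ℕ) (i j : NExp) (e : RExp) (μ : Mem) :
      Exec (.setReal a i j e) μ (μ.setReal a (i.eval μ) (j.eval μ) (e.eval μ))
        (i.cost + j.cost + e.cost + 1)
  | seq {p q : Prog} {μ ν ξ : Mem} {s r : ℕ} :
      Exec p μ ν s → Exec q ν ξ r → Exec (.seq p q) μ ξ (s + r)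
  | iteTrue {b : BExp} {p q : Prog} {μ ν : Mem} {s : ℕ} :
      b.eval μ → Exec p μ ν s → Exec (.ite b p q) μ ν (b.cost + s + 1)
  | iteFalse {b : BExp} {p q : Prog} {μ ν : Mem} {s : ℕ} :
      ¬ b.eval μ → Exec q μ ν s → Exec (.ite b p q) μ ν (b.cost + s + 1)
  | loopTrue {b : BExp} {p : Prog} {μ ν ξ : Mem} {s r : ℕ} :
      b.eval μ → Exec p μ ν s → Exec (.loop b p) ν ξ r →
        Exec (.loop b p) μ ξ (b.cost + s + r + 1)
  | loopFalse {b : BExp} {p : Prog} {μ : Mem} :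
      ¬ b.eval μ → Exec (.loop b p) μ μ (b.cost + 1)

/-- The result and the running time of a halting program are unique. -/
theorem Exec.deterministic {p : Prog} {μ ν ν' : Mem} {s s' : ℕ}
    (h : Exec p μ ν s) (h' : Exec p μ ν' s') : ν = ν' ∧ s = s' := by
  induction h generalizing ν' s' with
  | skip | setNat | setReal => cases h'; exact ⟨rfl, rfl⟩
  | seq _ _ ih₁ ih₂ =>
    cases h' with
    | seq g₁ g₂ =>
      obtain ⟨rfl, rfl⟩ := ih₁ g₁
      obtain ⟨rfl, rfl⟩ := ih₂ g₂
      exact ⟨rfl, rfl⟩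
  | iteTrue hb _ ih =>
    cases h' with
    | iteTrue _ g => obtain ⟨rfl, rfl⟩ := ih g; exact ⟨rfl, rfl⟩
    | iteFalse hb' _ => exact absurd hb hb'
  | iteFalse hb _ ih =>
    cases h' with
    | iteTrue hb' _ => exact absurd hb' hb
    | iteFalse _ g => obtain ⟨rfl, rfl⟩ := ih g; exact ⟨rfl, rfl⟩
  | loopTrue hb _ _ ih₁ ih₂ =>
    cases h' with
    | loopTrue _ g₁ g₂ =>
      obtain ⟨rfl, rfl⟩ := ih₁ g₁
      obtain ⟨rfl, rfl⟩ := ih₂ g₂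
      exact ⟨rfl, rfl⟩
    | loopFalse hb' => exact absurd hb hb'
  | loopFalse hb =>
    cases h' with
    | loopTrue hb' _ _ => exact absurd hb' hb
    | loopFalse _ => exact ⟨rfl, rfl⟩

/-! ## Input and output -/

/-- Entry `i` of an array given by a function on `Fin m`; zero beyond its end. -/
def entry {α : Type*} [Zero α] {m : ℕ} (f : Fin m → α) (i : ℕ) : α :=
  if h : i < m then f ⟨i, h⟩ else 0

/-- Entry `l` of a list of indices; zero beyond its end. -/
def listEntry {m : ℕ} (L : List (Fin m)) (l : ℕ) : ℕ := (L.map Fin.val).getD l 0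

/-- The bit string whose `l`-th entry is the `l`-th binary digit of `x`. -/
def bits (m x : ℕ) : Fin m → Fin 2 := fun l => if x.testBit l then 1 else 0

/-- The initial memory. The natural-number arrays hold
* `0`: the number of qubits, of terms, and of sites of the observable;
* `1`, `2`, `3`: for each term, the number of its sites, its sites, and its Pauli letters there;
* `4`, `5`: for each qubit, the number of terms acting on it, and the list of these terms;
* `6`: the sites of the observable.

The real arrays hold
* `0`: the time and the accuracy;
* `1`: for each term, its coefficients in the initial and in the target Hamiltonian;
* `2`, `3`: the real and imaginary parts of the entries of the observable's matrix;
* `4`: for each qubit, the real and imaginary parts of the two amplitudes of its state.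

All other entries are zero. -/
noncomputable def encode {n k : ℕ} (H : AdiabaticHamiltonian n k) (O : LocalObservable n k)
    (ψ : ProductState n) (t ε : ℝ) : Mem where
  nat
    | 0, 0, 0 => n
    | 0, 0, 1 => H.numTerms
    | 0, 0, 2 => O.numSites
    | 1, j, 0 => entry (fun j => (siteList (H.term j)).length) j
    | 2, j, l => entry (fun j => listEntry (siteList (H.term j)) l) j
    | 3, j, l =>
        entry (fun j => listEntry ((siteList (H.term j)).map (H.term j)) l) j
    | 4, q, 0 => entry (fun q => (H.termsAt q).length) q
    | 5, q, l => entry (fun q => listEntry (H.termsAt q) l) q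
    | 6, l, 0 => entry (fun l => (O.site l : ℕ)) l
    | _, _, _ => 0
  real
    | 0, 0, 0 => t
    | 0, 0, 1 => ε
    | 1, j, 0 => entry H.coeff₀ j
    | 1, j, 1 => entry H.coeff₁ j
    | 2, x, y => if x < 2 ^ O.numSites ∧ y < 2 ^ O.numSites
        then (O.mat (bits O.numSites x) (bits O.numSites y)).re else 0
    | 3, x, y => if x < 2 ^ O.numSites ∧ y < 2 ^ O.numSites
        then (O.mat (bits O.numSites x) (bits O.numSites y)).im else 0
    | 4, q, 0 => entry (fun q => (ψ.factor q 0).re) q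
    | 4, q, 1 => entry (fun q => (ψ.factor q 0).im) q
    | 4, q, 2 => entry (fun q => (ψ.factor q 1).re) q
    | 4, q, 3 => entry (fun q => (ψ.factor q 1).im) q
    | _, _, _ => 0

/-- The output of a halted program is entry `(0, 0)` of the real array `0`. -/
def Mem.output (μ : Mem) : ℝ := μ.real 0 0 0

/-! ## The running time -/

/-- `t* = 1 / (2 √(e 𝔡))`. -/
noncomputable def criticalTime (𝔡 : ℕ) : ℝ := 1 / (2 * √(Real.exp 1 * 𝔡))

/-- `((‖O‖/ε) t² e^{t²}) ^ (log ((ε/‖O‖)(1 - t/t*)) / log (t/t*))`, with `N = ‖O‖`.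
At `t = 0` the exponent evaluates to `0` and the whole expression to `1`. -/
noncomputable def runtimeScale (𝔡 : ℕ) (N t ε : ℝ) : ℝ :=
  (N / ε * t ^ 2 * Real.exp (t ^ 2)) ^
    (Real.log (ε / N * (1 - t / criticalTime 𝔡)) / Real.log (t / criticalTime 𝔡))

end AdiabaticSim

open AdiabaticSim

/-! The permitted running time is larger than it looks. If `M` is the order needed for accuracy `ε`,
roughly `log (‖O‖/ε) / log (1/t)`, then both the logarithm of the base and the exponent of
`runtimeScale` are at least of order `M`, so that `2 ^ (M ^ 2) ≤ runtimeScale ^ 4` once `M` exceeds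
a constant (`two_pow_sq_le_runtimeScale`). It therefore suffices to simulate with order `M` in `2 ^
O(M ^ 2)` steps, and a direct expansion into nested commutators achieves this.

Analysis. The interval `[0, t]` is cut into a constant number `J` of stages. Since `H` is affine in
time, the Heisenberg equation within a stage has a power series solution with a short recursion
(`taylor`). A commutator with the local Hamiltonian multiplies the norm bound of an operator on `w`
qubits by `O(w)` and enlarges its support by at most `k` qubits (`localSum_comm`), so the
coefficients grow like a binomial coefficient times a geometric sequence (`localSum_taylor`) and the
series converges for short stages. A truncated solution has a small residual, and unitarity turns
the residual into an error (`norm_heisenberg_sub_le`). The truncation order doubles from stage to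
stage, to compensate for the growth of supports and norms. With `J` large enough the total error is
at most a constant times `‖O‖ * t ^ M` (`norm_heis_sub_le`, `norm_heis_op_sub_le`).

Algorithm. The commutator of a Pauli string with a product operator is a sum of product operators,
one for each qubit common to both supports (`tens_commutator`). So the recursion `heis` can be run
on a queue of rows, each a scalar times a product of `2 × 2` matrices. Rows of the last stage are
evaluated in the product state. The sum of the accumulated value and the values of the waiting rows
is conserved (`Row.value_eq`), and the potential `Q ^ rank` bounds the number of rows
(`Row.sum_pow_rank_children`). With branching and depth both `O(M)`, there are at most `O(M) ^ O(M)
≤ 2 ^ O(M ^ 2)` rows.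

The operator norm is not available to the machine. The program finds `M` from the squared Frobenius
norm, which agrees with `‖O‖ ^ 2` up to a factor `4 ^ k` in both directions. -/

namespace AdiabaticSim

/-! ## A weakest-precondition calculus for the machine -/

namespace Prog

/-- A bound for the running time of a program none of whose loops makes more than `B` iterations
each time it is started. -/
def bnd (B : ℕ) : Prog → ℕ
  | .skip => 1
  | .setNat _ i j e => i.cost + j.cost + e.cost + 1
  | .setReal _ i j e => i.cost + j.cost + e.cost + 1
  | .seq p q => p.bnd B + q.bnd B
  | .ite b p q => b.cost + (p.bnd B + q.bnd B) + 1
  | .loop b p => (B + 1) * (b.cost + p.bnd B + 1)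

/-- The loops of a fixed program are nested to a fixed depth, so the time is polynomial in the
largest iteration count. A count of `2 ^ O(M ^ 2)` thus gives a time of the same form. -/
theorem exists_bnd_le (p : Prog) : ∃ c d : ℕ, ∀ B, p.bnd B ≤ c * (B + 1) ^ d := by
  have key : ∀ (c₁ d₁ c₂ d₂ B : ℕ), c₁ * (B + 1) ^ d₁ + c₂ * (B + 1) ^ d₂
      ≤ (c₁ + c₂) * (B + 1) ^ (d₁ + d₂) := by
    intro c₁ d₁ c₂ d₂ B
    rw [add_mul]
    gcongr <;> omega
  induction p with
  | skip => exact ⟨1, 0, fun B => by simp [bnd]⟩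
  | setNat a i j e => exact ⟨i.cost + j.cost + e.cost + 1, 0, fun B => by simp [bnd]⟩
  | setReal a i j e => exact ⟨i.cost + j.cost + e.cost + 1, 0, fun B => by simp [bnd]⟩
  | seq p q ihp ihq =>
    obtain ⟨c₁, d₁, h₁⟩ := ihp
    obtain ⟨c₂, d₂, h₂⟩ := ihq
    exact ⟨c₁ + c₂, d₁ + d₂, fun B => (add_le_add (h₁ B) (h₂ B)).trans (key _ _ _ _ _)⟩
  | ite b p q ihp ihq =>
    obtain ⟨c₁, d₁, h₁⟩ := ihp
    obtain ⟨c₂, d₂, h₂⟩ := ihq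
    refine ⟨b.cost + 1 + (c₁ + c₂), 0 + (d₁ + d₂), fun B => ?_⟩
    refine le_trans ?_ (key _ _ _ _ _)
    have := (add_le_add (h₁ B) (h₂ B)).trans (key _ _ _ _ _)
    simp only [bnd, pow_zero, mul_one]
    omega
  | loop b p ihp =>
    obtain ⟨c₁, d₁, h₁⟩ := ihp
    refine ⟨b.cost + 1 + c₁, (0 + d₁) + 1, fun B => ?_⟩
    have h := key (b.cost + 1) 0 c₁ d₁ B
    have h₁ := h₁ B
    simp only [bnd]
    calc (B + 1) * (b.cost + p.bnd B + 1)
        ≤ (B + 1) * ((b.cost + 1 + c₁) * (B + 1) ^ (0 + d₁)) := by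
          gcongr
          simp only [pow_zero, mul_one] at h
          omega
      _ = _ := by ring

/-- The arrays of natural numbers that a program may write to. -/
def natW : Prog → List ℕ
  | .skip => []
  | .setNat a _ _ _ => [a]
  | .setReal _ _ _ _ => []
  | .seq p q => p.natW ++ q.natW
  | .ite _ p q => p.natW ++ q.natW
  | .loop _ p => p.natW

/-- The arrays of reals that a program may write to. -/
def realW : Prog → List ℕ
  | .skip => []
  | .setNat _ _ _ _ => []
  | .setReal a _ _ _ => [a]
  | .seq p q => p.realW ++ q.realW
  | .ite _ p q => p.realW ++ q.realW
  | .loop _ p => p.realW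

end Prog

@[simp] theorem Mem.setNat_real (μ : Mem) (a i j v : ℕ) : (μ.setNat a i j v).real = μ.real := rfl

@[simp] theorem Mem.setReal_nat (μ : Mem) (a i j : ℕ) (v : ℝ) :
    (μ.setReal a i j v).nat = μ.nat := rfl

theorem Mem.setNat_nat_of_ne (μ : Mem) {a a' : ℕ} (i j v : ℕ) (h : a' ≠ a) :
    (μ.setNat a i j v).nat a' = μ.nat a' := by
  funext i' j'; simp [Mem.setNat, h]

theorem Mem.setReal_real_of_ne (μ : Mem) {a a' : ℕ} (i j : ℕ) (v : ℝ) (h : a' ≠ a) :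
    (μ.setReal a i j v).real a' = μ.real a' := by
  funext i' j'; simp [Mem.setReal, h]

theorem Mem.setNat_nat (μ : Mem) (a i j v a' i' j' : ℕ) :
    (μ.setNat a i j v).nat a' i' j' = if a' = a ∧ i' = i ∧ j' = j then v else μ.nat a' i' j' := by
  simp [Mem.setNat]

theorem Mem.setReal_real (μ : Mem) (a i j : ℕ) (v : ℝ) (a' i' j' : ℕ) :
    (μ.setReal a i j v).real a' i' j'
      = if a' = a ∧ i' = i ∧ j' = j then v else μ.real a' i' j' := by
  simp [Mem.setReal]

@[simp] theorem Mem.setNat_nat_self (μ : Mem) (a i j v : ℕ) :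
    (μ.setNat a i j v).nat a i j = v := by
  simp [Mem.setNat]

@[simp] theorem Mem.setReal_real_self (μ : Mem) (a i j : ℕ) (v : ℝ) :
    (μ.setReal a i j v).real a i j = v := by
  simp [Mem.setReal]

/-- Two memories agree outside the arrays that `p` writes to. -/
def Agree (p : Prog) (μ ν : Mem) : Prop :=
  (∀ a, a ∉ p.natW → ν.nat a = μ.nat a) ∧ ∀ a, a ∉ p.realW → ν.real a = μ.real a

theorem Agree.refl (p : Prog) (μ : Mem) : Agree p μ μ := ⟨fun _ _ => rfl, fun _ _ => rfl⟩

theorem Agree.trans {p : Prog} {μ ν ξ : Mem} (h : Agree p μ ν) (h' : Agree p ν ξ) :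
    Agree p μ ξ :=
  ⟨fun a ha => (h'.1 a ha).trans (h.1 a ha), fun a ha => (h'.2 a ha).trans (h.2 a ha)⟩

theorem Agree.mono {p q : Prog} {μ ν : Mem} (h : Agree p μ ν) (hn : p.natW ⊆ q.natW)
    (hr : p.realW ⊆ q.realW) : Agree q μ ν :=
  ⟨fun a ha => h.1 a fun h' => ha (hn h'), fun a ha => h.2 a fun h' => ha (hr h')⟩

/-- A frame rule: which arrays may change is read off the syntax, so the preservation of the input
and of other arrays reduces to checking finite lists. -/
theorem Exec.agree {p : Prog} {μ ν : Mem} {s : ℕ} (h : Exec p μ ν s) : Agree p μ ν := by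
  induction h with
  | skip => exact Agree.refl _ _
  | setNat a i j e μ =>
    refine ⟨fun a' ha => ?_, fun _ _ => rfl⟩
    exact Mem.setNat_nat_of_ne _ _ _ _ (by simpa [Prog.natW] using ha)
  | setReal a i j e μ =>
    refine ⟨fun _ _ => rfl, fun a' ha => ?_⟩
    exact Mem.setReal_real_of_ne _ _ _ _ (by simpa [Prog.realW] using ha)
  | seq _ _ ih₁ ih₂ =>
    exact (ih₁.mono (by simp [Prog.natW]) (by simp [Prog.realW])).trans
      (ih₂.mono (by simp [Prog.natW]) (by simp [Prog.realW]))
  | iteTrue _ _ ih => exact ih.mono (by simp [Prog.natW]) (by simp [Prog.realW])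
  | iteFalse _ _ ih => exact ih.mono (by simp [Prog.natW]) (by simp [Prog.realW])
  | loopTrue _ _ _ ih₁ ih₂ =>
    exact (ih₁.mono (by simp [Prog.natW]) (by simp [Prog.realW])).trans ih₂
  | loopFalse => exact Agree.refl _ _

/-- Started in `μ`, the program `p` halts in a memory that satisfies `Q`, within the time
`p.bnd B`. -/
def WP (B : ℕ) (p : Prog) (μ : Mem) (Q : Mem → Prop) : Prop :=
  ∃ ν s, Exec p μ ν s ∧ s ≤ p.bnd B ∧ Q ν

namespace WP

variable {B : ℕ} {p q : Prog} {b : BExp} {μ : Mem} {Q R : Mem → Prop}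

/-- The agreement of the two memories is handed to the continuation, so every use of this rule also
provides the frame. -/
theorem mono (h : WP B p μ Q) (hQ : ∀ ν, Agree p μ ν → Q ν → R ν) : WP B p μ R := by
  obtain ⟨ν, s, h₁, h₂, h₃⟩ := h
  exact ⟨ν, s, h₁, h₂, hQ ν h₁.agree h₃⟩

theorem skip (h : Q μ) : WP B .skip μ Q := ⟨μ, 1, .skip μ, le_rfl, h⟩

theorem setNat {a : ℕ} {i j e : NExp} (h : Q (μ.setNat a (i.eval μ) (j.eval μ) (e.eval μ))) :
    WP B (.setNat a i j e) μ Q := ⟨_, _, .setNat a i j e μ, le_rfl, h⟩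

theorem setReal {a : ℕ} {i j : NExp} {e : RExp}
    (h : Q (μ.setReal a (i.eval μ) (j.eval μ) (e.eval μ))) :
    WP B (.setReal a i j e) μ Q := ⟨_, _, .setReal a i j e μ, le_rfl, h⟩

theorem seq (h : WP B p μ fun ν => WP B q ν Q) : WP B (.seq p q) μ Q := by
  obtain ⟨ν, s, h₁, h₂, ξ, r, h₃, h₄, h₅⟩ := h
  exact ⟨ξ, s + r, .seq h₁ h₃, add_le_add h₂ h₄, h₅⟩

theorem ite (h₁ : b.eval μ → WP B p μ Q) (h₂ : ¬ b.eval μ → WP B q μ Q) :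
    WP B (.ite b p q) μ Q := by
  by_cases hb : b.eval μ
  · obtain ⟨ν, s, h, hs, hQ⟩ := h₁ hb
    exact ⟨ν, _, .iteTrue hb h, by simp only [Prog.bnd]; omega, hQ⟩
  · obtain ⟨ν, s, h, hs, hQ⟩ := h₂ hb
    exact ⟨ν, _, .iteFalse hb h, by simp only [Prog.bnd]; omega, hQ⟩

/-- The invariant carries the iteration number. Having to show `i < B` whenever the test holds gives
termination and the time bound together; the proof is by induction on the number `r` of iterations
still allowed. -/
theorem loop {I : ℕ → Mem → Prop} (h0 : I 0 μ)
    (hstep : ∀ i ν, I i ν → b.eval ν → i < B ∧ WP B p ν (I (i + 1))) :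
    WP B (.loop b p) μ fun ν => ∃ i, I i ν ∧ ¬ b.eval ν := by
  have key : ∀ r i ν, i + r = B → I i ν → ∃ ξ s, Exec (.loop b p) ν ξ s ∧
      s ≤ (r + 1) * (b.cost + p.bnd B + 1) ∧ ∃ i, I i ξ ∧ ¬ b.eval ξ := by
    intro r
    induction r with
    | zero =>
      intro i ν hi hI
      have hb : ¬ b.eval ν := fun hb => by have := (hstep i ν hI hb).1; omega
      exact ⟨ν, _, .loopFalse hb, by omega, i, hI, hb⟩
    | succ r ih =>
      intro i ν hi hI
      by_cases hb : b.eval ν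
      · obtain ⟨-, ν', s, h₁, h₂, h₃⟩ := hstep i ν hI hb
        obtain ⟨ξ, s', h₄, h₅, h₆⟩ := ih (i + 1) ν' (by omega) h₃
        refine ⟨ξ, _, .loopTrue hb h₁ h₄, ?_, h₆⟩
        calc b.cost + s + s' + 1 ≤ b.cost + p.bnd B + (r + 1) * (b.cost + p.bnd B + 1) + 1 := by
              omega
          _ = _ := by ring
      · exact ⟨ν, _, .loopFalse hb, by nlinarith, i, hI, hb⟩
  exact key B 0 μ (by omega) h0

end WP

/-- The scalar variable with name `a`. -/
abbrev NExp.var (a : ℕ) : NExp := .get a (.const 0) (.const 0)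

/-- `for v in [0, N) do p`. -/
def Prog.for (v : ℕ) (N : NExp) (p : Prog) : Prog :=
  .seq (.setNat v (.const 0) (.const 0) (.const 0))
    (.loop (.not (.natLe N (.var v)))
      (.seq p (.setNat v (.const 0) (.const 0) (.add (.var v) (.const 1)))))

@[simp] theorem Prog.natW_for (v : ℕ) (N : NExp) (p : Prog) :
    (Prog.for v N p).natW = v :: (p.natW ++ [v]) := rfl

@[simp] theorem Prog.realW_for (v : ℕ) (N : NExp) (p : Prog) :
    (Prog.for v N p).realW = p.realW := by
  simp [Prog.for, Prog.realW]

/-- The bound `N` is evaluated anew before each iteration, whence `hN` for all reachable memories.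
The invariant for `i + 1` is required after the increment of the counter, which comes after the
body. -/
theorem WP.for {B : ℕ} {p : Prog} {μ : Mem} {v n : ℕ} {N : NExp} (I : ℕ → Mem → Prop)
    (hB : n ≤ B) (hv : v ∉ p.natW)
    (hN : ∀ i ν, Agree (.for v N p) μ ν → I i ν → N.eval ν = n)
    (h0 : I 0 (μ.setNat v 0 0 0))
    (hstep : ∀ i < n, ∀ ν, Agree (.for v N p) μ ν → ν.nat v 0 0 = i → I i ν →
      WP B p ν fun ξ => I (i + 1) (ξ.setNat v 0 0 (i + 1))) :
    WP B (.for v N p) μ (I n) := by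
  refine WP.seq (WP.setNat ?_)
  refine WP.mono (WP.loop (I := fun i ν => i ≤ n ∧ Agree (.for v N p) μ ν ∧ ν.nat v 0 0 = i
    ∧ I i ν) ?_ ?_) ?_
  · refine ⟨Nat.zero_le _, ⟨fun a ha => ?_, fun a ha => rfl⟩, by simp [NExp.eval], h0⟩
    exact Mem.setNat_nat_of_ne _ _ _ _ (by rintro rfl; simp at ha)
  · rintro i ν ⟨-, hA, hi, hI⟩ hb
    have hlt : i < n := by
      simpa [BExp.eval, NExp.eval, hN i ν hA hI, hi] using hb
    refine ⟨by omega, WP.seq ((hstep i hlt ν hA hi hI).mono ?_)⟩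
    intro ξ hξ hI'
    refine WP.setNat ?_
    have hvi : ξ.nat v 0 0 = i := by rw [hξ.1 v hv]; exact hi
    simp only [NExp.eval, hvi]
    refine ⟨hlt, ?_, by simp, hI'⟩
    refine hA.trans ((hξ.mono (by simp [Prog.natW_for]) (by simp)).trans ?_)
    refine ⟨fun a ha => ?_, fun a ha => rfl⟩
    exact Mem.setNat_nat_of_ne _ _ _ _ (by rintro rfl; simp at ha)
  · rintro ν - ⟨i, ⟨hle, hA, hi, hI⟩, hb⟩
    have : i = n := by
      have h2 : n ≤ i := by simpa [BExp.eval, NExp.eval, hN i ν hA hI, hi] using hb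
      omega
    exact this ▸ hI

/-! ## Complex scalars and matrices in the memory -/

/-- An expression with a complex value. -/
structure CExp where
  re : RExp
  im : RExp

namespace CExp

/-- The value of an expression. -/
noncomputable def eval (μ : Mem) (z : CExp) : ℂ := ⟨z.re.eval μ, z.im.eval μ⟩

def add (z w : CExp) : CExp := ⟨.add z.re w.re, .add z.im w.im⟩

def sub (z w : CExp) : CExp := ⟨.sub z.re w.re, .sub z.im w.im⟩

def mul (z w : CExp) : CExp :=
  ⟨.sub (.mul z.re w.re) (.mul z.im w.im), .add (.mul z.re w.im) (.mul z.im w.re)⟩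

def conj (z : CExp) : CExp := ⟨z.re, .sub (.const 0) z.im⟩

/-- The Gaussian rational `x + y i`. -/
def const (x y : ℚ) : CExp := ⟨.const x, .const y⟩

/-- The complex entry whose real and imaginary parts are in the arrays `a` and `a + 1`. -/
def get (a : ℕ) (i j : NExp) : CExp := ⟨.get a i j, .get (a + 1) i j⟩

@[simp] theorem eval_add (μ : Mem) (z w : CExp) : (z.add w).eval μ = z.eval μ + w.eval μ := by
  apply Complex.ext <;> simp [eval, add, RExp.eval]

@[simp] theorem eval_sub (μ : Mem) (z w : CExp) : (z.sub w).eval μ = z.eval μ - w.eval μ := by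
  apply Complex.ext <;> simp [eval, sub, RExp.eval]

@[simp] theorem eval_mul (μ : Mem) (z w : CExp) : (z.mul w).eval μ = z.eval μ * w.eval μ := by
  apply Complex.ext <;> simp [eval, mul, RExp.eval]

@[simp] theorem eval_conj (μ : Mem) (z : CExp) : z.conj.eval μ = star (z.eval μ) := by
  apply Complex.ext <;> simp [eval, conj, RExp.eval]

end CExp

/-- The complex entry whose real and imaginary parts are in the arrays `a` and `a + 1`. -/
noncomputable def Mem.cplx (μ : Mem) (a i j : ℕ) : ℂ := ⟨μ.real a i j, μ.real (a + 1) i j⟩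

@[simp] theorem CExp.eval_get (μ : Mem) (a : ℕ) (i j : NExp) :
    (CExp.get a i j).eval μ = μ.cplx a (i.eval μ) (j.eval μ) := rfl

/-- An expression whose value is a `2 × 2` matrix. -/
abbrev MExp : Type := Fin 2 → Fin 2 → CExp

namespace MExp

/-- The value of an expression. -/
noncomputable def eval (μ : Mem) (A : MExp) : Matrix (Fin 2) (Fin 2) ℂ :=
  Matrix.of fun a b => (A a b).eval μ

def mul (A C : MExp) : MExp := fun a b => ((A a 0).mul (C 0 b)).add ((A a 1).mul (C 1 b))

def add (A C : MExp) : MExp := fun a b => (A a b).add (C a b)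

def sub (A C : MExp) : MExp := fun a b => (A a b).sub (C a b)

def one : MExp := fun a b => if a = b then .const 1 0 else .const 0 0

@[simp] theorem eval_mul (μ : Mem) (A C : MExp) : (A.mul C).eval μ = A.eval μ * C.eval μ := by
  ext a b; simp [eval, mul, Matrix.mul_apply]

@[simp] theorem eval_add (μ : Mem) (A C : MExp) : (A.add C).eval μ = A.eval μ + C.eval μ := by
  ext a b; simp [eval, add]

@[simp] theorem eval_sub (μ : Mem) (A C : MExp) : (A.sub C).eval μ = A.eval μ - C.eval μ := by
  ext a b; simp [eval, sub]

@[simp] theorem eval_one (μ : Mem) : one.eval μ = 1 := by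
  ext a b
  fin_cases a <;> fin_cases b <;> apply Complex.ext <;>
    simp [eval, one, CExp.eval, CExp.const, RExp.eval]

end MExp

/-- The `2 × 2` matrix with index `(i, j)`. The arrays `7`, …, `14` hold its difference from the
identity. -/
noncomputable def Mem.mat (μ : Mem) (i j : ℕ) : Matrix (Fin 2) (Fin 2) ℂ :=
  1 + !![μ.cplx 7 i j, μ.cplx 9 i j; μ.cplx 11 i j, μ.cplx 13 i j]

/-- The expression that reads the matrix with index `(i, j)`. -/
def MExp.get (i j : NExp) : MExp :=
  MExp.one.add fun a b => CExp.get (if a = 0 then if b = 0 then 7 else 9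
    else if b = 0 then 11 else 13) i j

@[simp] theorem MExp.eval_get (μ : Mem) (i j : NExp) :
    (MExp.get i j).eval μ = μ.mat (i.eval μ) (j.eval μ) := by
  rw [MExp.get, MExp.eval_add, MExp.eval_one, Mem.mat]
  congr 1
  ext a b
  fin_cases a <;> fin_cases b <;> simp [MExp.eval]

/-- Write a complex number. -/
def Prog.setC (a : ℕ) (i j : NExp) (z : CExp) : Prog :=
  .seq (.setReal a i j z.re) (.setReal (a + 1) i j z.im)

/-- The real part is written first, so the indices and the imaginary part are evaluated in an
already modified memory; `hz`, `hi` and `hj` say that this makes no difference. -/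
theorem WP.setC {B : ℕ} {μ : Mem} {Q : Mem → Prop} {a : ℕ} {i j : NExp} {z : CExp}
    (hz : ∀ v, z.im.eval (μ.setReal a (i.eval μ) (j.eval μ) v) = z.im.eval μ)
    (hi : ∀ v, i.eval (μ.setReal a (i.eval μ) (j.eval μ) v) = i.eval μ)
    (hj : ∀ v, j.eval (μ.setReal a (i.eval μ) (j.eval μ) v) = j.eval μ)
    (h : ∀ ν : Mem, ν.nat = μ.nat →
      ν.cplx a (i.eval μ) (j.eval μ) = z.eval μ →
      (∀ a' i' j', ¬ (i' = i.eval μ ∧ j' = j.eval μ) → ν.real a' i' j' = μ.real a' i' j') →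
      (∀ a', a' ≠ a → a' ≠ a + 1 → ν.real a' = μ.real a') → Q ν) :
    WP B (.setC a i j z) μ Q := by
  refine WP.seq (WP.setReal (WP.setReal (h _ rfl ?_ ?_ ?_)))
  · rw [hz, hi, hj]
    simp [Mem.cplx, Mem.setReal, CExp.eval]
  · intro a' i' j' h'
    rw [hz, hi, hj]
    have h1 : ∀ b, ¬ (a' = b ∧ i' = i.eval μ ∧ j' = j.eval μ) := fun b hb => h' hb.2
    simp [Mem.setReal, h1]
  · intro a' h1 h2
    rw [Mem.setReal_real_of_ne _ _ _ _ h2, Mem.setReal_real_of_ne _ _ _ _ h1]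

@[simp] theorem Mem.setReal_congr_nexp (μ : Mem) (a i j : ℕ) (v : ℝ) (e : NExp) :
    e.eval (μ.setReal a i j v) = e.eval μ := by
  induction e with
  | const c => rfl
  | get a i j hi hj => simp [NExp.eval, hi, hj]
  | add x y hx hy => simp [NExp.eval, hx, hy]
  | sub x y hx hy => simp [NExp.eval, hx, hy]

theorem NExp.eval_congr {μ ν : Mem} (h : ν.nat = μ.nat) (e : NExp) : e.eval ν = e.eval μ := by
  induction e with
  | const c => rfl
  | get a i j hi hj => simp [NExp.eval, hi, hj, h]
  | add x y hx hy => simp [NExp.eval, hx, hy]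
  | sub x y hx hy => simp [NExp.eval, hx, hy]

/-- Write the matrix with index `(i, j)`. -/
def Prog.setMat (i j : NExp) (A : MExp) : Prog :=
  .seq (.setC 7 i j ((A 0 0).sub (.const 1 0))) (.seq (.setC 9 i j (A 0 1))
    (.seq (.setC 11 i j (A 1 0)) (.setC 13 i j ((A 1 1).sub (.const 1 0)))))

/-- The four entries are written one after the other. Hypothesis `hA` demands that the expression
not read the entry under construction; in the program it reads another row of the queue. -/
theorem WP.setMat {B : ℕ} {μ : Mem} {Q : Mem → Prop} {i j : NExp} {A : MExp}
    (hA : ∀ ν : Mem, ν.nat = μ.nat →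
      (∀ a' i' j', ¬ (i' = i.eval μ ∧ j' = j.eval μ) → ν.real a' i' j' = μ.real a' i' j') →
      ∀ a b, (A a b).re.eval ν = (A a b).re.eval μ ∧ (A a b).im.eval ν = (A a b).im.eval μ)
    (h : ∀ ν : Mem, ν.nat = μ.nat →
      ν.mat (i.eval μ) (j.eval μ) = A.eval μ →
      (∀ a' i' j', ¬ (i' = i.eval μ ∧ j' = j.eval μ) → ν.real a' i' j' = μ.real a' i' j') →
      (∀ a', a' < 7 ∨ 14 < a' → ν.real a' = μ.real a') → Q ν) :
    WP B (.setMat i j A) μ Q := by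
  have keep : ∀ {ν : Mem} (a : ℕ) (v : ℝ),
      (∀ a' i' j', ¬ (i' = i.eval μ ∧ j' = j.eval μ) → ν.real a' i' j' = μ.real a' i' j') →
      ∀ a' i' j', ¬ (i' = i.eval μ ∧ j' = j.eval μ) →
        (ν.setReal a (i.eval μ) (j.eval μ) v).real a' i' j' = μ.real a' i' j' := by
    intro ν a v hν a' i' j' h'
    rw [Mem.setReal_real, if_neg fun h => h' h.2, hν _ _ _ h']
  have i0 : ∀ {ν : Mem}, ν.nat = μ.nat → i.eval ν = i.eval μ := fun h => NExp.eval_congr h i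
  have j0 : ∀ {ν : Mem}, ν.nat = μ.nat → j.eval ν = j.eval μ := fun h => NExp.eval_congr h j
  have r0 : ∀ a' i' j', ¬ (i' = i.eval μ ∧ j' = j.eval μ) → μ.real a' i' j' = μ.real a' i' j' :=
    fun _ _ _ _ => rfl
  refine WP.seq (WP.setC (fun v => ?_) (by simp) (by simp) ?_)
  · simp [CExp.sub, RExp.eval, CExp.const, (hA _ (Mem.setReal_nat _ _ _ _ _) (keep 7 v r0) 0 0).2]
  intro ν₁ n₁ c₁ r₁ s₁
  refine WP.seq (WP.setC (fun v => ?_) (by simp) (by simp) ?_)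
  · rw [i0 n₁, j0 n₁, (hA (Mem.setReal ν₁ 9 (i.eval μ) (j.eval μ) v) n₁ (keep 9 v r₁) 0 1).2, (hA _ n₁ r₁ 0 1).2]
  rw [i0 n₁, j0 n₁]
  intro ν₂ n₂ c₂ r₂ s₂
  replace n₂ := n₂.trans n₁
  replace r₂ : ∀ a' i' j', ¬ (i' = i.eval μ ∧ j' = j.eval μ) → ν₂.real a' i' j' = μ.real a' i' j' :=
    fun a' i' j' h => (r₂ a' i' j' h).trans (r₁ a' i' j' h)
  refine WP.seq (WP.setC (fun v => ?_) (by simp) (by simp) ?_)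
  · rw [i0 n₂, j0 n₂, (hA (Mem.setReal ν₂ 11 (i.eval μ) (j.eval μ) v) n₂ (keep 11 v r₂) 1 0).2, (hA _ n₂ r₂ 1 0).2]
  rw [i0 n₂, j0 n₂]
  intro ν₃ n₃ c₃ r₃ s₃
  replace n₃ := n₃.trans n₂
  replace r₃ : ∀ a' i' j', ¬ (i' = i.eval μ ∧ j' = j.eval μ) → ν₃.real a' i' j' = μ.real a' i' j' :=
    fun a' i' j' h => (r₃ a' i' j' h).trans (r₂ a' i' j' h)
  refine WP.setC (fun v => ?_) (by simp) (by simp) ?_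
  · rw [i0 n₃, j0 n₃]
    simp [CExp.sub, RExp.eval, CExp.const, (hA (Mem.setReal ν₃ 13 (i.eval μ) (j.eval μ) v) n₃ (keep 13 v r₃) 1 1).2, (hA _ n₃ r₃ 1 1).2]
  rw [i0 n₃, j0 n₃]
  intro ν₄ n₄ c₄ r₄ s₄
  have cc : ∀ {ν ξ : Mem} (a : ℕ), ν.real a = ξ.real a → ν.real (a + 1) = ξ.real (a + 1) →
      ∀ i j, ν.cplx a i j = ξ.cplx a i j := fun a h h' i j => by simp [Mem.cplx, h, h']
  have ev : ∀ {ν : Mem}, ν.nat = μ.nat →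
      (∀ a' i' j', ¬ (i' = i.eval μ ∧ j' = j.eval μ) → ν.real a' i' j' = μ.real a' i' j') →
      ∀ a b, (A a b).eval ν = (A a b).eval μ := fun hn hr a b => by
    simp [CExp.eval, hA _ hn hr a b]
  refine h ν₄ (n₄.trans n₃) ?_ (fun a' i' j' h => (r₄ a' i' j' h).trans (r₃ a' i' j' h)) ?_
  · have e7 : ν₄.cplx 7 (i.eval μ) (j.eval μ) = (A 0 0).eval μ - 1 := by
      rw [cc 7 (s₄ _ (by simp) (by simp)) (s₄ _ (by simp) (by simp)),
        cc 7 (s₃ _ (by simp) (by simp)) (s₃ _ (by simp) (by simp)),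
        cc 7 (s₂ _ (by simp) (by simp)) (s₂ _ (by simp) (by simp)), c₁]
      rw [CExp.eval_sub]
      congr 1
      apply Complex.ext <;> simp [CExp.eval, CExp.const, RExp.eval]
    have e9 : ν₄.cplx 9 (i.eval μ) (j.eval μ) = (A 0 1).eval μ := by
      rw [cc 9 (s₄ _ (by simp) (by simp)) (s₄ _ (by simp) (by simp)),
        cc 9 (s₃ _ (by simp) (by simp)) (s₃ _ (by simp) (by simp)), c₂, ev n₁ r₁]
    have e11 : ν₄.cplx 11 (i.eval μ) (j.eval μ) = (A 1 0).eval μ := by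
      rw [cc 11 (s₄ _ (by simp) (by simp)) (s₄ _ (by simp) (by simp)), c₃, ev n₂ r₂]
    have e13 : ν₄.cplx 13 (i.eval μ) (j.eval μ) = (A 1 1).eval μ - 1 := by
      rw [c₄, CExp.eval_sub, ev n₃ r₃]
      congr 1
      apply Complex.ext <;> simp [CExp.eval, CExp.const, RExp.eval]
    rw [Mem.mat, e7, e9, e11, e13]
    ext a b
    fin_cases a <;> fin_cases b <;> simp [MExp.eval]
  · intro a' ha'
    rw [s₄ a' (by omega) (by omega), s₃ a' (by omega) (by omega), s₂ a' (by omega) (by omega),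
      s₁ a' (by omega) (by omega)]

end AdiabaticSim

namespace AdiabaticSim

open scoped Matrix

/-! ## Product operators -/

/-- A partial isometry has norm at most one. -/
theorem norm_le_one_of_partialIsometry {E : Type*} [NormedAddCommGroup E] [InnerProductSpace ℂ E]
    [CompleteSpace E] (T : E →L[ℂ] E)
    (hT : (ContinuousLinearMap.adjoint T * T) * (ContinuousLinearMap.adjoint T * T)
      = ContinuousLinearMap.adjoint T * T) : ‖T‖ ≤ 1 := by
  rw [← ContinuousLinearMap.star_eq_adjoint] at hT
  have h2 : ‖star T * T‖ = ‖T‖ * ‖T‖ := CStarRing.norm_star_mul_self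
  have hs : star (star T * T) = star T * T := by rw [star_mul, star_star]
  -- `star T * T` is a selfadjoint idempotent, so by the C*-identity its norm equals its own square.
  have h1 : ‖star T * T‖ * ‖star T * T‖ = ‖star T * T‖ := by
    rw [← CStarRing.norm_star_mul_self, hs, hT]
  have h3 : ‖star T * T‖ ≤ 1 := by
    by_contra! h
    nlinarith
  nlinarith [norm_nonneg T]

theorem QOp.smul_zero {n : ℕ} (c : ℂ) : c • (0 : QOp n) = 0 := by
  ext1 v
  exact _root_.smul_zero c

section Tensor

variable {n : ℕ}

/-- The product operator `A₀ ⊗ ⋯ ⊗ A_{n-1}`. -/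
noncomputable def tens (A : Fin n → Matrix (Fin 2) (Fin 2) ℂ) : QOp n :=
  Matrix.toEuclideanCLM (𝕜 := ℂ) (Matrix.of fun x y : Fin n → Fin 2 => ∏ i, A i (x i) (y i))

theorem pauliOp_eq_tens (P : Fin n → Fin 4) : pauliOp P = tens fun i => pauli (P i) := rfl

theorem tens_mul (A C : Fin n → Matrix (Fin 2) (Fin 2) ℂ) :
    tens A * tens C = tens fun i => A i * C i := by
  rw [tens, tens, tens, ← map_mul]
  congr 1
  ext x y
  simp only [Matrix.mul_apply, Matrix.of_apply, Finset.prod_univ_sum, Fintype.piFinset_univ,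
    Finset.prod_mul_distrib]

theorem tens_one : tens (fun _ : Fin n => (1 : Matrix (Fin 2) (Fin 2) ℂ)) = 1 := by
  rw [tens, ← map_one (Matrix.toEuclideanCLM (n := Fin n → Fin 2) (𝕜 := ℂ))]
  congr 1
  ext x y
  simp only [Matrix.of_apply, Matrix.one_apply, Finset.prod_ite_zero, Finset.prod_const_one,
    Finset.mem_univ, true_imp_iff, funext_iff]

theorem star_tens (A : Fin n → Matrix (Fin 2) (Fin 2) ℂ) :
    star (tens A) = tens fun i => (A i)ᴴ := by
  rw [tens, tens, ← map_star]
  congr 1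
  ext x y
  simp [Matrix.star_apply, Matrix.conjTranspose_apply]

/-- A product of partial isometries has norm at most one. -/
theorem norm_tens_le_one (A : Fin n → Matrix (Fin 2) (Fin 2) ℂ)
    (hA : ∀ i, IsIdempotentElem ((A i)ᴴ * A i)) : ‖tens A‖ ≤ 1 := by
  refine norm_le_one_of_partialIsometry (tens A) ?_
  rw [← ContinuousLinearMap.star_eq_adjoint, star_tens, tens_mul, tens_mul]
  congr 1
  funext i
  exact hA i

theorem pauli_mul_self (a : Fin 4) : pauli a * pauli a = 1 := by
  fin_cases a <;> ext i j <;> fin_cases i <;> fin_cases j <;>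
    simp [pauli, Matrix.mul_apply]

theorem pauli_conjTranspose (a : Fin 4) : (pauli a)ᴴ = pauli a := by
  fin_cases a <;> ext i j <;> fin_cases i <;> fin_cases j <;>
    simp [pauli, Matrix.conjTranspose_apply]

@[simp] theorem pauli_zero : pauli 0 = 1 := rfl

theorem norm_pauliOp_le_one (P : Fin n → Fin 4) : ‖pauliOp P‖ ≤ 1 := by
  rw [pauliOp_eq_tens]
  refine norm_tens_le_one _ fun i => ?_
  simp [IsIdempotentElem, pauli_conjTranspose, pauli_mul_self]

theorem star_pauliOp (P : Fin n → Fin 4) : star (pauliOp P) = pauliOp P := by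
  simp only [pauliOp_eq_tens, star_tens, pauli_conjTranspose]

/-- The part at `q` of the telescoped commutator of two product operators. -/
noncomputable def commFactor (σ A : Fin n → Matrix (Fin 2) (Fin 2) ℂ) (q : Fin n) :
    Fin n → Matrix (Fin 2) (Fin 2) ℂ := fun i =>
  if i < q then σ i * A i else if q < i then A i * σ i else σ i * A i - A i * σ i

/-- Turn `A σ` into `σ A` in one tensor factor after another: each change contributes a product
operator with a commutator at a single qubit. Hence nested commutators never leave the sums of
product operators. -/
theorem tens_commutator (σ A : Fin n → Matrix (Fin 2) (Fin 2) ℂ) :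
    tens σ * tens A - tens A * tens σ = ∑ q, tens (commFactor σ A q) := by
  rw [tens_mul, tens_mul]
  simp only [tens]
  rw [← map_sub, ← map_sum]
  congr 1
  ext x y
  simp only [Matrix.sub_apply, Matrix.of_apply, Matrix.sum_apply]
  -- Expands `∏ (f i + g i)` with `f = A σ` and `g = [σ, A]`, so that `f + g = σ A`: the factors
  -- before the chosen index are `f + g`, those after it are `f`.
  have h := Finset.prod_add_ordered (Finset.univ : Finset (Fin n))
    (fun i => (A i * σ i) (x i) (y i)) (fun i => (σ i * A i - A i * σ i) (x i) (y i))
  simp only [Matrix.sub_apply, add_sub_cancel] at h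
  rw [h, add_sub_cancel_left]
  refine Finset.sum_congr rfl fun q _ => ?_
  have hq : (Finset.univ : Finset (Fin n)) = insert q
      ((Finset.univ.filter (· < q)) ∪ Finset.univ.filter (q < ·)) := by
    ext i
    simp only [Finset.mem_univ, Finset.mem_insert, Finset.mem_union, Finset.mem_filter, true_and,
      true_iff]
    rcases lt_trichotomy i q with h | h | h <;> simp [h]
  rw [hq, Finset.prod_insert (by simp), Finset.prod_union, mul_assoc]
  · congr 1
    · simp [commFactor]
    · congr 1
      · rw [← hq]
        refine Finset.prod_congr rfl fun i hi => ?_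
        simp only [Finset.mem_filter, Finset.mem_univ, true_and] at hi
        simp [commFactor, hi]
      · rw [← hq]
        refine Finset.prod_congr rfl fun i hi => ?_
        simp only [Finset.mem_filter, Finset.mem_univ, true_and] at hi
        simp [commFactor, hi, hi.not_gt]
  · rw [Finset.disjoint_left]
    intro i hi hi'
    simp only [Finset.mem_filter, Finset.mem_univ, true_and] at hi hi'
    exact lt_asymm hi hi'

theorem tens_eq_zero {A : Fin n → Matrix (Fin 2) (Fin 2) ℂ} (q : Fin n) (h : A q = 0) :
    tens A = 0 := by
  rw [tens, ← map_zero (Matrix.toEuclideanCLM (n := Fin n → Fin 2) (𝕜 := ℂ))]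
  congr 1
  ext x y
  simp only [Matrix.of_apply, Matrix.zero_apply]
  exact Finset.prod_eq_zero (Finset.mem_univ q) (by simp [h])

theorem commFactor_self (σ A : Fin n → Matrix (Fin 2) (Fin 2) ℂ) (q : Fin n) :
    commFactor σ A q q = σ q * A q - A q * σ q := by
  simp [commFactor]

/-- `⟨v|A|v⟩` for one qubit. -/
noncomputable def qubitExpect (v : EuclideanSpace ℂ (Fin 2)) (A : Matrix (Fin 2) (Fin 2) ℂ) : ℂ :=
  ∑ a, ∑ b, star (v a) * (A a b * v b)

theorem qubitExpect_one {v : EuclideanSpace ℂ (Fin 2)} (hv : ‖v‖ = 1) : qubitExpect v 1 = 1 := by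
  have h : inner ℂ v v = (1 : ℂ) := by rw [inner_self_eq_norm_sq_to_K, hv]; simp
  rw [PiLp.inner_apply] at h
  rw [← h]
  simp [qubitExpect, Matrix.one_apply, mul_comm, -Complex.inner, RCLike.inner_apply, -inner_self_eq_norm_sq_to_K]

theorem inner_tens (ψ : ProductState n) (A : Fin n → Matrix (Fin 2) (Fin 2) ℂ) :
    inner ℂ ψ.vec (tens A ψ.vec) = ∏ q, qubitExpect (ψ.factor q) (A q) := by
  simp only [qubitExpect, Finset.prod_univ_sum, Fintype.piFinset_univ]
  rw [PiLp.inner_apply]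
  refine Finset.sum_congr rfl fun x _ => ?_
  rw [tens, Matrix.ofLp_toEuclideanCLM]
  simp only [ProductState.vec, Matrix.mulVec, dotProduct, RCLike.inner_apply, Finset.sum_mul,
    Matrix.of_apply]
  refine Finset.sum_congr rfl fun y _ => ?_
  rw [← Finset.prod_mul_distrib, map_prod, ← Finset.prod_mul_distrib]
  refine Finset.prod_congr rfl fun q _ => ?_
  simp only [starRingEnd_apply]
  ring

theorem norm_vec (ψ : ProductState n) : ‖ψ.vec‖ = 1 := by
  have h := inner_tens ψ fun _ => 1
  rw [tens_one] at h
  simp only [qubitExpect_one (ψ.norm_factor _), Finset.prod_const_one,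
    one_apply_eq_self] at h
  rw [inner_self_eq_norm_sq_to_K] at h
  have h' : ‖ψ.vec‖ ^ 2 = 1 := Complex.ofReal_injective (by push_cast; exact h)
  nlinarith [norm_nonneg ψ.vec]

end Tensor

/-! ## Local operators -/

section Local

variable {n : ℕ}

/-- An operator that commutes with every Pauli string acting trivially on `S`. -/
def LocalOn (S : Finset (Fin n)) (T : QOp n) : Prop :=
  ∀ P : Fin n → Fin 4, (∀ q ∈ S, P q = 0) → Commute (pauliOp P) T

theorem LocalOn.mono {S S' : Finset (Fin n)} {T : QOp n} (h : LocalOn S T) (hS : S ⊆ S') :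
    LocalOn S' T := fun P hP => h P fun q hq => hP q (hS hq)

theorem localOn_tens {S : Finset (Fin n)} {A : Fin n → Matrix (Fin 2) (Fin 2) ℂ}
    (hA : ∀ q ∉ S, A q = 1) : LocalOn S (tens A) := by
  intro P hP
  rw [Commute, SemiconjBy, pauliOp_eq_tens, tens_mul, tens_mul]
  congr 1
  funext q
  by_cases hq : q ∈ S
  · simp [hP q hq]
  · simp [hA q hq]

/-- The qubits on which a Pauli string acts nontrivially. -/
def pauliSupport (P : Fin n → Fin 4) : Finset (Fin n) := Finset.univ.filter fun q => P q ≠ 0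

theorem mem_siteList {P : Fin n → Fin 4} {q : Fin n} : q ∈ siteList P ↔ P q ≠ 0 := by
  simp [siteList]

theorem nodup_siteList (P : Fin n → Fin 4) : (siteList P).Nodup :=
  (List.nodup_finRange n).filter _

theorem card_pauliSupport (P : Fin n → Fin 4) :
    (pauliSupport P).card = (siteList P).length := by
  have : pauliSupport P = (siteList P).toFinset := by
    ext q; simp [pauliSupport, mem_siteList]
  rw [this, List.toFinset_card_of_nodup (nodup_siteList P)]

theorem localOn_pauliOp (P : Fin n → Fin 4) : LocalOn (pauliSupport P) (pauliOp P) := by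
  rw [pauliOp_eq_tens]
  refine localOn_tens fun q hq => ?_
  have : P q = 0 := by simpa [pauliSupport] using hq
  simp [this]

/-- Sums of operators on at most `w` qubits each, with total norm at most `b`. -/
inductive LocalSum (w : ℕ) : ℝ → QOp n → Prop
  | of {b : ℝ} {T : QOp n} (S : Finset (Fin n)) : S.card ≤ w → LocalOn S T → ‖T‖ ≤ b →
      LocalSum w b T
  | add {b b' : ℝ} {T T' : QOp n} : LocalSum w b T → LocalSum w b' T' →
      LocalSum w (b + b') (T + T')

namespace LocalSum

variable {w w' : ℕ} {b b' : ℝ} {T T' : QOp n}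

theorem norm_le (h : LocalSum w b T) : ‖T‖ ≤ b := by
  induction h with
  | of S _ _ h => exact h
  | add _ _ ih ih' => exact (norm_add_le _ _).trans (add_le_add ih ih')

theorem nonneg (h : LocalSum w b T) : 0 ≤ b := (norm_nonneg _).trans h.norm_le

theorem zero (hb : 0 ≤ b) : LocalSum w b (0 : QOp n) :=
  .of ∅ (by simp) (fun _ _ => Commute.zero_right _) (by simpa using hb)

theorem mono (h : LocalSum w b T) (hw : w ≤ w') (hb : b ≤ b') : LocalSum w' b' T := by
  have h1 : LocalSum w' b T := by
    clear hb
    induction h with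
    | of S h₁ h₂ h₃ => exact .of S (h₁.trans hw) h₂ h₃
    | add _ _ ih ih' => exact .add ih ih'
  -- Bounds add up exactly along `LocalSum`, so the slack `b' - b` is attributed to an extra zero
  -- operator.
  have h2 := h1.add (zero (w := w') (sub_nonneg.2 hb))
  rwa [add_zero, add_sub_cancel] at h2

theorem smul (h : LocalSum w b T) (c : ℂ) : LocalSum w (‖c‖ * b) (c • T) := by
  induction h with
  | of S h₁ h₂ h₃ =>
    refine .of S h₁ (fun P hP => (h₂ P hP).smul_right c) ?_
    rw [norm_smul]
    gcongr
  | add _ _ ih ih' => rw [smul_add, mul_add]; exact .add ih ih'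

theorem sum {ι : Type*} (s : Finset ι) {f : ι → QOp n} {g : ι → ℝ}
    (h : ∀ i ∈ s, LocalSum w (g i) (f i)) : LocalSum w (∑ i ∈ s, g i) (∑ i ∈ s, f i) := by
  classical
  induction s using Finset.induction_on with
  | empty => simpa using zero le_rfl
  | insert a s ha ih =>
    rw [Finset.sum_insert ha, Finset.sum_insert ha]
    exact .add (h a (by simp)) (ih fun i hi => h i (by simp [hi]))

end LocalSum

end Local

/-! ### Commutators with a local Hamiltonian -/

namespace AdiabaticHamiltonian

variable {n k : ℕ} (H : AdiabaticHamiltonian n k)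

/-- `∑ⱼ γⱼ hⱼ`. -/
noncomputable def localHam (γ : Fin H.numTerms → ℝ) : QOp n :=
  ∑ j, (γ j : ℂ) • pauliOp (H.term j)

/-- `T ↦ i [∑ⱼ γⱼ hⱼ, T]`. -/
noncomputable def comm (γ : Fin H.numTerms → ℝ) : QOp n →ₗ[ℂ] QOp n :=
  Complex.I • (LinearMap.mulLeft ℂ (H.localHam γ) - LinearMap.mulRight ℂ (H.localHam γ))

theorem comm_apply (γ : Fin H.numTerms → ℝ) (T : QOp n) :
    H.comm γ T = Complex.I • (H.localHam γ * T - T * H.localHam γ) := rfl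

theorem comm_apply_eq_sum (γ : Fin H.numTerms → ℝ) (T : QOp n) :
    H.comm γ T = ∑ j, (Complex.I * γ j) •
      (pauliOp (H.term j) * T - T * pauliOp (H.term j)) := by
  rw [comm_apply, localHam, Finset.sum_mul, Finset.mul_sum, ← Finset.sum_sub_distrib,
    Finset.smul_sum]
  refine Finset.sum_congr rfl fun j _ => ?_
  rw [smul_mul_assoc, mul_smul_comm]
  module

theorem mem_termsAt {q : Fin n} {j : Fin H.numTerms} : j ∈ H.termsAt q ↔ H.term j q ≠ 0 := by
  simp [termsAt]

theorem nodup_termsAt (q : Fin n) : (H.termsAt q).Nodup := (List.nodup_finRange _).filter _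

/-- The terms through one qubit are pairwise adjacent, hence all but one of them are neighbours of
that one. -/
theorem length_termsAt_le (q : Fin n) : (H.termsAt q).length ≤ H.maxDegree + 1 := by
  classical
  rw [← List.toFinset_card_of_nodup (H.nodup_termsAt q)]
  rcases (H.termsAt q).toFinset.eq_empty_or_nonempty with h | ⟨j, hj⟩
  · simp [h]
  · have hj' : H.term j q ≠ 0 := by simpa [mem_termsAt] using hj
    have hsub : (H.termsAt q).toFinset.erase j ⊆ H.interactionGraph.neighborFinset j := by
      intro i hi
      simp only [Finset.mem_erase, List.mem_toFinset, mem_termsAt] at hi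
      rw [SimpleGraph.mem_neighborFinset]
      exact ⟨hi.1.symm, q, hj', hi.2⟩
    have h1 := Finset.card_le_card hsub
    rw [SimpleGraph.card_neighborFinset_eq_degree, Finset.card_erase_of_mem hj] at h1
    have h2 : H.interactionGraph.degree j ≤ H.maxDegree := by
      unfold maxDegree
      convert H.interactionGraph.degree_le_maxDegree j
    omega

/-- Only the terms that meet the support contribute, and these are at most `D * w`, independently of
`n`. Each commutator costs a factor `2 * g` in norm and adds the at most `k` qubits of its term to
the support. -/
theorem localSum_comm {γ : Fin H.numTerms → ℝ} {g : ℝ} (hγ : ∀ j, |γ j| ≤ g) {D K : ℕ}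
    (hD : H.maxDegree + 1 ≤ D) (hK : k ≤ K) (hg : 0 ≤ g) {w : ℕ} {b : ℝ} {T : QOp n}
    (hT : LocalSum w b T) : LocalSum (w + K) (g * (2 * D) * w * b) (H.comm γ T) := by
  classical
  induction hT with
  | @of b T S hS hl hb =>
    have hb0 : 0 ≤ b := (norm_nonneg _).trans hb
    set J : Finset (Fin H.numTerms) := S.biUnion fun q => (H.termsAt q).toFinset with hJ
    have hcard : J.card ≤ D * w := by
      refine Finset.card_biUnion_le.trans ?_
      calc ∑ q ∈ S, (H.termsAt q).toFinset.card ≤ ∑ q ∈ S, D := by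
            refine Finset.sum_le_sum fun q _ => ?_
            rw [List.toFinset_card_of_nodup (H.nodup_termsAt q)]
            exact (H.length_termsAt_le q).trans hD
        _ ≤ D * w := by
            rw [Finset.sum_const, smul_eq_mul, mul_comm]
            gcongr
    -- A term off `S` is itself one of the Pauli strings with which `T` commutes by `LocalOn`.
    have hz : ∀ j ∉ J, pauliOp (H.term j) * T - T * pauliOp (H.term j) = 0 := by
      intro j hj
      refine sub_eq_zero.2 (hl _ fun q hq => ?_)
      by_contra hne
      exact hj (by simp only [hJ, Finset.mem_biUnion, List.mem_toFinset, mem_termsAt]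
                   exact ⟨q, hq, hne⟩)
    rw [comm_apply_eq_sum, ← Finset.sum_subset (Finset.subset_univ J)
      fun j _ hj => by rw [hz j hj, QOp.smul_zero]]
    refine (LocalSum.sum (w := w + K) (g := fun _ => g * 2 * b) J fun j _ => ?_).mono le_rfl ?_
    · refine .of (S ∪ pauliSupport (H.term j)) ?_ ?_ ?_
      · refine (Finset.card_union_le _ _).trans ?_
        have := H.term_local j
        rw [card_pauliSupport]
        omega
      · have h1 := hl.mono (Finset.subset_union_left (s₁ := S) (s₂ := pauliSupport (H.term j)))
        have h2 := (localOn_pauliOp (H.term j)).mono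
          (Finset.subset_union_right (s₁ := S) (s₂ := pauliSupport (H.term j)))
        intro P hP
        exact (((h2 P hP).mul_right (h1 P hP)).sub_right
          ((h1 P hP).mul_right (h2 P hP))).smul_right _
      · have h1 := norm_pauliOp_le_one (H.term j)
        have h2 : ‖Complex.I * (γ j : ℂ)‖ ≤ g := by simpa using hγ j
        have h3 : ‖pauliOp (H.term j) * T - T * pauliOp (H.term j)‖ ≤ 2 * b := by
          refine (norm_sub_le _ _).trans ?_
          have h4 := norm_mul_le (pauliOp (H.term j)) T
          have h5 := norm_mul_le T (pauliOp (H.term j))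
          nlinarith [norm_nonneg T, norm_nonneg (pauliOp (H.term j))]
        rw [norm_smul, mul_assoc]
        gcongr
    · rw [Finset.sum_const, nsmul_eq_mul]
      have : (J.card : ℝ) ≤ D * w := by exact_mod_cast hcard
      calc (J.card : ℝ) * (g * 2 * b) ≤ (D * w) * (g * 2 * b) := by gcongr
        _ = _ := by ring
  | add _ _ ih ih' =>
    rw [map_add, mul_add]
    exact .add ih ih'

end AdiabaticHamiltonian

end AdiabaticSim

namespace AdiabaticSim

open MeasureTheory

/-! ## The Dyson series in a Banach algebra -/

section Dyson

variable {𝓐 : Type*} [NormedRing 𝓐] [NormedAlgebra ℝ 𝓐]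

/-- The terms of the Dyson series of `U' = K U`, `U(0) = 1`. -/
noncomputable def dysonSeries (K : ℝ → 𝓐) : ℕ → ℝ → 𝓐
  | 0, _ => 1
  | m + 1, t => ∫ s in (0 : ℝ)..t, K s * dysonSeries K m s

variable {K : ℝ → 𝓐}

theorem continuous_dysonSeries (hK : Continuous K) (m : ℕ) : Continuous (dysonSeries K m) := by
  induction m with
  | zero => exact continuous_const
  | succ m ih =>
    exact intervalIntegral.continuous_primitive (fun a b => (hK.mul ih).intervalIntegrable a b) 0

/-- The volume of the time simplex gives the factorial. Negative times are included because
differentiating the sum at `0` needs a neighbourhood, and `‖1‖` is kept because it is not assumed to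
be `1`. -/
theorem norm_dysonSeries_le {R C : ℝ} (hC : ∀ s, |s| ≤ R → ‖K s‖ ≤ C)
    (m : ℕ) : ∀ t : ℝ, |t| ≤ R →
      ‖dysonSeries K m t‖ ≤ ‖(1 : 𝓐)‖ * ((C * |t|) ^ m / m.factorial) := by
  induction m with
  | zero => intro t _; simp [dysonSeries]
  | succ m ih =>
    intro t ht
    have hC0 : 0 ≤ C := (norm_nonneg _).trans (hC 0 (by simpa using (abs_nonneg t).trans ht))
    have hint : ∫ s in Set.uIoc 0 t, ‖(1 : 𝓐)‖ * (C ^ (m + 1) / m.factorial) * |s - 0| ^ m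
        = ‖(1 : 𝓐)‖ * ((C * |t|) ^ (m + 1) / (m + 1).factorial) := by
      rw [integral_const_mul, integral_pow_abs_sub_uIoc, Nat.factorial_succ]
      push_cast
      rw [sub_zero, mul_pow]
      field_simp
    rw [dysonSeries, intervalIntegral.norm_integral_eq_norm_integral_uIoc, ← hint]
    refine norm_integral_le_of_norm_le ?_ ?_
    · exact (Continuous.integrableOn_uIoc (by fun_prop))
    · refine (ae_restrict_mem measurableSet_uIoc).mono fun s hs => ?_
      have hst : |s| ≤ |t| := by
        have := Set.abs_sub_left_of_mem_uIcc (Set.uIoc_subset_uIcc hs)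
        simpa using this
      calc ‖K s * dysonSeries K m s‖ ≤ ‖K s‖ * ‖dysonSeries K m s‖ := norm_mul_le _ _
        _ ≤ C * (‖(1 : 𝓐)‖ * ((C * |s|) ^ m / m.factorial)) :=
            mul_le_mul (hC s (hst.trans ht)) (ih s (hst.trans ht)) (norm_nonneg _) hC0
        _ = _ := by rw [sub_zero]; ring

/-- The sum of the Dyson series. -/
noncomputable def dysonSum (K : ℝ → 𝓐) (t : ℝ) : 𝓐 := ∑' m, dysonSeries K m t

theorem dysonSum_zero : dysonSum K 0 = 1 := by
  rw [dysonSum, tsum_eq_single 0]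
  · rfl
  · intro m hm
    obtain ⟨m, rfl⟩ := Nat.exists_eq_succ_of_ne_zero hm
    simp [dysonSeries]

variable [CompleteSpace 𝓐]

theorem hasDerivAt_dysonSeries_succ (hK : Continuous K) (m : ℕ) (t : ℝ) :
    HasDerivAt (dysonSeries K (m + 1)) (K t * dysonSeries K m t) t := by
  have hc : Continuous fun s => K s * dysonSeries K m s := hK.mul (continuous_dysonSeries hK m)
  exact intervalIntegral.integral_hasDerivAt_right (hc.intervalIntegrable _ _)
    (hc.stronglyMeasurableAtFilter _ _) hc.continuousAt

theorem summable_dysonSeries (hK : Continuous K) (t : ℝ) :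
    Summable fun m => dysonSeries K m t := by
  obtain ⟨C, hC⟩ := (isCompact_Icc (a := -|t|) (b := |t|)).exists_bound_of_continuousOn
    hK.continuousOn
  refine Summable.of_norm_bounded ((Real.summable_pow_div_factorial (C * |t|)).mul_left ‖(1 : 𝓐)‖)
    fun m => norm_dysonSeries_le (R := |t|) (fun s hs => hC s (abs_le.1 hs)) m t le_rfl

/-- Termwise differentiation: on a ball containing `t` the derivatives are dominated by an
exponential series. -/
theorem hasDerivAt_dysonSum (hK : Continuous K) (t : ℝ) :
    HasDerivAt (dysonSum K) (K t * dysonSum K t) t := by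
  set R := |t| + 1 with hR
  obtain ⟨C, hC⟩ := (isCompact_Icc (a := -R) (b := R)).exists_bound_of_continuousOn
    hK.continuousOn
  have hC' : ∀ s, |s| ≤ R → ‖K s‖ ≤ C := fun s hs => hC s (abs_le.1 hs)
  have hR0 : 0 < R := by positivity
  have hC0 : 0 ≤ C := (norm_nonneg _).trans (hC' 0 (by simpa using hR0.le))
  have ht : t ∈ Metric.ball (0 : ℝ) R := by simp [hR]
  set u : ℕ → ℝ := fun m => C * (‖(1 : 𝓐)‖ * ((C * R) ^ m / m.factorial)) with hu
  have hus : Summable u :=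
    ((Real.summable_pow_div_factorial (C * R)).mul_left ‖(1 : 𝓐)‖).mul_left C
  have key := hasDerivAt_tsum_of_isPreconnected (𝕜 := ℝ)
    (g := fun m => dysonSeries K (m + 1)) (g' := fun m s => K s * dysonSeries K m s)
    (u := u) (t := Metric.ball (0 : ℝ) R) (y₀ := t) (y := t) hus Metric.isOpen_ball
    (convex_ball (0 : ℝ) R).isPreconnected
    (fun m s _ => hasDerivAt_dysonSeries_succ hK m s) (fun m s hs => ?_) ht
    ((summable_nat_add_iff 1).2 (summable_dysonSeries hK t)) ht
  · have h0 : ∀ s, dysonSum K s = 1 + ∑' m, dysonSeries K (m + 1) s := fun s =>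
      (summable_dysonSeries hK s).tsum_eq_zero_add
    have h1 : dysonSum K = fun s => 1 + ∑' m, dysonSeries K (m + 1) s := funext h0
    have h2 : K t * dysonSum K t = ∑' m, K t * dysonSeries K m t :=
      ((summable_dysonSeries hK t).tsum_mul_left (K t)).symm
    rw [h2, h1]
    exact key.const_add 1
  · have hs' : |s| ≤ R := by
      have : |s| < R := by simpa using hs
      exact this.le
    calc ‖K s * dysonSeries K m s‖ ≤ ‖K s‖ * ‖dysonSeries K m s‖ := norm_mul_le _ _
      _ ≤ C * (‖(1 : 𝓐)‖ * ((C * |s|) ^ m / m.factorial)) :=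
          mul_le_mul (hC' s hs') (norm_dysonSeries_le hC' m s hs') (norm_nonneg _) hC0
      _ ≤ u m := by
          simp only [hu]
          gcongr

variable [StarRing 𝓐] [CStarRing 𝓐] [StarModule ℝ 𝓐]

/-- The derivative of `U* U` is `U* (K* + K) U`, which vanishes for a skew-adjoint generator. -/
theorem star_mul_dysonSum (hK : Continuous K) (hs : ∀ s, star (K s) = -K s) (t : ℝ) :
    star (dysonSum K t) * dysonSum K t = 1 := by
  have hd : ∀ s, HasDerivAt (fun s => star (dysonSum K s) * dysonSum K s) 0 s := by
    intro s
    have h := hasDerivAt_dysonSum hK s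
    have h' := h.star.mul h
    refine HasDerivAt.congr_deriv h' ?_
    rw [star_mul, hs]
    noncomm_ring
  have := is_const_of_deriv_eq_zero (𝕜 := ℝ) (fun s => (hd s).differentiableAt)
    (fun s => (hd s).deriv) t 0
  rw [this, dysonSum_zero, star_one, one_mul]

theorem CStarRing.norm_one_le {𝓐 : Type*} [NormedRing 𝓐] [StarRing 𝓐] [CStarRing 𝓐] :
    ‖(1 : 𝓐)‖ ≤ 1 := by
  have h : ‖(1 : 𝓐)‖ = ‖(1 : 𝓐)‖ * ‖(1 : 𝓐)‖ := by
    rw [← CStarRing.norm_star_mul_self, star_one, one_mul]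
  by_contra! h'
  nlinarith

theorem norm_dysonSum_le_one (hK : Continuous K) (hs : ∀ s, star (K s) = -K s) (t : ℝ) :
    ‖dysonSum K t‖ ≤ 1 := by
  have h : ‖dysonSum K t‖ * ‖dysonSum K t‖ = ‖(1 : 𝓐)‖ := by
    rw [← CStarRing.norm_star_mul_self, star_mul_dysonSum hK hs]
  have := CStarRing.norm_one_le (𝓐 := 𝓐)
  nlinarith [norm_nonneg (dysonSum K t)]

/-- Conjugation by a contraction. -/
theorem norm_star_mul_mul_le {𝓐 : Type*} [NormedRing 𝓐] [StarRing 𝓐] [CStarRing 𝓐] {U : 𝓐}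
    (hU : ‖U‖ ≤ 1) (T : 𝓐) : ‖star U * T * U‖ ≤ ‖T‖ := by
  calc ‖star U * T * U‖ ≤ ‖star U‖ * ‖T‖ * ‖U‖ :=
        (norm_mul_le _ _).trans (mul_le_mul_of_nonneg_right (norm_mul_le _ _) (norm_nonneg _))
    _ ≤ 1 * ‖T‖ * 1 := by
        rw [norm_star]
        gcongr
    _ = ‖T‖ := by ring

/-- If `T` solves the Heisenberg equation backwards from time `τ` up to a residual of norm at most
`c`, then its error after time `u` is at most `c u`. -/
theorem norm_heisenberg_sub_le (hK : Continuous K) (hs : ∀ s, star (K s) = -K s) {T T' : ℝ → 𝓐}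
    (hT : ∀ v, HasDerivAt T (T' v) v) {τ u c : ℝ} (hu : 0 ≤ u)
    (hres : ∀ v, 0 ≤ v → v ≤ u → ‖T' v + (K (τ - v) * T v - T v * K (τ - v))‖ ≤ c) :
    ‖star (dysonSum K (τ - u)) * T u * dysonSum K (τ - u)
      - star (dysonSum K τ) * T 0 * dysonSum K τ‖ ≤ c * u := by
  -- Moving the initial time by `dv` cancels the commutator part of `T'`; what remains of the
  -- derivative is the residual conjugated by a contraction, so the mean value inequality applies.
  have hd : ∀ v, HasDerivAt
      (fun v => star (dysonSum K (τ - v)) * T v * dysonSum K (τ - v))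
      (star (dysonSum K (τ - v)) * (T' v + (K (τ - v) * T v - T v * K (τ - v)))
        * dysonSum K (τ - v)) v := by
    intro v
    have h := (hasDerivAt_dysonSum hK (τ - v)).comp_const_sub τ v
    have h' := (h.star.mul (hT v)).mul h
    refine HasDerivAt.congr_deriv h' ?_
    rw [star_neg, star_mul, hs, Pi.mul_apply]
    noncomm_ring
  have := norm_image_sub_le_of_norm_deriv_le_segment' (a := 0) (b := u) (C := c)
    (fun v _ => (hd v).hasDerivWithinAt)
    (fun v hv => (norm_star_mul_mul_le (norm_dysonSum_le_one hK hs _) _).trans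
      (hres v hv.1 hv.2.le)) u ⟨hu, le_rfl⟩
  simpa using this

end Dyson

theorem star_sum_ofReal_smul {E ι : Type*} [NormedAddCommGroup E] [InnerProductSpace ℂ E]
    [CompleteSpace E] [Fintype ι] (γ : ι → ℝ) (T : ι → E →L[ℂ] E) :
    star (∑ j, (γ j : ℂ) • T j) = ∑ j, (γ j : ℂ) • star (T j) := by
  rw [star_sum]
  refine Finset.sum_congr rfl fun j _ => ?_
  rw [star_smul]
  congr 1
  exact Complex.conj_ofReal _

/-! ### The evolution as a Dyson sum with skew-adjoint generator -/

namespace AdiabaticHamiltonian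

variable {n k : ℕ} (H : AdiabaticHamiltonian n k)

/-- The generator `-i H(s)` of the evolution. -/
noncomputable def generator (s : ℝ) : QOp n := (-Complex.I) • H.ham s

theorem dysonTerm_eq (m : ℕ) (t : ℝ) : H.dysonTerm m t = dysonSeries H.generator m t := by
  induction m generalizing t with
  | zero => rfl
  | succ m ih =>
    simp only [dysonTerm, dysonSeries, generator, smul_mul_assoc, ih]

theorem evolution_eq (t : ℝ) : H.evolution t = dysonSum H.generator t := by
  simp only [evolution, dysonSum, dysonTerm_eq]

theorem continuous_generator : Continuous H.generator := by
  unfold generator ham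
  fun_prop

theorem initial_eq : H.initial = H.localHam H.coeff₀ := rfl

theorem target_eq : H.target = H.localHam H.coeff₁ := rfl

theorem star_localHam (γ : Fin H.numTerms → ℝ) : star (H.localHam γ) = H.localHam γ := by
  rw [localHam, star_sum_ofReal_smul (E := Qubits n)]
  simp only [star_pauliOp]

theorem localHam_combination (γ γ' : Fin H.numTerms → ℝ) (x y : ℝ) :
    H.localHam (fun j => x * γ j + y * γ' j)
      = (x : ℂ) • H.localHam γ + (y : ℂ) • H.localHam γ' := by
  simp only [localHam, Finset.smul_sum, smul_smul, ← Finset.sum_add_distrib]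
  refine Finset.sum_congr rfl fun j _ => ?_
  push_cast
  module

theorem ham_eq (s : ℝ) :
    H.ham s = H.localHam fun j => (1 - s) * H.coeff₀ j + s * H.coeff₁ j := by
  rw [localHam_combination, ham, initial_eq, target_eq]

theorem star_generator (s : ℝ) : star (H.generator s) = -H.generator s := by
  rw [generator, star_smul, ham_eq, star_localHam]
  simp only [star_neg, Complex.star_def, Complex.conj_I]
  module

theorem comm_combination (γ γ' : Fin H.numTerms → ℝ) (x y : ℝ) (T : QOp n) :
    H.comm (fun j => x * γ j + y * γ' j) T = (x : ℂ) • H.comm γ T + (y : ℂ) • H.comm γ' T := by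
  simp only [comm_apply, localHam_combination, add_mul, mul_add, smul_mul_assoc, mul_smul_comm]
  module

end AdiabaticHamiltonian

end AdiabaticSim

namespace AdiabaticSim

namespace AdiabaticHamiltonian

variable {n k : ℕ} (H : AdiabaticHamiltonian n k)

/-! ## Heisenberg evolution by truncated power series -/

/-- The coefficients of `H(τ)`. -/
def coeffAt (τ : ℝ) (j : Fin H.numTerms) : ℝ := (1 - τ) * H.coeff₀ j + τ * H.coeff₁ j

/-- The coefficients of `-H'`. -/
def coeffSlope (j : Fin H.numTerms) : ℝ := H.coeff₀ j - H.coeff₁ j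

theorem abs_coeffAt_le {τ : ℝ} (h0 : 0 ≤ τ) (h1 : τ ≤ 1) (j : Fin H.numTerms) :
    |H.coeffAt τ j| ≤ 1 := by
  have ha := abs_le.1 (H.abs_coeff₀_le j)
  have hb := abs_le.1 (H.abs_coeff₁_le j)
  rw [coeffAt, abs_le]
  constructor <;> nlinarith

theorem abs_coeffSlope_le (j : Fin H.numTerms) : |H.coeffSlope j| ≤ 2 := by
  have ha := abs_le.1 (H.abs_coeff₀_le j)
  have hb := abs_le.1 (H.abs_coeff₁_le j)
  rw [coeffSlope, abs_le]
  constructor <;> linarith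

/-- Seen backwards from `τ`, the Hamiltonian is affine in the elapsed time `v`. Therefore the power
series of the Heisenberg solution obeys a recursion with only two preceding coefficients. -/
theorem generator_commutator (τ v : ℝ) (T : QOp n) :
    H.generator (τ - v) * T - T * H.generator (τ - v)
      = -(H.comm (H.coeffAt τ) T + (v : ℂ) • H.comm H.coeffSlope T) := by
  have h : (fun j => (1 - (τ - v)) * H.coeff₀ j + (τ - v) * H.coeff₁ j)
      = fun j => 1 * H.coeffAt τ j + v * H.coeffSlope j := by
    funext j; simp only [coeffAt, coeffSlope]; ring
  have h1 : H.comm (H.coeffAt τ) T + (v : ℂ) • H.comm H.coeffSlope T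
      = H.comm (fun j => 1 * H.coeffAt τ j + v * H.coeffSlope j) T := by
    rw [comm_combination]
    push_cast
    module
  rw [h1, ← h, comm_apply, ← ham_eq, generator, smul_mul_assoc, mul_smul_comm]
  module

/-- The coefficient preceding the one of order `p` in a sequence of operators. -/
noncomputable def prevCoeff (T : ℕ → QOp n) : ℕ → QOp n
  | 0 => 0
  | p + 1 => T p

/-- The power series coefficients of the solution of `T' = i[h_γ + v h_δ, T]`. -/
noncomputable def taylor (γ δ : Fin H.numTerms → ℝ) (T : QOp n) : ℕ → QOp n
  | 0 => T
  | 1 => H.comm γ T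
  | p + 2 => ((p + 2 : ℝ) : ℂ)⁻¹ • (H.comm γ (taylor γ δ T (p + 1)) + H.comm δ (taylor γ δ T p))

variable {H}

/-- Setting the coefficient before order `0` to zero makes the cases `1` and `p + 2` one formula. -/
theorem taylor_succ (γ δ : Fin H.numTerms → ℝ) (T : QOp n) (p : ℕ) :
    H.taylor γ δ T (p + 1) = ((p + 1 : ℝ) : ℂ)⁻¹ •
      (H.comm γ (H.taylor γ δ T p) + H.comm δ (prevCoeff (H.taylor γ δ T) p)) := by
  cases p with
  | zero =>
    rw [prevCoeff, map_zero]
    simp only [taylor]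
    push_cast
    module
  | succ p =>
    rw [prevCoeff, taylor]
    congr 3
    push_cast
    ring

theorem smul_taylor_succ (γ δ : Fin H.numTerms → ℝ) (T : QOp n) (p : ℕ) :
    ((p + 1 : ℝ) : ℂ) • H.taylor γ δ T (p + 1)
      = H.comm γ (H.taylor γ δ T p) + H.comm δ (prevCoeff (H.taylor γ δ T) p) := by
  rw [taylor_succ, smul_smul, mul_inv_cancel₀ (by exact_mod_cast Nat.succ_ne_zero p), one_smul]

/-- Partial sums of the power series. -/
noncomputable def taylorSum (H : AdiabaticHamiltonian n k) (γ δ : Fin H.numTerms → ℝ) (T : QOp n)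
    (M : ℕ) (v : ℝ) : QOp n :=
  ∑ p ∈ Finset.range (M + 1), ((v ^ p : ℝ) : ℂ) • H.taylor γ δ T p

/-- The derivative of `taylorSum`. -/
noncomputable def taylorSumDeriv (H : AdiabaticHamiltonian n k) (γ δ : Fin H.numTerms → ℝ)
    (T : QOp n) (M : ℕ) (v : ℝ) : QOp n :=
  ∑ p ∈ Finset.range (M + 1), ((p * v ^ (p - 1) : ℝ) : ℂ) • H.taylor γ δ T p

theorem hasDerivAt_taylorSum (γ δ : Fin H.numTerms → ℝ) (T : QOp n) (M : ℕ) (v : ℝ) :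
    HasDerivAt (H.taylorSum γ δ T M) (H.taylorSumDeriv γ δ T M v) v := by
  unfold taylorSum taylorSumDeriv
  refine HasDerivAt.fun_sum fun p _ => ?_
  exact HasDerivAt.smul_const (𝕜' := ℂ) (hasDerivAt_pow p v).ofReal_comp (H.taylor γ δ T p)

theorem taylorSum_zero (γ δ : Fin H.numTerms → ℝ) (T : QOp n) (M : ℕ) :
    H.taylorSum γ δ T M 0 = T := by
  rw [taylorSum, Finset.sum_eq_single 0]
  · simp only [taylor, pow_zero]
    push_cast
    module
  · intro p _ hp
    rw [zero_pow hp]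
    push_cast
    module
  · simp

/-- The recursion cancels all powers below `v ^ M`. What is left is the derivative of the first
omitted term, and the slope commutator of the last retained one. -/
theorem taylorSum_residual (γ δ : Fin H.numTerms → ℝ) (T : QOp n) (M : ℕ) (v : ℝ) :
    H.taylorSumDeriv γ δ T M v + -(H.comm γ (H.taylorSum γ δ T M v)
        + (v : ℂ) • H.comm δ (H.taylorSum γ δ T M v))
      = -((((M + 1) * v ^ M : ℝ) : ℂ) • H.taylor γ δ T (M + 1)
        + ((v ^ (M + 1) : ℝ) : ℂ) • H.comm δ (H.taylor γ δ T M)) := by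
  induction M with
  | zero =>
    simp only [taylorSum, taylorSumDeriv, taylor, Finset.sum_range_one, pow_zero, zero_add]
    push_cast
    simp only [map_smul]
    module
  | succ M ih =>
    have h1 : H.taylorSum γ δ T (M + 1) v = H.taylorSum γ δ T M v
        + ((v ^ (M + 1) : ℝ) : ℂ) • H.taylor γ δ T (M + 1) := Finset.sum_range_succ _ _
    have h2 : H.taylorSumDeriv γ δ T (M + 1) v = H.taylorSumDeriv γ δ T M v
        + (((M + 1) * v ^ M : ℝ) : ℂ) • H.taylor γ δ T (M + 1) := by
      rw [taylorSumDeriv, Finset.sum_range_succ]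
      congr 4
      push_cast
      simp
    have h3 := smul_taylor_succ γ δ T (M + 1)
    rw [prevCoeff] at h3
    have h4 : ((((M + 1 : ℕ) + 1) * v ^ (M + 1) : ℝ) : ℂ) • H.taylor γ δ T (M + 1 + 1)
        = ((v ^ (M + 1) : ℝ) : ℂ) • (H.comm γ (H.taylor γ δ T (M + 1))
          + H.comm δ (H.taylor γ δ T M)) := by
      rw [← h3, smul_smul, mul_comm]
      push_cast
      rfl
    rw [h1, h2, h4, map_add, map_add, map_smul, map_smul]
    have h5 : H.taylorSumDeriv γ δ T M v = H.comm γ (H.taylorSum γ δ T M v)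
        + (v : ℂ) • H.comm δ (H.taylorSum γ δ T M v)
        - ((((M + 1) * v ^ M : ℝ) : ℂ) • H.taylor γ δ T (M + 1)
        + ((v ^ (M + 1) : ℝ) : ℂ) • H.comm δ (H.taylor γ δ T M)) := by
      rw [sub_eq_add_neg, ← ih]
      abel
    rw [h5]
    push_cast
    module

/-! ### Growth of the power series coefficients and the error of one stage -/

section Bounds

variable {γ δ : Fin H.numTerms → ℝ} {D K : ℕ} {w : ℕ} {b : ℝ} {T : QOp n}

/-- With support size `w' = w + K * p`, the two commutators contribute factors `2 * D * w'` and `4 *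
D * w'`, in total `6 * D * w' ≤ 6 * D * K * (w + p + 1)`. After division by `p + 1` the factors `(w
+ p + 1) / (p + 1)` multiply up to a binomial coefficient. The same bound is carried for the
preceding coefficient, which reduces the recursion to one step. -/
theorem localSum_taylor (hγ : ∀ j, |γ j| ≤ 1) (hδ : ∀ j, |δ j| ≤ 2) (hD : H.maxDegree + 1 ≤ D)
    (hK : k ≤ K) (hK1 : 1 ≤ K) (hT : LocalSum w b T) (p : ℕ) :
    LocalSum (w + K * p) (b * (6 * D * K) ^ p * (w + p).choose p) (H.taylor γ δ T p) ∧
    LocalSum (w + K * p) (b * (6 * D * K) ^ p * (w + p).choose p)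
      (prevCoeff (H.taylor γ δ T) p) := by
  have hb := hT.nonneg
  have hK1' : (1 : ℝ) ≤ K := by exact_mod_cast hK1
  have hD1' : (1 : ℝ) ≤ D := by exact_mod_cast (by omega : 1 ≤ D)
  have hA : (1 : ℝ) ≤ 6 * D * K := by nlinarith
  induction p with
  | zero =>
    refine ⟨by simpa [taylor] using hT, ?_⟩
    rw [prevCoeff]
    exact LocalSum.zero (by simpa using hb)
  | succ p ih =>
    have hch : ((p : ℝ) + 1) * (w + (p + 1)).choose (p + 1)
        = (w + p + 1) * (w + p).choose p := by
      have := Nat.add_one_mul_choose_eq (w + p) p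
      rw [mul_comm]
      exact_mod_cast this.symm
    set A : ℝ := 6 * D * K with hAdef
    set C : ℝ := ((w + p).choose p : ℝ) with hC
    have hC0 : 0 ≤ C := by positivity
    have hC' : ((w + (p + 1)).choose (p + 1) : ℝ) = (w + p + 1) * C / (p + 1) := by
      rw [eq_div_iff (by positivity), ← hch]; ring
    constructor
    · rw [taylor_succ]
      have h1 := localSum_comm H hγ hD hK zero_le_one ih.1
      have h2 := localSum_comm H hδ hD hK zero_le_two ih.2
      refine ((h1.add h2).smul _).mono (by rw [Nat.mul_succ, add_assoc]) ?_
      have hn : ‖((p + 1 : ℝ) : ℂ)⁻¹‖ = ((p : ℝ) + 1)⁻¹ := by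
        rw [norm_inv, Complex.norm_real, Real.norm_of_nonneg (by positivity)]
      rw [hn, hC', inv_mul_le_iff₀ (by positivity)]
      have hw : (((w + K * p : ℕ) : ℝ)) ≤ K * (w + p + 1) := by
        push_cast
        have : (0 : ℝ) ≤ w := by positivity
        nlinarith
      have hX : 0 ≤ b * A ^ p * C := by positivity
      calc 1 * (2 * (D : ℝ)) * ((w + K * p : ℕ) : ℝ) * (b * A ^ p * C)
            + 2 * (2 * (D : ℝ)) * ((w + K * p : ℕ) : ℝ) * (b * A ^ p * C)
          = 6 * D * (((w + K * p : ℕ) : ℝ) * (b * A ^ p * C)) := by ring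
        _ ≤ 6 * D * (K * (w + p + 1) * (b * A ^ p * C)) := by gcongr
        _ = A * (w + p + 1) * (b * A ^ p * C) := by rw [hAdef]; ring
        _ = _ := by rw [pow_succ]; field_simp
    · rw [prevCoeff]
      refine ih.1.mono (by gcongr; omega) ?_
      have hle : C ≤ (w + (p + 1)).choose (p + 1) := by
        rw [hC']
        rw [le_div_iff₀ (by positivity)]
        nlinarith [(Nat.cast_nonneg w : (0 : ℝ) ≤ w)]
      have hle2 : A ^ p ≤ A ^ (p + 1) := pow_le_pow_right₀ hA (Nat.le_succ p)
      gcongr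

theorem choose_le_two_pow_real (w p : ℕ) : (((w + p).choose p : ℕ) : ℝ) ≤ 2 ^ w * 2 ^ p := by
  rw [← pow_add]
  exact_mod_cast Nat.choose_le_two_pow _ _

/-- The binomial coefficient is at most `2 ^ (w + p)`, and the condition on `u` makes the remaining
series geometric with ratio at most `1 / 2`, whence the factor `2`. -/
theorem localSum_taylorSum (hγ : ∀ j, |γ j| ≤ 1) (hδ : ∀ j, |δ j| ≤ 2) (hD : H.maxDegree + 1 ≤ D)
    (hK : k ≤ K) (hK1 : 1 ≤ K) (hT : LocalSum w b T) {u : ℝ} (hu : 0 ≤ u)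
    (hu' : 4 * (6 * D * K) * u ≤ 1) (M : ℕ) :
    LocalSum (w + K * M) (2 * (b * 2 ^ w)) (H.taylorSum γ δ T M u) := by
  have hb := hT.nonneg
  set A : ℝ := 6 * D * K with hA
  have hA0 : 0 ≤ A := by positivity
  refine (LocalSum.sum (w := w + K * M) (g := fun p => b * 2 ^ w * (1 / 2) ^ p)
    (Finset.range (M + 1)) fun p hp => ?_).mono le_rfl ?_
  · have hp' : p ≤ M := by simpa [Nat.lt_succ_iff] using hp
    refine ((localSum_taylor hγ hδ hD hK hK1 hT p).1.smul _).mono (by gcongr) ?_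
    rw [Complex.norm_real, Real.norm_of_nonneg (by positivity)]
    calc u ^ p * (b * A ^ p * ((w + p).choose p : ℝ))
        ≤ u ^ p * (b * A ^ p * (2 ^ w * 2 ^ p)) := by
          gcongr; exact choose_le_two_pow_real w p
      _ = b * 2 ^ w * (2 * A * u) ^ p := by rw [mul_pow (2 * A) u, mul_pow 2 A]; ring
      _ ≤ b * 2 ^ w * (1 / 2) ^ p := by
          gcongr
          linarith
  · rw [← Finset.mul_sum, mul_comm (2 : ℝ)]
    gcongr
    have := sum_geometric_two_le (M + 1)
    simpa using this

/-- Both terms of `taylorSum_residual` are of order `M`. One factor `2 ^ (w + M)` bounds the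
binomial coefficient, and another absorbs the linear factor `M + 1` or `w + M`; together they give
`4 ^ w` and the ratio `4 * A * u`. -/
theorem norm_taylorSum_residual_le (hγ : ∀ j, |γ j| ≤ 1) (hδ : ∀ j, |δ j| ≤ 2)
    (hD : H.maxDegree + 1 ≤ D) (hK : k ≤ K) (hK1 : 1 ≤ K) (hT : LocalSum w b T) {u v : ℝ}
    (hv : 0 ≤ v) (hvu : v ≤ u) (hu : u ≤ 1) (M : ℕ) :
    ‖H.taylorSumDeriv γ δ T M v + -(H.comm γ (H.taylorSum γ δ T M v)
        + (v : ℂ) • H.comm δ (H.taylorSum γ δ T M v))‖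
      ≤ 3 * (6 * D * K) * b * 4 ^ w * (4 * (6 * D * K) * u) ^ M := by
  have hb := hT.nonneg
  have hK1' : (1 : ℝ) ≤ K := by exact_mod_cast hK1
  set A : ℝ := 6 * D * K with hA
  have hA0 : 0 ≤ A := by positivity
  have h1 := (localSum_taylor hγ hδ hD hK hK1 hT (M + 1)).1.norm_le
  have h2 := (localSum_comm H hδ hD hK zero_le_two
    (localSum_taylor hγ hδ hD hK hK1 hT M).1).norm_le
  rw [← hA] at h1 h2
  have hM : ((M : ℝ) + 1) ≤ 2 ^ M := by exact_mod_cast Nat.lt_two_pow_self (n := M)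
  have hwM : ((w : ℝ) + M) ≤ 2 ^ w * 2 ^ M := by
    rw [← pow_add]; exact_mod_cast (Nat.lt_two_pow_self (n := w + M)).le
  have hu0 : 0 ≤ u := hv.trans hvu
  have hv1 : v ≤ 1 := hvu.trans hu
  have e1 : ‖(((M + 1) * v ^ M : ℝ) : ℂ) • H.taylor γ δ T (M + 1)‖
      ≤ 2 * A * b * 4 ^ w * (4 * A * u) ^ M := by
    rw [norm_smul, Complex.norm_real, Real.norm_of_nonneg (by positivity)]
    calc (M + 1) * v ^ M * ‖H.taylor γ δ T (M + 1)‖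
        ≤ 2 ^ M * u ^ M * (b * A ^ (M + 1) * (2 ^ w * 2 ^ (M + 1))) := by
          gcongr
          exact h1.trans (by gcongr; exact choose_le_two_pow_real w (M + 1))
      _ = 2 * A * b * 2 ^ w * ((2 * 2) ^ M * A ^ M * u ^ M) := by
          rw [mul_pow (2 : ℝ) 2]; ring
      _ = 2 * A * b * 2 ^ w * (4 * A * u) ^ M := by
          rw [mul_pow (4 * A) u, mul_pow 4 A]; norm_num
      _ ≤ _ := by
          gcongr
          norm_num
  have e2 : ‖((v ^ (M + 1) : ℝ) : ℂ) • H.comm δ (H.taylor γ δ T M)‖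
      ≤ A * b * 4 ^ w * (4 * A * u) ^ M := by
    rw [norm_smul, Complex.norm_real, Real.norm_of_nonneg (by positivity)]
    have hw : (((w + K * M : ℕ) : ℝ)) ≤ K * (w + M) := by
      push_cast
      have : (0 : ℝ) ≤ w := by positivity
      nlinarith
    calc v ^ (M + 1) * ‖H.comm δ (H.taylor γ δ T M)‖
        ≤ v ^ (M + 1) * (2 * (2 * D) * (K * (w + M)) * (b * A ^ M * (2 ^ w * 2 ^ M))) := by
          gcongr
          refine h2.trans ?_
          gcongr
          exact choose_le_two_pow_real w M
      _ ≤ (u ^ M * 1) * (A * (2 ^ w * 2 ^ M) * (b * A ^ M * (2 ^ w * 2 ^ M))) := by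
          rw [pow_succ]
          have hDK : (2 : ℝ) * (2 * D) * (K * (w + M)) ≤ A * (2 ^ w * 2 ^ M) := by
            calc (2 : ℝ) * (2 * D) * (K * (w + M)) = 4 * (D * K) * (w + M) := by ring
              _ ≤ 6 * (D * K) * (w + M) := by gcongr; norm_num
              _ = A * (w + M) := by rw [hA]; ring
              _ ≤ _ := by gcongr
          gcongr
      _ = A * b * (2 * 2) ^ w * ((2 * 2) ^ M * A ^ M * u ^ M) := by
          rw [mul_pow (2 : ℝ) 2, mul_pow (2 : ℝ) 2]; ring
      _ = _ := by rw [mul_pow (4 * A) u, mul_pow 4 A]; norm_num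
  rw [taylorSum_residual, norm_neg]
  calc _ ≤ _ := norm_add_le _ _
    _ ≤ 2 * A * b * 4 ^ w * (4 * A * u) ^ M + A * b * 4 ^ w * (4 * A * u) ^ M :=
        add_le_add e1 e2
    _ = _ := by ring

end Bounds

/-- The simulated Heisenberg evolution: `s` stages of duration `u` are left, and the current
stage, in which powers of the duration up to `c` are kept, has reached the power `p`. The bound
for the powers is doubled from each stage to the next one. -/
noncomputable def heis (H : AdiabaticHamiltonian n k) (u : ℝ) :
    ℕ → ℕ → ℕ → QOp n →ₗ[ℂ] QOp n
  | 0, _, _ => LinearMap.id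
  | s + 1, c, p => heis H u s (2 * c) 0
      + (if p + 1 ≤ c then heis H u (s + 1) c (p + 1) ∘ₗ
          (((u / (p + 1) : ℝ) : ℂ) • H.comm (H.coeffAt ((s + 1) * u))) else 0)
      + (if p + 2 ≤ c then heis H u (s + 1) c (p + 2) ∘ₗ
          (((u ^ 2 / (p + 2) : ℝ) : ℂ) • H.comm H.coeffSlope) else 0)
termination_by s c p => (s, c - p)

theorem heis_zero (u : ℝ) (c p : ℕ) (T : QOp n) : H.heis u 0 c p T = T := by
  rw [heis]; rfl

theorem heis_succ (u : ℝ) (s c p : ℕ) (T : QOp n) :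
    H.heis u (s + 1) c p T = H.heis u s (2 * c) 0 T
      + (if p + 1 ≤ c then H.heis u (s + 1) c (p + 1)
          (((u / (p + 1) : ℝ) : ℂ) • H.comm (H.coeffAt ((s + 1) * u)) T) else 0)
      + (if p + 2 ≤ c then H.heis u (s + 1) c (p + 2)
          (((u ^ 2 / (p + 2) : ℝ) : ℂ) • H.comm H.coeffSlope T) else 0) := by
  rw [heis]
  split_ifs <;> rfl

/-- The recursion `heis` sends a single operator on by steps of one or two powers and never collects
equal powers, which suits a queue of product operators. Linearity reassembles its paths into the
truncated power series. -/
theorem heis_succ_eq_taylorSum (u : ℝ) (s c : ℕ) (T : QOp n) :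
    H.heis u (s + 1) c 0 T
      = H.heis u s (2 * c) 0 (H.taylorSum (H.coeffAt ((s + 1) * u)) H.coeffSlope T c u) := by
  set B := H.taylor (H.coeffAt ((s + 1) * u)) H.coeffSlope T with hB
  -- Here the powers below `P` have been passed to the next stage, power `P` holds its full
  -- coefficient, and power `P + 1` has so far received only the slope contribution of `P - 1`.
  have key : ∀ P ≤ c, H.heis u (s + 1) c 0 T
      = (∑ p ∈ Finset.range P, H.heis u s (2 * c) 0 (((u ^ p : ℝ) : ℂ) • B p))
        + H.heis u (s + 1) c P (((u ^ P : ℝ) : ℂ) • B P)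
        + (if P + 1 ≤ c then H.heis u (s + 1) c (P + 1)
          (((u ^ (P + 1) / (P + 1) : ℝ) : ℂ) • H.comm H.coeffSlope (prevCoeff B P)) else 0) := by
    intro P
    induction P with
    | zero =>
      intro _
      have h0 : (((u ^ 0 : ℝ) : ℂ) • B 0) = T := by
        rw [hB]; simp only [taylor, pow_zero]; push_cast; module
      rw [h0, prevCoeff, map_zero, QOp.smul_zero, map_zero]
      simp
    | succ P ih =>
      intro hP
      rw [ih (by omega), heis_succ u s c P, if_pos hP, if_pos hP, Finset.sum_range_succ]
      have h1 : (((u / (P + 1) : ℝ) : ℂ) • H.comm (H.coeffAt ((s + 1) * u))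
            (((u ^ P : ℝ) : ℂ) • B P))
          + (((u ^ (P + 1) / (P + 1) : ℝ) : ℂ) • H.comm H.coeffSlope (prevCoeff B P))
          = ((u ^ (P + 1) : ℝ) : ℂ) • B (P + 1) := by
        rw [hB, taylor_succ, ← hB, map_smul]
        push_cast
        module
      have h2 : (((u ^ 2 / (P + 2) : ℝ) : ℂ) • H.comm H.coeffSlope (((u ^ P : ℝ) : ℂ) • B P))
          = ((u ^ (P + 1 + 1) / ((P + 1 : ℕ) + 1) : ℝ) : ℂ) •
            H.comm H.coeffSlope (prevCoeff B (P + 1)) := by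
        rw [map_smul, prevCoeff, smul_smul]
        congr 1
        rw [← Complex.ofReal_mul]
        congr 1
        push_cast
        ring
      rw [← h1, h2, map_add]
      push_cast
      abel
  have h := key c le_rfl
  rw [if_neg (by omega), add_zero, heis_succ u s c c, if_neg (by omega), if_neg (by omega), add_zero,
    add_zero] at h
  rw [h, taylorSum, map_sum, Finset.sum_range_succ]

/-- A stage of order `c` starting at `w ≤ 2 * K * c` errs by at most `3 * A * b * ρ ^ c` with `ρ =
16 ^ K * (4 * A * u)`, since `4 ^ w ≤ 16 ^ (K * c)`. It leaves support size at most `3 * K * c`,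
within the limit for order `2 * c`, and multiplies the norm bound by `2 * 2 ^ w ≤ (2 * 4 ^ K) ^ c`.
Doubling the order provides an extra `ρ ^ c` that pays for this, so all stages obey the same error
bound. -/
theorem norm_heis_sub_le {D K : ℕ} (hD : H.maxDegree + 1 ≤ D) (hK : k ≤ K) (hK1 : 1 ≤ K) {u : ℝ}
    (hu : 0 ≤ u) (hu' : 2 * 4 ^ K * (16 ^ K * (4 * (6 * D * K) * u)) ≤ 1) (s : ℕ) :
    s * u ≤ 1 → ∀ (c w : ℕ) (b : ℝ) (T : QOp n), 1 ≤ c → w ≤ 2 * K * c → LocalSum w b T →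
      ‖H.heis u s c 0 T - star (H.evolution (s * u)) * T * H.evolution (s * u)‖
        ≤ s * (3 * (6 * D * K) * b * (16 ^ K * (4 * (6 * D * K) * u)) ^ c) := by
  set A : ℝ := 6 * D * K with hA
  have hA0 : 0 ≤ A := by positivity
  set ρ : ℝ := 16 ^ K * (4 * A * u) with hρ
  have hρ0 : 0 ≤ ρ := by positivity
  have h16 : (1 : ℝ) ≤ 16 ^ K := one_le_pow₀ (by norm_num)
  have h4 : (1 : ℝ) ≤ 4 ^ K := one_le_pow₀ (by norm_num)
  have hρ1 : ρ ≤ 1 := by nlinarith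
  have hAu : 4 * A * u ≤ 1 := by
    have : 0 ≤ 4 * A * u := by positivity
    nlinarith
  induction s with
  | zero =>
    intro _ c w b T _ _ _
    rw [heis_zero, evolution_eq, Nat.cast_zero, zero_mul, dysonSum_zero]
    simp
  | succ s ih =>
    intro hsu c w b T hc hw hT
    have hb := hT.nonneg
    push_cast at hsu ⊢
    have hsu0 : 0 ≤ s * u := by positivity
    have hu1 : u ≤ 1 := by nlinarith
    have hγ := H.abs_coeffAt_le (τ := (s + 1) * u) (by positivity) hsu
    have hδ := H.abs_coeffSlope_le
    set T₁ := H.taylorSum (H.coeffAt ((s + 1) * u)) H.coeffSlope T c u with hT₁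
    have hloc : LocalSum (w + K * c) (2 * (b * 2 ^ w)) T₁ :=
      localSum_taylorSum hγ hδ hD hK hK1 hT hu hAu c
    -- The stage treated here is the latest time slice; the remaining `s` stages act on its
    -- truncated solution.
    have e1 := ih (by nlinarith) (2 * c) (w + K * c) _ T₁ (by omega) (by nlinarith) hloc
    have e2 : ‖star (H.evolution (s * u)) * T₁ * H.evolution (s * u)
        - star (H.evolution ((s + 1) * u)) * T * H.evolution ((s + 1) * u)‖
        ≤ 3 * A * b * 4 ^ w * (4 * A * u) ^ c * u := by
      have h := norm_heisenberg_sub_le (K := H.generator) (τ := (s + 1) * u) (u := u)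
        (c := 3 * A * b * 4 ^ w * (4 * A * u) ^ c) H.continuous_generator H.star_generator
        (hasDerivAt_taylorSum (H.coeffAt ((s + 1) * u)) H.coeffSlope T c) hu
        (fun v hv hvu => by
          rw [generator_commutator]
          exact norm_taylorSum_residual_le hγ hδ hD hK hK1 hT hv hvu hu1 c)
      rw [taylorSum_zero, show ((s : ℝ) + 1) * u - u = s * u by ring] at h
      rw [evolution_eq, evolution_eq]
      exact h
    rw [heis_succ_eq_taylorSum, ← hT₁]
    have e3 : 3 * A * b * 4 ^ w * (4 * A * u) ^ c * u ≤ 3 * A * b * ρ ^ c := by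
      have h4w : (4 : ℝ) ^ w ≤ (16 ^ K) ^ c := by
        calc (4 : ℝ) ^ w ≤ 4 ^ (2 * K * c) := pow_le_pow_right₀ (by norm_num) hw
          _ = _ := by rw [pow_mul, pow_mul]; norm_num
      calc 3 * A * b * 4 ^ w * (4 * A * u) ^ c * u
          ≤ 3 * A * b * (16 ^ K) ^ c * (4 * A * u) ^ c * 1 := by gcongr
        _ = _ := by rw [hρ, mul_pow ((16 : ℝ) ^ K)]; ring
    have e4 : 3 * A * (2 * (b * 2 ^ w)) * ρ ^ (2 * c) ≤ 3 * A * b * ρ ^ c := by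
      have h2w : (2 : ℝ) ^ w ≤ (4 ^ K) ^ c := by
        calc (2 : ℝ) ^ w ≤ 2 ^ (2 * K * c) := pow_le_pow_right₀ (by norm_num) hw
          _ = _ := by rw [pow_mul, pow_mul]; norm_num
      have h2c : (2 : ℝ) ≤ 2 ^ c := by
        calc (2 : ℝ) = 2 ^ 1 := by norm_num
          _ ≤ 2 ^ c := pow_le_pow_right₀ (by norm_num) hc
      calc 3 * A * (2 * (b * 2 ^ w)) * ρ ^ (2 * c)
          = 3 * A * b * (2 * 2 ^ w * ρ ^ (2 * c)) := by ring
        _ ≤ 3 * A * b * (2 ^ c * (4 ^ K) ^ c * ρ ^ (2 * c)) := by gcongr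
        _ = 3 * A * b * ((2 * 4 ^ K * ρ) ^ c * ρ ^ c) := by
            rw [mul_pow (2 * 4 ^ K) ρ, mul_pow (2 : ℝ), two_mul c, pow_add]; ring
        _ ≤ 3 * A * b * (1 * ρ ^ c) := by
            gcongr
            exact pow_le_one₀ (by positivity) hu'
        _ = _ := by ring
    calc ‖H.heis u s (2 * c) 0 T₁
          - star (H.evolution ((s + 1) * u)) * T * H.evolution ((s + 1) * u)‖
        ≤ ‖H.heis u s (2 * c) 0 T₁ - star (H.evolution (s * u)) * T₁ * H.evolution (s * u)‖
          + ‖star (H.evolution (s * u)) * T₁ * H.evolution (s * u)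
            - star (H.evolution ((s + 1) * u)) * T * H.evolution ((s + 1) * u)‖ :=
          norm_sub_le_norm_sub_add_norm_sub _ _ _
      _ ≤ s * (3 * A * (2 * (b * 2 ^ w)) * ρ ^ (2 * c))
          + 3 * A * b * 4 ^ w * (4 * A * u) ^ c * u := add_le_add e1 e2
      _ ≤ s * (3 * A * b * ρ ^ c) + 3 * A * b * ρ ^ c := by gcongr
      _ = _ := by ring

end AdiabaticHamiltonian

end AdiabaticSim

namespace AdiabaticSim

open Function

/-! ## The simulation program

Besides the input, the program uses the following arrays. For natural numbers:
* `7`, `8`: the end and the beginning of a queue of rows;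
* `9`, `10`, `11`: loop counters;
* `12`, `13`, `14`: for each row, the number of stages left, the bound for the power and the power;
* `15`, `16`, `17`: for each row, the number of its qubits, their list, and their indicator;
* `18`: the bound for the powers in the first stage;
* `19`, `20`, `21`, `22`: a qubit of the current row, a term acting on it, an updated qubit, and the
  number of qubits of the current row.

For reals:
* `5`, `6`: for each row, its coefficient;
* `7`, …, `14`: for each row and qubit, a matrix, stored as the difference from the identity;
* `15`: the sum of the expectation values computed so far;
* `16`, …, `20`: auxiliary scalars. -/

namespace Sim

abbrev zero : NExp := .const 0

abbrev tail : NExp := .var 7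

abbrev head : NExp := .var 8

/-- Add the qubit `var 21` to the last row. -/
def addSite : Prog :=
  .ite (.natLe (.get 17 tail (.var 21)) zero)
    (.seq (.setNat 17 tail (.var 21) (.const 1))
      (.seq (.setNat 16 tail (.get 15 tail zero) (.var 21))
        (.setNat 15 tail zero (.add (.get 15 tail zero) (.const 1)))))
    .skip

/-- Copy the qubits and the matrices of the first row to the last one. -/
def copyRow : Prog :=
  .for 11 (.get 15 head zero)
    (.seq (.setNat 21 zero zero (.get 16 head (.var 11)))
      (.seq addSite (.setMat tail (.var 21) (.get head (.var 21)))))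

/-- Run one of four programs, depending on a Pauli letter. -/
def withPauli (e : NExp) (f : Fin 4 → Prog) : Prog :=
  .ite (.natLe e (.const 0)) (f 0) (.ite (.natLe e (.const 1)) (f 1)
    (.ite (.natLe e (.const 2)) (f 2) (f 3)))

/-- The Pauli matrices. -/
def pauliExp : Fin 4 → MExp
  | 0 => MExp.one
  | 1 => fun a b => if a = b then .const 0 0 else .const 1 0
  | 2 => fun a b => if a = b then .const 0 0 else if a = 0 then .const 0 (-1) else .const 0 1
  | 3 => fun a b => if a = b then if a = 0 then .const 1 0 else .const (-1) 0 else .const 0 0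

/-- Update the matrix of the last row at the qubit `var 21`, on which the term has the letter
`P`. -/
def applyLetter (P : Fin 4) : Prog :=
  .ite (.not (.natLe (.var 19) (.var 21)))
    (.setMat tail (.var 21) ((pauliExp P).mul (.get head (.var 21))))
    (.ite (.not (.natLe (.var 21) (.var 19)))
      (.setMat tail (.var 21) (MExp.mul (.get head (.var 21)) (pauliExp P)))
      (.setMat tail (.var 21) (((pauliExp P).mul (.get head (.var 21))).sub
        (MExp.mul (.get head (.var 21)) (pauliExp P)))))

/-- Turn the last row from a copy of the first one into the part at the qubit `var 19` of its
commutator with the term `var 20`. -/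
def applyTerm : Prog :=
  .for 11 (.get 1 (.var 20) zero)
    (.seq (.setNat 21 zero zero (.get 2 (.var 20) (.var 11)))
      (.seq addSite (withPauli (.get 3 (.var 20) (.var 11)) applyLetter)))

/-- Complete the last row, and start a new one. -/
def finish (s c p : NExp) (z : CExp) : Prog :=
  .seq (.setNat 12 tail zero s) (.seq (.setNat 13 tail zero c) (.seq (.setNat 14 tail zero p)
    (.seq (.setC 5 tail zero z) (.setNat 7 zero zero (.add tail (.const 1))))))

/-- The duration of a stage. -/
def duration (J : ℕ) : RExp := .div (.get 0 zero zero) (.const J)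

/-- The real factor of the coefficient that the power increment `κ + 1` contributes. -/
def factorExp (J : ℕ) : Fin 2 → RExp
  | 0 => .mul (.div (duration J) (.ofNat (.add (.get 14 head zero) (.const 1))))
      (.add (.mul (.sub (.const 1) (.mul (.ofNat (.get 12 head zero)) (duration J)))
          (.get 1 (.var 20) zero))
        (.mul (.mul (.ofNat (.get 12 head zero)) (duration J)) (.get 1 (.var 20) (.const 1))))
  | 1 => .mul (.div (.mul (duration J) (duration J))
        (.ofNat (.add (.get 14 head zero) (.const 2))))
      (.sub (.get 1 (.var 20) zero) (.get 1 (.var 20) (.const 1)))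

/-- Append the row that arises from the first one by the commutator at the qubit `var 19` with the
term `var 20`, with the power increment `κ + 1`. -/
def child (J : ℕ) (κ : Fin 2) : Prog :=
  .ite (.natLe (.add (.get 14 head zero) (.const (κ + 1))) (.get 13 head zero))
    (.seq copyRow (.seq applyTerm
      (finish (.get 12 head zero) (.get 13 head zero)
        (.add (.get 14 head zero) (.const (κ + 1)))
        (CExp.mul (.get 5 head zero) ⟨.const 0, factorExp J κ⟩))))
    .skip

/-- Append the row that arises from the first one by going to the next stage. -/
def nextStage : Prog :=
  .seq copyRow (finish (.sub (.get 12 head zero) (.const 1))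
    (.add (.get 13 head zero) (.get 13 head zero)) zero (.get 5 head zero))

/-- An amplitude of the state of the qubit `var 21`. -/
def amplitude (a : Fin 2) : CExp :=
  ⟨.get 4 (.var 21) (.const (2 * a)), .get 4 (.var 21) (.const (2 * a + 1))⟩

/-- The expectation value of the matrix of the first row at the qubit `var 21`. -/
def qubitExp : CExp :=
  let f : Fin 2 → Fin 2 → CExp := fun a b =>
    (amplitude a).conj.mul ((MExp.get head (.var 21) a b).mul (amplitude b))
  ((f 0 0).add (f 0 1)).add ((f 1 0).add (f 1 1))

/-- Multiply the scalar `17` by the expectation value of the first row at its qubit number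
`var 9`. -/
def leafBody : Prog :=
  .seq (.setNat 21 zero zero (.get 16 head (.var 9)))
    (.seq (.setC 19 zero zero (CExp.mul (.get 17 zero zero) qubitExp))
      (.setC 17 zero zero (.get 19 zero zero)))

/-- Add the expectation value of the first row to the result. -/
def leaf : Prog :=
  .seq (.setC 17 zero zero (.const 1 0)) (.seq (.for 9 (.get 15 head zero) leafBody)
    (.setReal 15 zero zero (.add (.get 15 zero zero)
      (CExp.mul (.get 5 head zero) (.get 17 zero zero)).re)))

/-- Append the two commutators of the first row at the qubit `var 19` with the term number
`var 10` that acts on it. -/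
def termBody (J : ℕ) : Prog :=
  .seq (.setNat 20 zero zero (.get 5 (.var 19) (.var 10))) (.seq (child J 0) (child J 1))

/-- Append all commutators of the first row at its qubit number `var 9`. -/
def siteBody (J : ℕ) : Prog :=
  .seq (.setNat 19 zero zero (.get 16 head (.var 9)))
    (.for 10 (.get 4 (.var 19) zero) (termBody J))

/-- Append all commutators of the first row. -/
def commutators (J : ℕ) : Prog :=
  .seq (.setNat 22 zero zero (.get 15 head zero)) (.for 9 (.var 22) (siteBody J))

/-- Process the first row. -/
def process (J : ℕ) : Prog :=
  .seq (.ite (.natLe (.get 12 head zero) zero) leaf (.seq nextStage (commutators J)))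
    (.setNat 8 zero zero (.add head (.const 1)))

end Sim

/-! ## Rows -/

/-- What a row of the queue stands for: the product operator `coef • ⨂ fac`, different from the
identity on the qubits in `sup` only, in a given stage and with a given power. -/
structure Row (n : ℕ) where
  stage : ℕ
  cap : ℕ
  pow : ℕ
  coef : ℂ
  fac : Fin n → Matrix (Fin 2) (Fin 2) ℂ
  sup : List (Fin n)

/-- Append an element unless it is there. -/
def insertEnd {α : Type*} [DecidableEq α] (L : List α) (a : α) : List α :=
  if a ∈ L then L else L ++ [a]

theorem mem_insertEnd {α : Type*} [DecidableEq α] {L : List α} {a b : α} :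
    b ∈ insertEnd L a ↔ b ∈ L ∨ b = a := by
  unfold insertEnd
  split_ifs with h
  · constructor
    · exact Or.inl
    · rintro (h' | rfl) <;> assumption
  · simp

theorem nodup_insertEnd {α : Type*} [DecidableEq α] {L : List α} (h : L.Nodup) (a : α) :
    (insertEnd L a).Nodup := by
  unfold insertEnd
  split_ifs with ha
  · exact h
  · rw [List.nodup_append]
    refine ⟨h, List.nodup_singleton a, ?_⟩
    rintro x hx y hy rfl
    rw [List.mem_singleton] at hy
    exact ha (hy ▸ hx)

theorem length_insertEnd_le {α : Type*} [DecidableEq α] (L : List α) (a : α) :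
    (insertEnd L a).length ≤ L.length + 1 := by
  unfold insertEnd
  split_ifs <;> simp

/-- Append those elements of a list that are not there. -/
def appendNew {α : Type*} [DecidableEq α] (L L' : List α) : List α := L'.foldl insertEnd L

theorem mem_appendNew {α : Type*} [DecidableEq α] {L L' : List α} {b : α} :
    b ∈ appendNew L L' ↔ b ∈ L ∨ b ∈ L' := by
  induction L' generalizing L with
  | nil => simp [appendNew]
  | cons a L' ih =>
    have : b ∈ appendNew L (a :: L') ↔ b ∈ insertEnd L a ∨ b ∈ L' := ih
    rw [this, mem_insertEnd, List.mem_cons, or_assoc]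

theorem nodup_appendNew {α : Type*} [DecidableEq α] {L : List α} (h : L.Nodup) (L' : List α) :
    (appendNew L L').Nodup := by
  induction L' generalizing L with
  | nil => exact h
  | cons a L' ih => exact ih (nodup_insertEnd h a)

theorem length_appendNew_le {α : Type*} [DecidableEq α] (L L' : List α) :
    (appendNew L L').length ≤ L.length + L'.length := by
  induction L' generalizing L with
  | nil => simp [appendNew]
  | cons a L' ih =>
    have h1 : (appendNew L (a :: L')).length ≤ (insertEnd L a).length + L'.length := ih _
    have h2 := length_insertEnd_le L a
    simp only [List.length_cons]
    omega

variable {n : ℕ}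

/-- The qubits and the matrices of the row `e` are given by `L` and `F`. -/
structure SupAt (μ : Mem) (e : ℕ) (L : List (Fin n)) (F : Fin n → Matrix (Fin 2) (Fin 2) ℂ) :
    Prop where
  len : μ.nat 15 e 0 = L.length
  site : ∀ (l : ℕ) (hl : l < L.length), μ.nat 16 e l = L[l]
  flag : ∀ q : Fin n, μ.nat 17 e q = if q ∈ L then 1 else 0
  mat : ∀ q : Fin n, μ.mat e q = F q

/-- The row `e` stands for `R`. -/
structure RowAt (μ : Mem) (e : ℕ) (R : Row n) : Prop extends SupAt μ e R.sup R.fac where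
  stage : μ.nat 12 e 0 = R.stage
  cap : μ.nat 13 e 0 = R.cap
  pow : μ.nat 14 e 0 = R.pow
  coef : μ.cplx 5 e 0 = R.coef

/-- The queue starts at `h` and consists of `rows`. -/
structure QueueAt (h : ℕ) (μ : Mem) (rows : List (Row n)) : Prop where
  head : μ.nat 8 0 0 = h
  tail : μ.nat 7 0 0 = h + rows.length
  row : ∀ (i : ℕ) (hi : i < rows.length), RowAt μ (h + i) rows[i]
  fresh : ∀ e, h + rows.length ≤ e → SupAt μ e ([] : List (Fin n)) fun _ => 1

/-- The memories agree outside the row `T` and the scalars `11`, `21`. -/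
structure SameOff (T : ℕ) (μ ν : Mem) : Prop where
  nat : ∀ a i j, a ≠ 11 → a ≠ 21 → (12 ≤ a → a ≤ 17 → i ≠ T) → ν.nat a i j = μ.nat a i j
  real : ∀ a i j, (5 ≤ a → a ≤ 14 → i ≠ T) → ν.real a i j = μ.real a i j

namespace SameOff

variable {T : ℕ} {μ ν ξ : Mem}

theorem refl (T : ℕ) (μ : Mem) : SameOff T μ μ := ⟨fun _ _ _ _ _ _ => rfl, fun _ _ _ _ => rfl⟩

theorem trans (h : SameOff T μ ν) (h' : SameOff T ν ξ) : SameOff T μ ξ :=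
  ⟨fun a i j h₁ h₂ h₃ => (h'.nat a i j h₁ h₂ h₃).trans (h.nat a i j h₁ h₂ h₃),
    fun a i j h₁ => (h'.real a i j h₁).trans (h.real a i j h₁)⟩

theorem setNat (μ : Mem) {a i j v : ℕ} (ha : a = 11 ∨ a = 21 ∨ (12 ≤ a ∧ a ≤ 17 ∧ i = T)) :
    SameOff T μ (μ.setNat a i j v) := by
  refine ⟨fun a' i' j' h₁ h₂ h₃ => ?_, fun _ _ _ _ => rfl⟩
  rw [Mem.setNat_nat, if_neg]
  rintro ⟨rfl, rfl, rfl⟩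
  omega

theorem mat (h : SameOff T μ ν) {e : ℕ} (he : e ≠ T) (q : ℕ) : ν.mat e q = μ.mat e q := by
  have : ∀ a, ν.cplx a e q = μ.cplx a e q := fun a => by
    simp only [Mem.cplx, h.real _ e q fun _ _ => he]
  simp only [Mem.mat, this]

theorem supAt (h : SameOff T μ ν) {e : ℕ} (he : e ≠ T) {L : List (Fin n)}
    {F : Fin n → Matrix (Fin 2) (Fin 2) ℂ} (hs : SupAt μ e L F) : SupAt ν e L F where
  len := by rw [h.nat _ _ _ (by omega) (by omega) fun _ _ => he]; exact hs.len
  site l hl := by rw [h.nat _ _ _ (by omega) (by omega) fun _ _ => he]; exact hs.site l hl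
  flag q := by rw [h.nat _ _ _ (by omega) (by omega) fun _ _ => he]; exact hs.flag q
  mat q := by rw [h.mat he]; exact hs.mat q

theorem rowAt (h : SameOff T μ ν) {e : ℕ} (he : e ≠ T) {R : Row n} (hr : RowAt μ e R) :
    RowAt ν e R where
  toSupAt := h.supAt he hr.toSupAt
  stage := by rw [h.nat _ _ _ (by omega) (by omega) fun _ _ => he]; exact hr.stage
  cap := by rw [h.nat _ _ _ (by omega) (by omega) fun _ _ => he]; exact hr.cap
  pow := by rw [h.nat _ _ _ (by omega) (by omega) fun _ _ => he]; exact hr.pow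
  coef := by
    rw [← hr.coef]
    simp only [Mem.cplx, h.real _ e _ fun _ _ => he]

end SameOff

/-- The support of a row depends on the arrays of the supports only. -/
theorem SupAt.congr {μ ν : Mem} {e : ℕ} {L : List (Fin n)}
    {F : Fin n → Matrix (Fin 2) (Fin 2) ℂ} (hs : SupAt μ e L F)
    (hn : ∀ a j, 15 ≤ a → a ≤ 17 → ν.nat a e j = μ.nat a e j)
    (hr : ∀ a j, 7 ≤ a → a ≤ 14 → ν.real a e j = μ.real a e j) : SupAt ν e L F where
  len := by rw [hn _ _ (by omega) (by omega)]; exact hs.len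
  site l hl := by rw [hn _ _ (by omega) (by omega)]; exact hs.site l hl
  flag q := by rw [hn _ _ (by omega) (by omega)]; exact hs.flag q
  mat q := by
    rw [← hs.mat q]
    simp only [Mem.mat, Mem.cplx]
    simp only [hr 7 q (by omega) (by omega), hr 8 q (by omega) (by omega),
      hr 9 q (by omega) (by omega), hr 10 q (by omega) (by omega),
      hr 11 q (by omega) (by omega), hr 12 q (by omega) (by omega),
      hr 13 q (by omega) (by omega), hr 14 q (by omega) (by omega)]

/-! ## Correctness of the parts of the program -/

section Correctness

open Sim

variable {B : ℕ} {μ : Mem} {T : ℕ} {L : List (Fin n)} {F : Fin n → Matrix (Fin 2) (Fin 2) ℂ}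

/-- The indicator array decides membership in one lookup, so the list of qubits stays free of
repetitions without a search. -/
theorem wp_addSite {q : Fin n} (hT : μ.nat 7 0 0 = T) (hq : μ.nat 21 0 0 = q)
    (hs : SupAt μ T L F) :
    WP B addSite μ fun ν => SameOff T μ ν ∧ SupAt ν T (insertEnd L q) F := by
  refine WP.ite (fun hb => ?_) (fun hb => ?_)
  · have hqL : q ∉ L := by
      intro h
      simp [BExp.eval, NExp.eval, hT, hq, hs.flag q, h] at hb
    refine WP.seq (WP.setNat (WP.seq (WP.setNat (WP.setNat ?_))))
    simp only [NExp.eval, hT, hq, Mem.setNat_nat]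
    norm_num
    simp only [hs.len]
    refine ⟨((SameOff.setNat _ (by omega)).trans (SameOff.setNat _ (by omega))).trans
      (SameOff.setNat _ (by omega)), ?_⟩
    refine ⟨?_, fun l hl => ?_, fun q' => ?_, fun q' => ?_⟩
    · simp [insertEnd, hqL]
    · simp only [insertEnd, hqL, if_false] at hl ⊢
      simp only [Mem.setNat_nat]
      norm_num
      rw [List.length_append, List.length_singleton] at hl
      rcases Nat.lt_or_ge l L.length with h | h
      · rw [if_neg (by omega), List.getElem_append_left h]
        exact hs.site l h
      · have : l = L.length := by omega
        subst this
        simp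
    · simp only [Mem.setNat_nat]
      norm_num
      rw [hs.flag q']
      by_cases h : q' = q
      · subst h; simp [mem_insertEnd]
      · simp [mem_insertEnd, h, Fin.val_inj]
    · exact hs.mat q'
  · have hqL : q ∈ L := by
      by_contra h
      simp [BExp.eval, NExp.eval, hT, hq, hs.flag q, h] at hb
    refine WP.skip ⟨SameOff.refl _ _, ?_⟩
    rwa [insertEnd, if_pos hqL]

/-- An expression has the same value in two memories. -/
def CExp.Same (μ ν : Mem) (z : CExp) : Prop :=
  z.re.eval ν = z.re.eval μ ∧ z.im.eval ν = z.im.eval μ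

theorem CExp.Same.add {μ ν : Mem} {z w : CExp} (hz : z.Same μ ν) (hw : w.Same μ ν) :
    (z.add w).Same μ ν := by
  simp only [Same, CExp.add, RExp.eval, hz.1, hz.2, hw.1, hw.2, and_self]

theorem CExp.Same.sub {μ ν : Mem} {z w : CExp} (hz : z.Same μ ν) (hw : w.Same μ ν) :
    (z.sub w).Same μ ν := by
  simp only [Same, CExp.sub, RExp.eval, hz.1, hz.2, hw.1, hw.2, and_self]

theorem CExp.Same.mul {μ ν : Mem} {z w : CExp} (hz : z.Same μ ν) (hw : w.Same μ ν) :
    (z.mul w).Same μ ν := by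
  simp only [Same, CExp.mul, RExp.eval, hz.1, hz.2, hw.1, hw.2, and_self]

theorem CExp.Same.eval {μ ν : Mem} {z : CExp} (hz : z.Same μ ν) : z.eval ν = z.eval μ := by
  simp only [CExp.eval, hz.1, hz.2]

theorem CExp.same_const (μ ν : Mem) (x y : ℚ) : (CExp.const x y).Same μ ν := ⟨rfl, rfl⟩

theorem MExp.same_mul {μ ν : Mem} {A C : MExp} (hA : ∀ a b, (A a b).Same μ ν)
    (hC : ∀ a b, (C a b).Same μ ν) (a b : Fin 2) : (A.mul C a b).Same μ ν :=
  ((hA _ _).mul (hC _ _)).add ((hA _ _).mul (hC _ _))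

theorem MExp.same_sub {μ ν : Mem} {A C : MExp} (hA : ∀ a b, (A a b).Same μ ν)
    (hC : ∀ a b, (C a b).Same μ ν) (a b : Fin 2) : (A.sub C a b).Same μ ν :=
  (hA _ _).sub (hC _ _)

theorem MExp.same_one (μ ν : Mem) (a b : Fin 2) : (MExp.one a b).Same μ ν := by
  unfold one; split_ifs <;> exact CExp.same_const _ _ _ _

theorem same_pauliExp (μ ν : Mem) (P : Fin 4) (a b : Fin 2) : (pauliExp P a b).Same μ ν := by
  fin_cases P
  · exact MExp.same_one _ _ _ _
  all_goals
    simp only [pauliExp]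
    split_ifs <;> exact CExp.same_const _ _ _ _

@[simp] theorem eval_pauliExp (μ : Mem) (P : Fin 4) : (pauliExp P).eval μ = pauli P := by
  fin_cases P
  · exact MExp.eval_one μ
  all_goals
    ext a b
    fin_cases a <;> fin_cases b <;> apply Complex.ext <;>
      simp [MExp.eval, pauliExp, pauli, CExp.eval, CExp.const, RExp.eval]

theorem MExp.same_get {μ ν : Mem} {i j : NExp} (hn : ν.nat = μ.nat)
    (hr : ∀ a, ν.real a (i.eval μ) (j.eval μ) = μ.real a (i.eval μ) (j.eval μ)) (a b : Fin 2) :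
    (MExp.get i j a b).Same μ ν := by
  refine (MExp.same_one _ _ _ _).add ⟨?_, ?_⟩ <;>
    simp only [CExp.get, RExp.eval, NExp.eval_congr hn, hr]

/-- Overwriting one matrix of the row `T` by an expression that does not depend on this row. -/
theorem wp_setMat_row {q : Fin n} {A : MExp} {M : Matrix (Fin 2) (Fin 2) ℂ}
    (hT : μ.nat 7 0 0 = T) (hq : μ.nat 21 0 0 = q) (hs : SupAt μ T L F)
    (hA : ∀ ν : Mem, ν.nat = μ.nat →
      (∀ a i j, i ≠ T → ν.real a i j = μ.real a i j) → ∀ a b, (A a b).Same μ ν)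
    (hM : A.eval μ = M) :
    WP B (.setMat tail (.var 21) A) μ fun ν => SameOff T μ ν ∧ SupAt ν T L (update F q M) := by
  have e1 : NExp.eval μ tail = T := hT
  have e2 : NExp.eval μ (.var 21) = q := hq
  refine WP.setMat ?_ ?_
  · intro ν hn hr
    rw [e1, e2] at hr
    exact hA ν hn fun a i j hi => hr a i j fun h => hi h.1
  · intro ν hn hm hr hr'
    rw [e1, e2] at hm hr
    refine ⟨⟨fun a i j _ _ _ => by rw [hn], fun a i j h => ?_⟩, ?_, ?_, ?_, ?_⟩
    · by_cases hi : i = T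
      · rw [hr' a (by by_contra! hc; exact h (by omega) (by omega) hi)]
      · exact hr a i j fun h => hi h.1
    · rw [hn]; exact hs.len
    · rw [hn]; exact hs.site
    · rw [hn]; exact hs.flag
    · intro q'
      by_cases hqq : q' = q
      · subst hqq
        rw [hm, hM, update_self]
      · rw [update_of_ne hqq, ← hs.mat q']
        have : ∀ a, ν.real a T q' = μ.real a T q' := fun a =>
          hr a T q' fun h => hqq (Fin.val_injective h.2)
        simp only [Mem.mat, Mem.cplx, this]

theorem take_succ_of_lt {α : Type*} {M : List α} {i : ℕ} (hi : i < M.length) :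
    M.take (i + 1) = M.take i ++ [M[i]] := by
  rw [List.take_add_one, List.getElem?_eq_getElem hi, Option.toList_some]

theorem wp_copyRow {h : ℕ} {R : Row n} (hnd : R.sup.Nodup) (hfac : ∀ q ∉ R.sup, R.fac q = 1)
    (hB : R.sup.length ≤ B) (hh : μ.nat 8 0 0 = h) (hT : μ.nat 7 0 0 = T) (hhT : h ≠ T)
    (hR : RowAt μ h R) (hs : SupAt μ T ([] : List (Fin n)) fun _ => 1) :
    WP B copyRow μ fun ν => SameOff T μ ν ∧ SupAt ν T R.sup R.fac := by
  have hI : WP B copyRow μ fun ν => SameOff T μ ν ∧ SupAt ν T (R.sup.take R.sup.length)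
      (fun q => if q ∈ R.sup.take R.sup.length then R.fac q else 1) := by
    -- After `i` iterations the row agrees with the original on the first `i` qubits and is still
    -- the identity elsewhere.
    refine WP.for (fun i ν => SameOff T μ ν ∧ SupAt ν T (R.sup.take i)
      (fun q => if q ∈ R.sup.take i then R.fac q else 1)) hB (by decide) ?_ ?_ ?_
    · rintro i ν - ⟨hso, -⟩
      have h8 : ν.nat 8 0 0 = h := by rw [hso.nat _ _ _ (by omega) (by omega) (by omega), hh]
      simp only [NExp.eval, h8]
      exact (hso.rowAt hhT hR).len
    · refine ⟨SameOff.setNat _ (by omega), ?_⟩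
      refine SupAt.congr ?_ (μ := μ) (fun a j _ _ => ?_) (fun _ _ _ _ => rfl)
      · simpa using hs
      · rw [Mem.setNat_nat_of_ne _ _ _ _ (by omega)]
    · rintro i hi ν - hνi ⟨hso, hsup⟩
      have h8 : ν.nat 8 0 0 = h := by rw [hso.nat _ _ _ (by omega) (by omega) (by omega), hh]
      have h7 : ν.nat 7 0 0 = T := by rw [hso.nat _ _ _ (by omega) (by omega) (by omega), hT]
      have hRν := hso.rowAt hhT hR
      refine WP.seq (WP.setNat ?_)
      simp only [NExp.eval, h8, hνi, hRν.site i hi]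
      set ν₁ := ν.setNat 21 0 0 (R.sup[i] : Fin n) with hν₁
      have hso₁ : SameOff T μ ν₁ := hso.trans (SameOff.setNat _ (by omega))
      have hsup₁ : SupAt ν₁ T (R.sup.take i)
          (fun q => if q ∈ R.sup.take i then R.fac q else 1) :=
        hsup.congr (fun a j _ _ => by rw [hν₁, Mem.setNat_nat_of_ne _ _ _ _ (by omega)])
          fun _ _ _ _ => rfl
      have h7₁ : ν₁.nat 7 0 0 = T := by rw [hν₁, Mem.setNat_nat_of_ne _ _ _ _ (by omega), h7]
      refine WP.seq ((wp_addSite (q := R.sup[i]) h7₁ (by simp [hν₁]) hsup₁).mono ?_)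
      rintro ν₂ ha ⟨hso₂, hsup₂⟩
      have h21 : ν₂.nat 21 0 0 = (R.sup[i] : Fin n) := by
        rw [ha.1 21 (by decide)]; simp [hν₁]
      have hso₂' := hso₁.trans hso₂
      have h8₂ : ν₂.nat 8 0 0 = h := by
        rw [hso₂'.nat _ _ _ (by omega) (by omega) (by omega), hh]
      have h7₂ : ν₂.nat 7 0 0 = T := by
        rw [hso₂'.nat _ _ _ (by omega) (by omega) (by omega), hT]
      refine (wp_setMat_row (M := R.fac R.sup[i]) h7₂ h21 hsup₂ ?_ ?_).mono ?_
      · intro ξ hn hr a b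
        refine MExp.same_get hn (fun a => hr _ _ _ ?_) a b
        simp only [NExp.eval, h8₂]
        exact hhT
      · rw [MExp.eval_get]
        simp only [NExp.eval, h8₂, h21]
        exact (hso₂'.rowAt hhT hR).mat _
      · rintro ξ - ⟨hso₃, hsup₃⟩
        refine ⟨(hso₂'.trans hso₃).trans (SameOff.setNat _ (by omega)), ?_⟩
        -- Because the list has no repetitions, `addSite` really appends, and the order of the list
        -- is preserved.
        have hmem : R.sup[i] ∉ R.sup.take i := by
          intro hm
          have := hnd.sublist (List.take_sublist (i + 1) R.sup)
          rw [take_succ_of_lt hi, List.nodup_append] at this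
          exact this.2.2 _ hm _ (List.mem_singleton_self _) rfl
        rw [insertEnd, if_neg hmem, ← take_succ_of_lt hi] at hsup₃
        have hF : (fun q => if q ∈ R.sup.take (i + 1) then R.fac q else 1)
            = update (fun q => if q ∈ R.sup.take i then R.fac q else 1) R.sup[i]
              (R.fac R.sup[i]) := by
          funext q
          by_cases hq : q = R.sup[i]
          · rw [hq, update_self, if_pos (by
              rw [take_succ_of_lt hi]
              exact List.mem_append_right _ (List.mem_singleton_self _))]
          · rw [update_of_ne hq]
            have : q ∈ R.sup.take (i + 1) ↔ q ∈ R.sup.take i := by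
              rw [take_succ_of_lt hi, List.mem_append, List.mem_singleton, or_iff_left hq]
            simp only [this]
        rw [hF]
        exact hsup₃.congr (fun a j _ _ => by rw [Mem.setNat_nat_of_ne _ _ _ _ (by omega)])
          fun _ _ _ _ => rfl
  refine hI.mono ?_
  rintro ν - ⟨h₁, h₂⟩
  refine ⟨h₁, ?_⟩
  rw [List.take_length] at h₂
  convert h₂ using 1
  funext q
  split_ifs with hq
  · rfl
  · exact hfac q hq

end Correctness

end AdiabaticSim

namespace AdiabaticSim

open Function

variable {n : ℕ}

section Correctness

open Sim

variable {B : ℕ} {μ : Mem} {T : ℕ} {L : List (Fin n)} {F : Fin n → Matrix (Fin 2) (Fin 2) ℂ}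

theorem wp_withPauli {e : NExp} {f : Fin 4 → Prog} {P : Fin 4} {Q : Mem → Prop}
    (he : e.eval μ = P) (h : WP B (f P) μ Q) : WP B (withPauli e f) μ Q := by
  have key : ∀ c : ℕ, (BExp.natLe e (.const c)).eval μ ↔ (P : ℕ) ≤ c := fun c => by
    simp [BExp.eval, NExp.eval, he]
  refine WP.ite (fun h0 => ?_) fun h0 => WP.ite (fun h1 => ?_) fun h1 => WP.ite (fun h2 => ?_)
    fun h2 => ?_
  all_goals
    simp only [key] at *
    convert h
    apply Fin.ext
    have := P.isLt
    simp
    omega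

theorem wp_applyLetter {h : ℕ} {R : Row n} {σ : Fin n → Fin 4} {q₀ q : Fin n}
    (h19 : μ.nat 19 0 0 = q₀) (h21 : μ.nat 21 0 0 = q) (hh : μ.nat 8 0 0 = h)
    (hT : μ.nat 7 0 0 = T) (hhT : h ≠ T) (hR : RowAt μ h R) (hs : SupAt μ T L F) :
    WP B (applyLetter (σ q)) μ fun ν => SameOff T μ ν ∧
      SupAt ν T L (update F q (commFactor (fun i => pauli (σ i)) R.fac q₀ q)) := by
  have hget : ∀ ν : Mem, ν.nat = μ.nat → (∀ a i j, i ≠ T → ν.real a i j = μ.real a i j) →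
      ∀ a b, (MExp.get head (.var 21) a b).Same μ ν := fun ν hn hr =>
    MExp.same_get hn fun a => hr _ _ _ (by simp only [NExp.eval, hh]; exact hhT)
  have heval : (MExp.get head (.var 21)).eval μ = R.fac q := by
    rw [MExp.eval_get]
    simp only [NExp.eval, hh, h21]
    exact hR.mat q
  refine WP.ite (fun h0 => ?_) fun h0 => WP.ite (fun h1 => ?_) fun h1 => ?_
  · have hlt : q < q₀ := by simpa [BExp.eval, NExp.eval, h19, h21] using h0
    refine wp_setMat_row hT h21 hs
      (fun ν hn hr => MExp.same_mul (same_pauliExp _ _ _) (hget ν hn hr)) ?_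
    rw [MExp.eval_mul, eval_pauliExp, heval, commFactor, if_pos hlt]
  · have hle : q₀ ≤ q := by simpa [BExp.eval, NExp.eval, h19, h21] using h0
    have hlt : q₀ < q := by simpa [BExp.eval, NExp.eval, h19, h21] using h1
    refine wp_setMat_row hT h21 hs
      (fun ν hn hr => MExp.same_mul (hget ν hn hr) (same_pauliExp _ _ _)) ?_
    rw [MExp.eval_mul, eval_pauliExp, heval, commFactor, if_neg hle.not_gt, if_pos hlt]
  · have hle : q₀ ≤ q := by simpa [BExp.eval, NExp.eval, h19, h21] using h0
    have hle' : q ≤ q₀ := by simpa [BExp.eval, NExp.eval, h19, h21] using h1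
    refine wp_setMat_row hT h21 hs
      (fun ν hn hr => MExp.same_sub (MExp.same_mul (same_pauliExp _ _ _) (hget ν hn hr))
        (MExp.same_mul (hget ν hn hr) (same_pauliExp _ _ _))) ?_
    rw [MExp.eval_sub, MExp.eval_mul, MExp.eval_mul, eval_pauliExp, heval, commFactor,
      if_neg hle.not_gt, if_neg hle'.not_gt]

/-- The input describes the term `X` by the Pauli string `σ`. -/
structure TermAt (μ : Mem) (X : ℕ) (σ : Fin n → Fin 4) : Prop where
  len : μ.nat 1 X 0 = (siteList σ).length
  site : ∀ (l : ℕ) (hl : l < (siteList σ).length), μ.nat 2 X l = (siteList σ)[l]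
  letter : ∀ (l : ℕ) (hl : l < (siteList σ).length), μ.nat 3 X l = σ (siteList σ)[l]

theorem TermAt.sameOff {ν : Mem} {X : ℕ} {σ : Fin n → Fin 4} (h : TermAt μ X σ)
    (hs : SameOff T μ ν) : TermAt ν X σ where
  len := by rw [hs.nat _ _ _ (by omega) (by omega) (by omega)]; exact h.len
  site l hl := by rw [hs.nat _ _ _ (by omega) (by omega) (by omega)]; exact h.site l hl
  letter l hl := by rw [hs.nat _ _ _ (by omega) (by omega) (by omega)]; exact h.letter l hl

/-- Off the support of the term the factors of the commutator are those of the copied row, so only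
the sites of the term are visited. The condition `σ q₀ ≠ 0` ensures that the distinguished qubit is
among them. The factors are always read from the first row, which is not being overwritten. -/
theorem wp_applyTerm {h X : ℕ} {R : Row n} {σ : Fin n → Fin 4} {q₀ : Fin n}
    (hB : (siteList σ).length ≤ B) (hq₀ : σ q₀ ≠ 0)
    (h19 : μ.nat 19 0 0 = q₀) (h20 : μ.nat 20 0 0 = X) (hh : μ.nat 8 0 0 = h)
    (hT : μ.nat 7 0 0 = T) (hhT : h ≠ T) (hX : TermAt μ X σ) (hR : RowAt μ h R)
    (hs : SupAt μ T R.sup R.fac) :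
    WP B applyTerm μ fun ν => SameOff T μ ν ∧ SupAt ν T (appendNew R.sup (siteList σ))
      (commFactor (fun i => pauli (σ i)) R.fac q₀) := by
  set Y := siteList σ with hY
  set G := commFactor (fun i => pauli (σ i)) R.fac q₀ with hG
  have hI : WP B applyTerm μ fun ν => SameOff T μ ν ∧
      SupAt ν T (appendNew R.sup (Y.take Y.length))
        (fun q => if q ∈ Y.take Y.length then G q else R.fac q) := by
    refine WP.for (fun i ν => SameOff T μ ν ∧ SupAt ν T (appendNew R.sup (Y.take i))
      (fun q => if q ∈ Y.take i then G q else R.fac q)) hB (by decide) ?_ ?_ ?_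
    · rintro i ν - ⟨hso, -⟩
      have h20ν : ν.nat 20 0 0 = X := by
        rw [hso.nat _ _ _ (by omega) (by omega) (by omega), h20]
      simp only [NExp.eval, h20ν]
      exact (hX.sameOff hso).len
    · refine ⟨SameOff.setNat _ (by omega), ?_⟩
      refine SupAt.congr ?_ (μ := μ) (fun a j _ _ => ?_) (fun _ _ _ _ => rfl)
      · simpa [appendNew] using hs
      · rw [Mem.setNat_nat_of_ne _ _ _ _ (by omega)]
    · rintro i hi ν - hνi ⟨hso, hsup⟩
      have h20ν : ν.nat 20 0 0 = X := by
        rw [hso.nat _ _ _ (by omega) (by omega) (by omega), h20]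
      have h7 : ν.nat 7 0 0 = T := by rw [hso.nat _ _ _ (by omega) (by omega) (by omega), hT]
      refine WP.seq (WP.setNat ?_)
      simp only [NExp.eval, h20ν, hνi, (hX.sameOff hso).site i hi]
      change WP B _ (ν.setNat 21 0 0 (Y[i] : Fin n)) _
      set ν₁ := ν.setNat 21 0 0 (Y[i] : Fin n) with hν₁
      have hso₁ : SameOff T μ ν₁ := hso.trans (SameOff.setNat _ (by omega))
      have hsup₁ := hsup.congr (ν := ν₁)
        (fun a j _ _ => by rw [hν₁, Mem.setNat_nat_of_ne _ _ _ _ (by omega)]) fun _ _ _ _ => rfl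
      have h7₁ : ν₁.nat 7 0 0 = T := by rw [hν₁, Mem.setNat_nat_of_ne _ _ _ _ (by omega), h7]
      have h11₁ : ν₁.nat 11 0 0 = i := by
        rw [hν₁, Mem.setNat_nat_of_ne _ _ _ _ (by omega), hνi]
      refine WP.seq ((wp_addSite (q := Y[i]) h7₁ (by simp [hν₁]) hsup₁).mono ?_)
      rintro ν₂ ha ⟨hso₂, hsup₂⟩
      have h21 : ν₂.nat 21 0 0 = (Y[i] : Fin n) := by rw [ha.1 21 (by decide)]; simp [hν₁]
      have h11₂ : ν₂.nat 11 0 0 = i := by rw [ha.1 11 (by decide), h11₁]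
      have hso₂' := hso₁.trans hso₂
      have hsc : ∀ a, a ≠ 11 → a ≠ 21 → (a < 12 ∨ 17 < a) → ν₂.nat a 0 0 = μ.nat a 0 0 :=
        fun a h1 h2 h3 => hso₂'.nat _ _ _ h1 h2 (by omega)
      refine wp_withPauli (P := σ Y[i]) ?_ ?_
      · simp only [NExp.eval, h11₂, hsc 20 (by omega) (by omega) (by omega), h20]
        exact (hX.sameOff hso₂').letter i hi
      · refine (wp_applyLetter (q₀ := q₀) ((hsc 19 (by omega) (by omega) (by omega)).trans h19) h21
          ((hsc 8 (by omega) (by omega) (by omega)).trans hh)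
          ((hsc 7 (by omega) (by omega) (by omega)).trans hT) hhT (hso₂'.rowAt hhT hR) hsup₂).mono ?_
        rintro ξ - ⟨hso₃, hsup₃⟩
        refine ⟨(hso₂'.trans hso₃).trans (SameOff.setNat _ (by omega)), ?_⟩
        have hL : appendNew R.sup (Y.take (i + 1)) = insertEnd (appendNew R.sup (Y.take i)) Y[i] := by
          rw [take_succ_of_lt hi, appendNew, List.foldl_append]; rfl
        have hF : (fun q => if q ∈ Y.take (i + 1) then G q else R.fac q)
            = update (fun q => if q ∈ Y.take i then G q else R.fac q) Y[i] (G Y[i]) := by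
          funext q
          by_cases hq : q = Y[i]
          · rw [hq, update_self, if_pos (by
              rw [take_succ_of_lt hi]
              exact List.mem_append_right _ (List.mem_singleton_self _))]
          · rw [update_of_ne hq]
            have : q ∈ Y.take (i + 1) ↔ q ∈ Y.take i := by
              rw [take_succ_of_lt hi, List.mem_append, List.mem_singleton, or_iff_left hq]
            simp only [this]
        rw [hF, hL]
        exact hsup₃.congr (fun a j _ _ => by rw [Mem.setNat_nat_of_ne _ _ _ _ (by omega)])
          fun _ _ _ _ => rfl
  refine hI.mono ?_
  rintro ν - ⟨h₁, h₂⟩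
  refine ⟨h₁, ?_⟩
  rw [List.take_length] at h₂
  convert h₂ using 1
  funext q
  split_ifs with hq
  · rfl
  · have h0 : σ q = 0 := by
      by_contra h0
      exact hq (mem_siteList.2 h0)
    have hne : q ≠ q₀ := by
      rintro rfl
      exact hq₀ h0
    rw [hG, commFactor]
    simp only [h0, pauli_zero, one_mul, mul_one]
    rcases lt_or_gt_of_ne hne with h | h
    · rw [if_pos h]
    · rw [if_neg h.not_gt, if_pos h]

/-- The row enters the queue only when the tail is incremented. As its fields are written one by
one, the expressions must keep their values in every memory that differs from `μ₀` only at the row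
`T` and in the two auxiliary scalars. -/
theorem wp_finish {h : ℕ} {μ₀ : Mem} {rows : List (Row n)} {R : Row n} {s c p : NExp} {z : CExp}
    (hQ : QueueAt h μ₀ rows) (hT : T = h + rows.length) (hso : SameOff T μ₀ μ)
    (hsup : SupAt μ T R.sup R.fac)
    (hs : ∀ ν, SameOff T μ₀ ν → s.eval ν = R.stage)
    (hc : ∀ ν, SameOff T μ₀ ν → c.eval ν = R.cap)
    (hp : ∀ ν, SameOff T μ₀ ν → p.eval ν = R.pow)
    (hz : ∀ ν, SameOff T μ₀ ν → z.Same μ₀ ν) (hz' : z.eval μ₀ = R.coef) :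
    WP B (finish s c p z) μ fun ν => QueueAt h ν (rows ++ [R]) := by
  have htail : ∀ ν, SameOff T μ₀ ν → ν.nat 7 0 0 = T := fun ν hν => by
    rw [hν.nat _ _ _ (by omega) (by omega) (by omega), hQ.tail, hT]
  refine WP.seq (WP.setNat ?_)
  simp only [NExp.eval, htail μ hso, hs μ hso]
  set ν₁ := μ.setNat 12 T 0 R.stage with hν₁
  have hso₁ : SameOff T μ₀ ν₁ := hso.trans (SameOff.setNat _ (by omega))
  refine WP.seq (WP.setNat ?_)
  simp only [NExp.eval, htail ν₁ hso₁, hc ν₁ hso₁]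
  set ν₂ := ν₁.setNat 13 T 0 R.cap with hν₂
  have hso₂ : SameOff T μ₀ ν₂ := hso₁.trans (SameOff.setNat _ (by omega))
  refine WP.seq (WP.setNat ?_)
  simp only [NExp.eval, htail ν₂ hso₂, hp ν₂ hso₂]
  set ν₃ := ν₂.setNat 14 T 0 R.pow with hν₃
  have hso₃ : SameOff T μ₀ ν₃ := hso₂.trans (SameOff.setNat _ (by omega))
  have e7 : NExp.eval ν₃ tail = T := htail ν₃ hso₃
  refine WP.seq (WP.setC (fun v => ?_) (by simp) (by simp) ?_)
  · rw [e7]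
    refine ((hz (ν₃.setReal 5 T 0 v) (hso₃.trans ⟨fun _ _ _ _ _ _ => rfl, fun a i j hij => ?_⟩)).2).trans
      (hz _ hso₃).2.symm
    rw [Mem.setReal_real, if_neg]
    rintro ⟨rfl, rfl, -⟩
    exact hij (by omega) (by omega) rfl
  · rw [e7]
    intro ν₄ hn hz₄ hr hr'
    have hso₄ : SameOff T μ₀ ν₄ := by
      refine hso₃.trans ⟨fun a i j _ _ _ => by rw [hn], fun a i j hij => ?_⟩
      by_cases hi : i = T
      · rw [hr' a (fun h' => hij (by omega) (by omega) hi) (fun h' => hij (by omega) (by omega) hi)]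
      · exact hr a i j fun h' => hi h'.1
    refine WP.setNat ?_
    simp only [NExp.eval, htail ν₄ hso₄]
    have hoff : ∀ {a i j : ℕ}, a ≠ 7 → (ν₄.setNat 7 0 0 (T + 1)).nat a i j = ν₄.nat a i j :=
      fun ha => by rw [Mem.setNat_nat_of_ne _ _ _ _ ha]
    have hrow : ∀ e, e ≠ T → SameOff T μ₀ ν₄ → ∀ R' : Row n, RowAt μ₀ e R' →
        RowAt (ν₄.setNat 7 0 0 (T + 1)) e R' := by
      intro e he hso R' hR'
      have hR'' := hso.rowAt he hR'
      exact ⟨hR''.toSupAt.congr (fun a j _ _ => hoff (by omega)) fun _ _ _ _ => rfl,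
        (hoff (by omega)).trans hR''.stage, (hoff (by omega)).trans hR''.cap,
        (hoff (by omega)).trans hR''.pow, hR''.coef⟩
    refine ⟨?_, ?_, fun i hi => ?_, fun e he => ?_⟩
    · rw [hoff (by omega), hso₄.nat _ _ _ (by omega) (by omega) (by omega), hQ.head]
    · rw [Mem.setNat_nat_self, List.length_append, List.length_singleton, hT, add_assoc]
    · rw [List.length_append, List.length_singleton] at hi
      rcases Nat.lt_or_ge i rows.length with hlt | hge
      · rw [List.getElem_append_left hlt]
        exact hrow _ (by omega) hso₄ _ (hQ.row i hlt)
      · have hi' : i = rows.length := by omega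
        subst hi'
        rw [List.getElem_append_right le_rfl, ← hT]
        simp only [Nat.sub_self, List.getElem_cons_zero]
        refine ⟨hsup.congr (fun a j ha hb => ?_) fun a j ha hb => ?_, ?_, ?_, ?_, ?_⟩
        · rw [hoff (by omega), hn, hν₃, Mem.setNat_nat_of_ne _ _ _ _ (by omega), hν₂,
            Mem.setNat_nat_of_ne _ _ _ _ (by omega), hν₁,
            Mem.setNat_nat_of_ne _ _ _ _ (by omega)]
        · rw [Mem.setNat_real, hr' a (by omega) (by omega)]
          rfl
        · rw [hoff (by omega), hn, hν₃, Mem.setNat_nat_of_ne _ _ _ _ (by omega), hν₂,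
            Mem.setNat_nat_of_ne _ _ _ _ (by omega), hν₁, Mem.setNat_nat_self]
        · rw [hoff (by omega), hn, hν₃, Mem.setNat_nat_of_ne _ _ _ _ (by omega), hν₂,
            Mem.setNat_nat_self]
        · rw [hoff (by omega), hn, hν₃, Mem.setNat_nat_self]
        · refine Eq.trans ?_ (hz₄.trans ((hz _ hso₃).eval.trans hz'))
          rfl
    · rw [List.length_append, List.length_singleton] at he
      exact (hso₄.supAt (by omega) (hQ.fresh e (by omega))).congr
        (fun a j _ _ => hoff (by omega)) fun _ _ _ _ => rfl

end Correctness

end AdiabaticSim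

set_option maxRecDepth 8000

/-! ### Preservation of the input and of the queue -/

namespace AdiabaticSim

open Function

variable {n : ℕ}

/-- The input part of the memory is that of `E`. -/
structure InputAt (E μ : Mem) : Prop where
  nat : ∀ a ≤ 6, μ.nat a = E.nat a
  real : ∀ a ≤ 4, μ.real a = E.real a

theorem InputAt.agree {E μ ν : Mem} {p : Prog} (h : InputAt E μ) (ha : Agree p μ ν)
    (hn : ∀ a ∈ p.natW, 7 ≤ a) (hr : ∀ a ∈ p.realW, 5 ≤ a) : InputAt E ν where
  nat a ha' := by rw [ha.1 a fun h' => by have := hn a h'; omega, h.nat a ha']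
  real a ha' := by rw [ha.2 a fun h' => by have := hr a h'; omega, h.real a ha']

theorem InputAt.setNat {E μ : Mem} {a i j v : ℕ} (h : InputAt E μ) (ha : 7 ≤ a) :
    InputAt E (μ.setNat a i j v) where
  nat a' ha' := by rw [Mem.setNat_nat_of_ne _ _ _ _ (by omega), h.nat a' ha']
  real a' ha' := h.real a' ha'

theorem QueueAt.setNat {h : ℕ} {μ : Mem} {rows : List (Row n)} {a i j v : ℕ}
    (hQ : QueueAt h μ rows) (ha : a ≠ 7) (ha' : a ≠ 8) (ha'' : a < 12 ∨ 17 < a) :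
    QueueAt h (μ.setNat a i j v) rows := by
  have e : ∀ a', a' ≠ a → (μ.setNat a i j v).nat a' = μ.nat a' := fun a' h =>
    Mem.setNat_nat_of_ne _ _ _ _ h
  refine ⟨by rw [e 8 (by omega), hQ.head], by rw [e 7 (by omega), hQ.tail], fun i hi => ?_,
    fun i hi => ?_⟩
  · have hr := hQ.row i hi
    exact ⟨hr.toSupAt.congr (fun a' j _ _ => by rw [e a' (by omega)]) fun _ _ _ _ => rfl,
      by rw [e 12 (by omega), hr.stage], by rw [e 13 (by omega), hr.cap],
      by rw [e 14 (by omega), hr.pow], hr.coef⟩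
  · exact (hQ.fresh i hi).congr (fun a' j _ _ => by rw [e a' (by omega)]) fun _ _ _ _ => rfl

theorem QueueAt.pop {h : ℕ} {μ : Mem} {R : Row n} {rows : List (Row n)}
    (hQ : QueueAt h μ (R :: rows)) : QueueAt (h + 1) (μ.setNat 8 0 0 (h + 1)) rows := by
  have e : ∀ a', a' ≠ 8 → (μ.setNat 8 0 0 (h + 1)).nat a' = μ.nat a' := fun a' h =>
    Mem.setNat_nat_of_ne _ _ _ _ h
  refine ⟨by simp, ?_, fun i hi => ?_, fun i hi => ?_⟩
  · rw [e 7 (by omega), hQ.tail, List.length_cons]; omega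
  · have hr := hQ.row (i + 1) (by simpa using hi)
    rw [show h + (i + 1) = h + 1 + i by omega] at hr
    exact ⟨hr.toSupAt.congr (fun a' j _ _ => by rw [e a' (by omega)]) fun _ _ _ _ => rfl,
      by rw [e 12 (by omega), hr.stage]; rfl, by rw [e 13 (by omega), hr.cap]; rfl,
      by rw [e 14 (by omega), hr.pow]; rfl, hr.coef⟩
  · refine (hQ.fresh i ?_).congr (fun a' j _ _ => by rw [e a' (by omega)]) fun _ _ _ _ => rfl
    rw [List.length_cons]; omega

theorem QueueAt.congr {h : ℕ} {μ ν : Mem} {rows : List (Row n)} (hQ : QueueAt h μ rows)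
    (hn : ∀ a, a = 7 ∨ a = 8 ∨ (12 ≤ a ∧ a ≤ 17) → ν.nat a = μ.nat a)
    (hr : ∀ a, 5 ≤ a → a ≤ 14 → ν.real a = μ.real a) : QueueAt h ν rows := by
  refine ⟨by rw [hn 8 (by omega), hQ.head], by rw [hn 7 (by omega), hQ.tail], fun i hi => ?_,
    fun i hi => ?_⟩
  · have hR := hQ.row i hi
    exact ⟨hR.toSupAt.congr (fun a' j _ _ => by rw [hn a' (by omega)])
        (fun a' j _ _ => by rw [hr a' (by omega) (by omega)]),
      by rw [hn 12 (by omega), hR.stage], by rw [hn 13 (by omega), hR.cap],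
      by rw [hn 14 (by omega), hR.pow], by
        rw [← hR.coef]
        simp only [Mem.cplx, hr 5 (by omega) (by omega), hr (5 + 1) (by omega) (by omega)]⟩
  · exact (hQ.fresh i hi).congr (fun a' j _ _ => by rw [hn a' (by omega)])
      (fun a' j _ _ => by rw [hr a' (by omega) (by omega)])

/-! ## The input -/

section Input

variable {k : ℕ} (H : AdiabaticHamiltonian n k) (O : LocalObservable n k) (ψ : ProductState n)
  (t ε : ℝ)

theorem entry_fin {α : Type*} [Zero α] {m : ℕ} (f : Fin m → α) (i : Fin m) :
    entry f i = f i := by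
  simp [entry]

theorem listEntry_of_lt {m : ℕ} (M : List (Fin m)) {l : ℕ} (hl : l < M.length) :
    listEntry M l = M[l] := by
  simp [listEntry, List.getD_eq_getElem?_getD, hl]

theorem encode_termAt (X : Fin H.numTerms) : TermAt (encode H O ψ t ε) X (H.term X) where
  len := entry_fin (fun j => (siteList (H.term j)).length) X
  site l hl := (entry_fin (fun j => listEntry (siteList (H.term j)) l) X).trans
    (listEntry_of_lt _ hl)
  letter l hl := (entry_fin (fun j => listEntry ((siteList (H.term j)).map (H.term j)) l) X).trans
    ((listEntry_of_lt _ (by simpa using hl)).trans (by simp))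

theorem encode_degree (q : Fin n) :
    (encode H O ψ t ε).nat 4 q 0 = (H.termsAt q).length :=
  entry_fin (fun q => (H.termsAt q).length) q

theorem encode_termsAt (q : Fin n) {l : ℕ} (hl : l < (H.termsAt q).length) :
    (encode H O ψ t ε).nat 5 q l = (H.termsAt q)[l] :=
  (entry_fin (fun q => listEntry (H.termsAt q) l) q).trans (listEntry_of_lt _ hl)

theorem encode_coeff₀ (X : Fin H.numTerms) :
    (encode H O ψ t ε).real 1 X 0 = H.coeff₀ X := entry_fin H.coeff₀ X

theorem encode_coeff₁ (X : Fin H.numTerms) :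
    (encode H O ψ t ε).real 1 X 1 = H.coeff₁ X := entry_fin H.coeff₁ X

theorem encode_amplitude (q : Fin n) (a : Fin 2) :
    (⟨(encode H O ψ t ε).real 4 q (2 * a), (encode H O ψ t ε).real 4 q (2 * a + 1)⟩ : ℂ)
      = ψ.factor q a := by
  fin_cases a
  · exact Complex.ext (entry_fin (fun q => (ψ.factor q 0).re) q)
      (entry_fin (fun q => (ψ.factor q 0).im) q)
  · exact Complex.ext (entry_fin (fun q => (ψ.factor q 1).re) q)
      (entry_fin (fun q => (ψ.factor q 1).im) q)

end Input

/-! ## The children of a row -/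

namespace Row

variable {k : ℕ} (H : AdiabaticHamiltonian n k) (u : ℝ)

/-- A row is different from the identity only on the qubits in its list, which has no
repetitions. -/
structure Valid (R : Row n) : Prop where
  nodup : R.sup.Nodup
  fac_eq_one : ∀ q ∉ R.sup, R.fac q = 1

/-- The real factor of the coefficient that the power increment `κ + 1` contributes. -/
noncomputable def factor (R : Row n) (X : Fin H.numTerms) (κ : Fin 2) : ℝ :=
  if κ = 0 then u / (R.pow + 1) * H.coeffAt (R.stage * u) X
  else u ^ 2 / (R.pow + 2) * H.coeffSlope X

/-- The part at `q` of the commutator with the term `X`. -/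
noncomputable def kid (R : Row n) (κ : Fin 2) (q : Fin n) (X : Fin H.numTerms) : Row n where
  stage := R.stage
  cap := R.cap
  pow := R.pow + (κ + 1)
  coef := R.coef * (Complex.I * R.factor H u X κ)
  fac := commFactor (fun i => pauli (H.term X i)) R.fac q
  sup := appendNew R.sup (siteList (H.term X))

/-- The part at `q` of the commutator with the term `X`, unless its power is too large. -/
noncomputable def kids (R : Row n) (κ : Fin 2) (q : Fin n) (X : Fin H.numTerms) : List (Row n) :=
  if R.pow + (κ + 1) ≤ R.cap then [R.kid H u κ q X] else []

/-- The same operator in the next stage. -/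
def next (R : Row n) : Row n where
  stage := R.stage - 1
  cap := R.cap + R.cap
  pow := 0
  coef := R.coef
  fac := R.fac
  sup := R.sup

/-- All commutators. -/
noncomputable def commutators (R : Row n) : List (Row n) :=
  R.sup.flatMap fun q => (H.termsAt q).flatMap fun X => R.kids H u 0 q X ++ R.kids H u 1 q X

/-- The rows that processing `R` appends. -/
noncomputable def children (R : Row n) : List (Row n) :=
  if R.stage = 0 then [] else R.next :: R.commutators H u

end Row

/-! ## Correctness of the processing of a row -/

section Processing

open Sim

variable {k : ℕ} {H : AdiabaticHamiltonian n k} {O : LocalObservable n k} {ψ : ProductState n}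
  {t ε : ℝ} {B J h : ℕ} {μ : Mem} {R : Row n} {rows : List (Row n)}

theorem wp_child (κ : Fin 2) (hI : InputAt (encode H O ψ t ε) μ)
    (hQ : QueueAt h μ (R :: rows)) (hR : R.Valid) (hB : R.sup.length ≤ B) (hkB : k ≤ B)
    {q : Fin n} {X : Fin H.numTerms} (hq : H.term X q ≠ 0)
    (h19 : μ.nat 19 0 0 = q) (h20 : μ.nat 20 0 0 = X) :
    WP B (child J κ) μ fun ν => QueueAt h ν (R :: rows ++ R.kids H (t / J) κ q X) := by
  have hrow : RowAt μ h R := hQ.row 0 (by simp)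
  set T := h + (R :: rows).length with hT
  have hhT : h ≠ T := by rw [hT, List.length_cons]; omega
  have h7 : μ.nat 7 0 0 = T := hQ.tail
  have hX : TermAt μ X (H.term X) := by
    have h0 := encode_termAt H O ψ t ε X
    exact ⟨by rw [hI.nat 1 (by omega)]; exact h0.len,
      fun l hl => by rw [hI.nat 2 (by omega)]; exact h0.site l hl,
      fun l hl => by rw [hI.nat 3 (by omega)]; exact h0.letter l hl⟩
  refine WP.ite (fun hb => ?_) fun hb => ?_
  · have hle : R.pow + (κ + 1) ≤ R.cap := by
      simpa [BExp.eval, NExp.eval, hQ.head, hrow.pow, hrow.cap] using hb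
    rw [Row.kids, if_pos hle]
    refine WP.seq ((wp_copyRow hR.nodup hR.fac_eq_one hB hQ.head h7 hhT hrow
      (hQ.fresh T le_rfl)).mono ?_)
    rintro ν₁ - ⟨hso₁, hsup₁⟩
    have hsc : ∀ a, a ≠ 11 → a ≠ 21 → (a < 12 ∨ 17 < a) → ν₁.nat a 0 0 = μ.nat a 0 0 :=
      fun a h1 h2 h3 => hso₁.nat _ _ _ h1 h2 (by omega)
    refine WP.seq ((wp_applyTerm (X := X) ((H.term_local X).trans hkB) hq
      ((hsc 19 (by omega) (by omega) (by omega)).trans h19)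
      ((hsc 20 (by omega) (by omega) (by omega)).trans h20)
      ((hsc 8 (by omega) (by omega) (by omega)).trans hQ.head)
      ((hsc 7 (by omega) (by omega) (by omega)).trans h7) hhT (hX.sameOff hso₁)
      (hso₁.rowAt hhT hrow) hsup₁).mono ?_)
    rintro ν₂ - ⟨hso₂, hsup₂⟩
    have hs8 : ∀ ν, SameOff T μ ν → ν.nat 8 0 0 = h := fun ν hν => by
      rw [hν.nat _ _ _ (by omega) (by omega) (by omega), hQ.head]
    refine wp_finish (R := R.kid H (t / J) κ q X) hQ rfl (hso₁.trans hso₂) hsup₂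
      (fun ν hν => ?_) (fun ν hν => ?_) (fun ν hν => ?_) (fun ν hν => ?_) ?_
    · simp only [NExp.eval, hs8 ν hν]; exact (hν.rowAt hhT hrow).stage
    · simp only [NExp.eval, hs8 ν hν]; exact (hν.rowAt hhT hrow).cap
    · simp only [NExp.eval, hs8 ν hν, (hν.rowAt hhT hrow).pow]; rfl
    · refine CExp.Same.mul ⟨?_, ?_⟩ ⟨rfl, ?_⟩
      · simp only [CExp.get, RExp.eval, NExp.eval, hs8 ν hν, hQ.head]
        exact hν.real _ _ _ fun _ _ => hhT
      · simp only [CExp.get, RExp.eval, NExp.eval, hs8 ν hν, hQ.head]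
        exact hν.real _ _ _ fun _ _ => hhT
      · have e0 : ν.real 0 0 0 = μ.real 0 0 0 := hν.real _ _ _ (by omega)
        have e1 : ∀ i j, ν.real 1 i j = μ.real 1 i j := fun i j => hν.real _ _ _ (by omega)
        have e20 : ν.nat 20 0 0 = μ.nat 20 0 0 := hν.nat _ _ _ (by omega) (by omega) (by omega)
        have e12 : ν.nat 12 h 0 = μ.nat 12 h 0 :=
          hν.nat _ _ _ (by omega) (by omega) fun _ _ => hhT
        have e14 : ν.nat 14 h 0 = μ.nat 14 h 0 :=
          hν.nat _ _ _ (by omega) (by omega) fun _ _ => hhT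
        fin_cases κ <;>
          simp [factorExp, duration, RExp.eval, NExp.eval, hs8 ν hν, hQ.head, e0, e1, e20, e12, e14]
    · rw [CExp.eval_mul, CExp.eval_get]
      have e1 : μ.cplx 5 (NExp.eval μ head) (NExp.eval μ zero) = R.coef := by
        simp only [NExp.eval, hQ.head]; exact hrow.coef
      rw [e1]
      have e0 : μ.real 0 0 0 = t := by rw [hI.real 0 (by omega)]; rfl
      have ec : μ.real 1 X 0 = H.coeff₀ X := by
        rw [hI.real 1 (by omega)]; exact encode_coeff₀ H O ψ t ε X
      have ec' : μ.real 1 X 1 = H.coeff₁ X := by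
        rw [hI.real 1 (by omega)]; exact encode_coeff₁ H O ψ t ε X
      have e2 : (factorExp J κ).eval μ = R.factor H (t / J) X κ := by
        fin_cases κ <;>
          simp [factorExp, duration, RExp.eval, NExp.eval, hQ.head, hrow.pow, hrow.stage, h20, e0,
            ec, ec', Row.factor, AdiabaticHamiltonian.coeffAt,
            AdiabaticHamiltonian.coeffSlope]
        first | ring1 | (left; ring1)
      have e3 : CExp.eval μ ⟨.const 0, factorExp J κ⟩
          = Complex.I * (R.factor H (t / J) X κ : ℂ) := by
        apply Complex.ext <;> simp [CExp.eval, RExp.eval, e2]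
      rw [e3]
      rfl
  · have hlt : ¬ R.pow + (κ + 1) ≤ R.cap := by
      simpa [BExp.eval, NExp.eval, hQ.head, hrow.pow, hrow.cap] using hb
    rw [Row.kids, if_neg hlt, List.append_nil]
    exact WP.skip hQ

theorem natW_child (κ : Fin 2) : ∀ a ∈ (child J κ).natW,
    a = 7 ∨ a = 11 ∨ a = 21 ∨ 12 ≤ a ∧ a ≤ 17 := by
  -- The parameters occur in constants only, so the list of arrays does not depend on them and
  -- becomes closed enough for `decide`.
  have h : (child J κ).natW = (child 0 0).natW := rfl
  rw [h]
  decide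

theorem realW_child (κ : Fin 2) : ∀ a ∈ (child J κ).realW, 5 ≤ a ∧ a ≤ 14 := by
  have h : (child J κ).realW = (child 0 0).realW := rfl
  rw [h]
  decide

theorem wp_nextStage (hQ : QueueAt h μ (R :: rows)) (hR : R.Valid) (hB : R.sup.length ≤ B) :
    WP B nextStage μ fun ν => QueueAt h ν (R :: rows ++ [R.next]) := by
  have hrow : RowAt μ h R := hQ.row 0 (by simp)
  set T := h + (R :: rows).length with hT
  have hhT : h ≠ T := by rw [hT, List.length_cons]; omega
  refine WP.seq ((wp_copyRow hR.nodup hR.fac_eq_one hB hQ.head hQ.tail hhT hrow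
    (hQ.fresh T le_rfl)).mono ?_)
  rintro ν₁ - ⟨hso₁, hsup₁⟩
  have hs8 : ∀ ν, SameOff T μ ν → ν.nat 8 0 0 = h := fun ν hν => by
    rw [hν.nat _ _ _ (by omega) (by omega) (by omega), hQ.head]
  refine wp_finish (R := R.next) hQ rfl hso₁ hsup₁
    (fun ν hν => ?_) (fun ν hν => ?_) (fun ν hν => rfl) (fun ν hν => ?_) ?_
  · simp only [NExp.eval, hs8 ν hν, (hν.rowAt hhT hrow).stage]; rfl
  · simp only [NExp.eval, hs8 ν hν, (hν.rowAt hhT hrow).cap]; rfl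
  · constructor <;> simp only [CExp.get, RExp.eval, NExp.eval, hs8 ν hν, hQ.head] <;>
      exact hν.real _ _ _ fun _ _ => hhT
  · rw [CExp.eval_get]
    simp only [NExp.eval, hQ.head]
    exact hrow.coef

theorem wp_siteBody (hI : InputAt (encode H O ψ t ε) μ)
    (hQ : QueueAt h μ (R :: rows)) (hR : R.Valid) (hB : R.sup.length ≤ B) (hkB : k ≤ B)
    (hdB : ∀ q, (H.termsAt q).length ≤ B) {i : ℕ} (hi : i < R.sup.length)
    (h9 : μ.nat 9 0 0 = i) :
    WP B (siteBody J) μ fun ν => QueueAt h ν (R :: rows ++ (H.termsAt R.sup[i]).flatMap fun X =>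
      R.kids H (t / J) 0 R.sup[i] X ++ R.kids H (t / J) 1 R.sup[i] X) := by
  have hrow : RowAt μ h R := hQ.row 0 (by simp)
  set q := R.sup[i] with hq
  refine WP.seq (WP.setNat ?_)
  simp only [NExp.eval, hQ.head, h9, hrow.site i hi]
  rw [← hq]
  set μ₁ := μ.setNat 19 0 0 q with hμ₁
  have hI₁ : InputAt (encode H O ψ t ε) μ₁ := hI.setNat (by omega)
  have hn : (Prog.for 10 (.get 4 (.var 19) zero) (termBody J)).natW
    = (Prog.for 10 (.get 4 (.var 19) zero) (termBody 0)).natW := rfl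
  have hr : (Prog.for 10 (.get 4 (.var 19) zero) (termBody J)).realW
    = (Prog.for 10 (.get 4 (.var 19) zero) (termBody 0)).realW := rfl
  have hA19 : ∀ {ν}, Agree (.for 10 (.get 4 (.var 19) zero) (termBody J)) μ₁ ν →
      ν.nat 19 0 0 = q := fun hA => by
    rw [hA.1 19 (by rw [hn]; decide), hμ₁, Mem.setNat_nat_self]
  have hAI : ∀ {ν}, Agree (.for 10 (.get 4 (.var 19) zero) (termBody J)) μ₁ ν →
      InputAt (encode H O ψ t ε) ν := fun hA =>
    hI₁.agree hA (by rw [hn]; decide) (by rw [hr]; decide)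
  set g : Fin H.numTerms → List (Row n) := fun X =>
    R.kids H (t / J) 0 q X ++ R.kids H (t / J) 1 q X with hg
  refine (WP.for (n := (H.termsAt q).length)
    (fun j ν => QueueAt h ν (R :: rows ++ ((H.termsAt q).take j).flatMap g)) (hdB q) ?_ ?_ ?_
    ?_).mono ?_
  · have : (termBody J).natW = (termBody 0).natW := rfl
    rw [this]
    decide
  · intro j ν hA _
    simp only [NExp.eval, hA19 hA, (hAI hA).nat 4 (by omega)]
    exact encode_degree H O ψ t ε q
  · simp only [List.take_zero, List.flatMap_nil, List.append_nil]
    exact (hQ.setNat (by omega) (by omega) (by omega)).setNat (by omega) (by omega) (by omega)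
  · intro j hj ν hA h10 hQν
    refine WP.seq (WP.setNat ?_)
    have e5 : ν.nat 5 q j = (H.termsAt q)[j] := by
      rw [(hAI hA).nat 5 (by omega)]
      exact encode_termsAt H O ψ t ε q hj
    simp only [NExp.eval, hA19 hA, h10, e5]
    set X := (H.termsAt q)[j] with hX
    have hXq : H.term X q ≠ 0 := H.mem_termsAt.1 (List.getElem_mem hj)
    set ν₁ := ν.setNat 20 0 0 X with hν₁
    have hI₂ : InputAt (encode H O ψ t ε) ν₁ := (hAI hA).setNat (by omega)
    have hQ₂ : QueueAt h ν₁ (R :: rows ++ ((H.termsAt q).take j).flatMap g) :=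
      hQν.setNat (by omega) (by omega) (by omega)
    have h19 : ν₁.nat 19 0 0 = q := by
      rw [hν₁, Mem.setNat_nat_of_ne _ _ _ _ (by omega), hA19 hA]
    refine WP.seq ((wp_child (J := J) 0 hI₂ hQ₂ hR hB hkB hXq h19 (by simp [hν₁])).mono ?_)
    intro ν₂ hA₂ hQ₃
    have hn₂ : ∀ a, a ≠ 7 → a ≠ 11 → a ≠ 21 → (a < 12 ∨ 17 < a) → ν₂.nat a = ν₁.nat a :=
      fun a h1 h2 h3 h4 => hA₂.1 a fun ha => by have := natW_child _ a ha; omega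
    have hI₃ : InputAt (encode H O ψ t ε) ν₂ := hI₂.agree hA₂
      (fun a ha => by have := natW_child _ a ha; omega)
      (fun a ha => by have := realW_child _ a ha; omega)
    refine (wp_child (J := J) (rows := rows ++ ((H.termsAt q).take j).flatMap g ++
      R.kids H (t / J) 0 q X) 1 hI₃ (by simpa using hQ₃) hR hB hkB hXq
      (by rw [hn₂ 19 (by omega) (by omega) (by omega) (by omega), h19])
      (by rw [hn₂ 20 (by omega) (by omega) (by omega) (by omega)]; simp [hν₁])).mono ?_
    intro ν₃ _ hQ₄
    refine QueueAt.setNat ?_ (by omega) (by omega) (by omega)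
    rw [take_succ_of_lt hj, List.flatMap_append]
    simpa [hg] using hQ₄
  · intro ν _ hQν
    rwa [List.take_length] at hQν

theorem wp_commutators (hI : InputAt (encode H O ψ t ε) μ)
    (hQ : QueueAt h μ (R :: rows)) (hR : R.Valid) (hB : R.sup.length ≤ B) (hkB : k ≤ B)
    (hdB : ∀ q, (H.termsAt q).length ≤ B) :
    WP B (Sim.commutators J) μ fun ν => QueueAt h ν (R :: rows ++ R.commutators H (t / J)) := by
  have hrow : RowAt μ h R := hQ.row 0 (by simp)
  refine WP.seq (WP.setNat ?_)
  simp only [NExp.eval, hQ.head, hrow.len]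
  set μ₁ := μ.setNat 22 0 0 R.sup.length with hμ₁
  have hI₁ : InputAt (encode H O ψ t ε) μ₁ := hI.setNat (by omega)
  have hn : (Prog.for 9 (.var 22) (siteBody J)).natW
    = (Prog.for 9 (.var 22) (siteBody 0)).natW := rfl
  have hr : (Prog.for 9 (.var 22) (siteBody J)).realW
    = (Prog.for 9 (.var 22) (siteBody 0)).realW := rfl
  set f : Fin n → List (Row n) := fun q => (H.termsAt q).flatMap fun X =>
    R.kids H (t / J) 0 q X ++ R.kids H (t / J) 1 q X with hf
  refine (WP.for (n := R.sup.length)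
    (fun i ν => QueueAt h ν (R :: rows ++ (R.sup.take i).flatMap f)) hB ?_ ?_ ?_ ?_).mono ?_
  · have : (siteBody J).natW = (siteBody 0).natW := rfl
    rw [this]
    decide
  · intro i ν hA _
    have : ν.nat 22 = μ₁.nat 22 := hA.1 22 (by rw [hn]; decide)
    simp only [NExp.eval, this]
    simp [hμ₁]
  · simp only [List.take_zero, List.flatMap_nil, List.append_nil]
    exact (hQ.setNat (by omega) (by omega) (by omega)).setNat (by omega) (by omega) (by omega)
  · intro i hi ν hA h9 hQν
    have hIν : InputAt (encode H O ψ t ε) ν :=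
      hI₁.agree hA (by rw [hn]; decide) (by rw [hr]; decide)
    refine (wp_siteBody hIν hQν hR hB hkB hdB hi h9).mono ?_
    intro ν₁ _ hQ₁
    refine QueueAt.setNat ?_ (by omega) (by omega) (by omega)
    rw [take_succ_of_lt hi, List.flatMap_append]
    simpa [hf] using hQ₁
  · intro ν _ hQν
    rwa [List.take_length] at hQν

theorem eval_amplitude (hI : InputAt (encode H O ψ t ε) μ) {q : Fin n}
    (h21 : μ.nat 21 0 0 = q) (a : Fin 2) : (amplitude a).eval μ = ψ.factor q a := by
  rw [← encode_amplitude H O ψ t ε q a]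
  apply Complex.ext <;>
    simp only [CExp.eval, amplitude, RExp.eval, NExp.eval, h21, hI.real 4 le_rfl]

theorem eval_qubitExp (hI : InputAt (encode H O ψ t ε) μ) {q : Fin n}
    (h21 : μ.nat 21 0 0 = q) (hh : μ.nat 8 0 0 = h) :
    qubitExp.eval μ = qubitExpect (ψ.factor q) (μ.mat h q) := by
  have hm : ∀ a b, (MExp.get head (.var 21) a b).eval μ = μ.mat h q a b := fun a b => by
    have := congrFun (congrFun (MExp.eval_get μ head (.var 21)) a) b
    simp only [NExp.eval, h21, hh] at this
    exact this
  simp only [qubitExp, CExp.eval_add, CExp.eval_mul, CExp.eval_conj, hm,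
    eval_amplitude hI h21, qubitExpect, Fin.sum_univ_two]

theorem wp_leaf (hI : InputAt (encode H O ψ t ε) μ) (hQ : QueueAt h μ (R :: rows))
    (hB : R.sup.length ≤ B) :
    WP B leaf μ fun ν => QueueAt h ν (R :: rows) ∧ ν.real 15 0 0 = μ.real 15 0 0 +
      (R.coef * (R.sup.map fun q => qubitExpect (ψ.factor q) (R.fac q)).prod).re := by
  have hrow : RowAt μ h R := hQ.row 0 (by simp)
  set f : Fin n → ℂ := fun q => qubitExpect (ψ.factor q) (R.fac q) with hf
  refine WP.seq (WP.setC (fun v => rfl) (by simp) (by simp) ?_)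
  rintro μ₁ hn₁ hz₁ - hr₁
  have hQ₁ : QueueAt h μ₁ (R :: rows) := hQ.congr (fun a _ => by rw [hn₁])
    fun a _ _ => hr₁ a (by omega) (by omega)
  have hI₁ : InputAt (encode H O ψ t ε) μ₁ :=
    ⟨fun a ha => by rw [hn₁, hI.nat a ha],
      fun a ha => by rw [hr₁ a (by omega) (by omega), hI.real a ha]⟩
  have h15 : μ₁.real 15 = μ.real 15 := hr₁ 15 (by omega) (by omega)
  have hAQ : ∀ {ν}, Agree (.for 9 (.get 15 head zero) leafBody) μ₁ ν → QueueAt h ν (R :: rows) :=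
    fun hA => hQ₁.congr (fun a ha => hA.1 a fun h => by
      have : ∀ a ∈ (Prog.for 9 (.get 15 head zero) leafBody).natW, a = 9 ∨ a = 21 := by decide
      have := this a h
      omega) fun a h5 h14 => hA.2 a fun h => by
      have : ∀ a ∈ (Prog.for 9 (.get 15 head zero) leafBody).realW, 17 ≤ a := by decide
      have := this a h
      omega
  have hAI : ∀ {ν}, Agree (.for 9 (.get 15 head zero) leafBody) μ₁ ν →
      InputAt (encode H O ψ t ε) ν := fun hA => hI₁.agree hA (by decide) (by decide)
  refine WP.seq ((WP.for (n := R.sup.length)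
    (fun i ν => ν.cplx 17 0 0 = ((R.sup.take i).map f).prod) hB (by decide) ?_ ?_ ?_).mono ?_)
  · intro i ν hA _
    simp only [NExp.eval, (hAQ hA).head]
    exact ((hAQ hA).row 0 (by simp)).len
  · simp only [List.take_zero, List.map_nil, List.prod_nil]
    refine hz₁.trans ?_
    apply Complex.ext <;> simp [CExp.eval, CExp.const, RExp.eval]
  · intro i hi ν hA h9 hprod
    have hrν : RowAt ν h R := (hAQ hA).row 0 (by simp)
    refine WP.seq (WP.setNat ?_)
    simp only [NExp.eval, (hAQ hA).head, h9, hrν.site i hi]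
    set ν₁ := ν.setNat 21 0 0 (R.sup[i] : Fin n) with hν₁
    have hI₂ : InputAt (encode H O ψ t ε) ν₁ := (hAI hA).setNat (by omega)
    have hQ₂ : QueueAt h ν₁ (R :: rows) := (hAQ hA).setNat (by omega) (by omega) (by omega)
    have h21 : ν₁.nat 21 0 0 = (R.sup[i] : Fin n) := by simp [hν₁]
    have hr₂' : RowAt ν₁ h R := hQ₂.row 0 (by simp)
    -- The updated product passes through the scalar `19`: written directly to `17`, its new real
    -- part would spoil the evaluation of the imaginary part.
    refine WP.seq (WP.setC (fun v => ?_) (by simp) (by simp) ?_)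
    · have e : ∀ a, a ≠ 19 → (ν₁.setReal 19 (NExp.eval ν₁ zero) (NExp.eval ν₁ zero) v).real a
          = ν₁.real a := fun a ha => Mem.setReal_real_of_ne _ _ _ _ ha
      simp [qubitExp, CExp.mul, CExp.get, CExp.add, CExp.conj, MExp.get, MExp.add, MExp.one,
        CExp.const, amplitude, RExp.eval, e]
    · rintro ν₂ hn₂ hz₂ - hr₂
      refine WP.setC (fun v => ?_) (by simp) (by simp) ?_
      · simp only [CExp.get, RExp.eval, Mem.setReal_congr_nexp]
        rw [Mem.setReal_real_of_ne _ _ _ _ (by omega)]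
      · rintro ν₃ hn₃ hz₃ - hr₃
        refine Eq.trans (b := ν₃.cplx 17 0 0) rfl ?_
        refine hz₃.trans ?_
        rw [CExp.eval_get]
        refine hz₂.trans ?_
        rw [CExp.eval_mul, eval_qubitExp hI₂ h21 hQ₂.head, CExp.eval_get,
          hr₂'.mat, take_succ_of_lt hi, List.map_append, List.prod_append]
        simp only [List.map_cons, List.map_nil, List.prod_singleton]
        exact congrArg (· * _) hprod
  · intro ν hA hprod
    rw [List.take_length] at hprod
    refine WP.setReal ⟨(hAQ hA).congr (fun a _ => rfl) fun a _ _ =>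
      Mem.setReal_real_of_ne _ _ _ _ (by omega), ?_⟩
    have h15ν : ν.real 15 = μ.real 15 := (hA.2 15 (by decide)).trans h15
    have hm : (CExp.mul (.get 5 head zero) (.get 17 zero zero)).re.eval ν
        = ((CExp.mul (.get 5 head zero) (.get 17 zero zero)).eval ν).re := rfl
    have hc : (CExp.get 5 head zero).eval ν = R.coef := by
      rw [CExp.eval_get]
      simp only [NExp.eval, (hAQ hA).head]
      exact ((hAQ hA).row 0 (by simp)).coef
    have hp : (CExp.get 17 zero zero).eval ν = (R.sup.map f).prod := by
      rw [CExp.eval_get]; exact hprod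
    simp only [NExp.eval, RExp.eval, Mem.setReal_real_self]
    rw [hm, CExp.eval_mul, hc, hp, h15ν]

/-- The contribution of a row to the result. -/
noncomputable def Row.leafValue (R : Row n) (ψ : ProductState n) : ℝ :=
  if R.stage = 0 then
    (R.coef * (R.sup.map fun q => qubitExpect (ψ.factor q) (R.fac q)).prod).re else 0

theorem wp_process (hI : InputAt (encode H O ψ t ε) μ)
    (hQ : QueueAt h μ (R :: rows)) (hR : R.Valid) (hB : R.sup.length ≤ B) (hkB : k ≤ B)
    (hdB : ∀ q, (H.termsAt q).length ≤ B) :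
    WP B (process J) μ fun ν => InputAt (encode H O ψ t ε) ν ∧
      QueueAt (h + 1) ν (rows ++ R.children H (t / J)) ∧
      ν.real 15 0 0 = μ.real 15 0 0 + R.leafValue ψ := by
  have hrow : RowAt μ h R := hQ.row 0 (by simp)
  -- That the input survives depends only on the arrays written, so it is split off and read from
  -- the frame at the end.
  refine WP.mono (R := fun ν => InputAt (encode H O ψ t ε) ν ∧
      QueueAt (h + 1) ν (rows ++ R.children H (t / J)) ∧
      ν.real 15 0 0 = μ.real 15 0 0 + R.leafValue ψ)
    (Q := fun ν => QueueAt (h + 1) ν (rows ++ R.children H (t / J)) ∧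
      ν.real 15 0 0 = μ.real 15 0 0 + R.leafValue ψ) ?_ ?_
  · refine WP.seq (WP.ite (fun hb => ?_) fun hb => ?_)
    · have h0 : R.stage = 0 := by
        simpa [BExp.eval, NExp.eval, hQ.head, hrow.stage] using hb
      refine (wp_leaf hI hQ hB).mono ?_
      rintro ν - ⟨hQν, hν⟩
      refine WP.setNat ?_
      simp only [NExp.eval, hQν.head, Row.children, Row.leafValue, if_pos h0, List.append_nil]
      exact ⟨hQν.pop, hν⟩
    · have h0 : R.stage ≠ 0 := by
        simpa [BExp.eval, NExp.eval, hQ.head, hrow.stage] using hb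
      refine WP.seq ((wp_nextStage hQ hR hB).mono ?_)
      intro ν₁ hA₁ hQ₁
      have hI₁ := hI.agree hA₁ (by decide) (by decide)
      refine (wp_commutators (J := J) (rows := rows ++ [R.next]) hI₁ (by simpa using hQ₁) hR hB
        hkB hdB).mono ?_
      intro ν₂ hA₂ hQ₂
      have e1 : ν₁.real 15 = μ.real 15 := hA₁.2 15 (by decide)
      have e2 : ν₂.real 15 = ν₁.real 15 := hA₂.2 15 (by
        have : (Sim.commutators J).realW = (Sim.commutators 0).realW := rfl
        rw [this]; decide)
      refine WP.setNat ?_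
      simp only [NExp.eval, hQ₂.head, Row.children, Row.leafValue, if_neg h0, add_zero]
      refine ⟨?_, by rw [Mem.setNat_real, e2, e1]⟩
      have := QueueAt.pop (rows := rows ++ [R.next] ++ R.commutators H (t / J))
        (by simpa using hQ₂)
      simpa using this
  · intro ν hA hν
    have hn : (process J).natW = (process 0).natW := rfl
    have hr : (process J).realW = (process 0).realW := rfl
    exact ⟨hI.agree hA (by rw [hn]; decide) (by rw [hr]; decide), hν⟩

end Processing

end AdiabaticSim

namespace AdiabaticSim

open Function

theorem List.sum_map_flatMap {α β E : Type*} [AddMonoid E] (L : List α) (f : α → List β)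
    (g : β → E) : ((L.flatMap f).map g).sum = (L.map fun a => ((f a).map g).sum).sum := by
  induction L with
  | nil => simp
  | cons a L ih => simp [ih]

theorem List.sum_map_le_nsmul {α : Type*} (L : List α) (f : α → ℕ) {b : ℕ}
    (h : ∀ a ∈ L, f a ≤ b) : (L.map f).sum ≤ L.length * b := by
  induction L with
  | nil => simp
  | cons a L ih =>
    have h1 := ih fun x hx => h x (List.mem_cons_of_mem _ hx)
    have h2 := h a List.mem_cons_self
    simp only [List.map_cons, List.sum_cons, List.length_cons, add_mul]
    omega

theorem List.length_flatMap_le_mul {α β : Type*} (L : List α) (f : α → List β) {b : ℕ}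
    (h : ∀ a ∈ L, (f a).length ≤ b) : (L.flatMap f).length ≤ L.length * b := by
  rw [List.length_flatMap]
  exact List.sum_map_le_nsmul L _ h

/-! ### Rows as operators and the conservation of their values -/

namespace Row

variable {n k : ℕ} (H : AdiabaticHamiltonian n k) (u : ℝ) {R : Row n}

/-- The operator of a row. -/
noncomputable def op (R : Row n) : QOp n := R.coef • tens R.fac

/-- The operator that results from a row at the end of the simulated evolution. -/
noncomputable def result (R : Row n) : QOp n := H.heis u R.stage R.cap R.pow R.op

theorem Valid.kid (hR : R.Valid) (κ : Fin 2) {q : Fin n} (hq : q ∈ R.sup) (X : Fin H.numTerms) :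
    (R.kid H u κ q X).Valid where
  nodup := nodup_appendNew hR.nodup _
  fac_eq_one i hi := by
    have hi' : i ∉ R.sup ∧ i ∉ siteList (H.term X) := by
      simpa [Row.kid, mem_appendNew] using hi
    have h0 : H.term X i = 0 := by
      by_contra h
      exact hi'.2 (mem_siteList.2 h)
    have hne : i ≠ q := by
      rintro rfl
      exact hi'.1 hq
    simp only [Row.kid, commFactor, h0, hR.fac_eq_one i hi'.1, pauli_zero, one_mul]
    rcases lt_or_gt_of_ne hne with h | h
    · rw [if_pos h]
    · rw [if_neg h.not_gt, if_pos h]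

theorem Valid.next (hR : R.Valid) : R.next.Valid := ⟨hR.nodup, hR.fac_eq_one⟩

/-- In the expansion over all qubits and terms, a summand vanishes unless the qubit carries both a
nontrivial factor of the row and a nontrivial letter of the term. Hence the local lists of the input
suffice, and `n` does not enter the running time. -/
theorem smul_comm_op (hR : R.Valid) (c : ℝ) (γ : Fin H.numTerms → ℝ) :
    (c : ℂ) • H.comm γ R.op = (R.sup.map fun q => ((H.termsAt q).map fun X =>
      (R.coef * (Complex.I * ((c * γ X : ℝ) : ℂ))) •
        tens (commFactor (fun i => pauli (H.term X i)) R.fac q)).sum).sum := by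
  classical
  set G : Fin n → Fin H.numTerms → QOp n := fun q X =>
    (R.coef * (Complex.I * ((c * γ X : ℝ) : ℂ))) •
        tens (commFactor (fun i => pauli (H.term X i)) R.fac q) with hG
  have hz : ∀ q X, q ∉ R.sup ∨ H.term X q = 0 → G q X = 0 := by
    intro q X h
    have : commFactor (fun i => pauli (H.term X i)) R.fac q q = 0 := by
      rw [commFactor_self]
      rcases h with h | h
      · simp [hR.fac_eq_one q h]
      · simp [h]
    rw [hG]
    simp only [tens_eq_zero q this, QOp.smul_zero]
  have h1 : (c : ℂ) • H.comm γ R.op = ∑ q, ∑ X, G q X := by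
    rw [H.comm_apply_eq_sum, Finset.smul_sum, Finset.sum_comm]
    refine Finset.sum_congr rfl fun X _ => ?_
    rw [hG]
    simp only
    rw [← Finset.smul_sum, ← tens_commutator, op, pauliOp_eq_tens, mul_smul_comm, smul_mul_assoc]
    push_cast
    module
  rw [h1, ← List.sum_toFinset _ hR.nodup]
  refine (Finset.sum_subset (Finset.subset_univ R.sup.toFinset) fun q _ hq => ?_).symm.trans ?_
  · exact Finset.sum_eq_zero fun X _ => hz q X (Or.inl (by simpa using hq))
  · refine Finset.sum_congr rfl fun q _ => ?_
    rw [← List.sum_toFinset _ (H.nodup_termsAt q)]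
    refine (Finset.sum_subset (Finset.subset_univ _) fun X _ hX => ?_).symm
    refine hz q X (Or.inr ?_)
    by_contra h
    exact hX (List.mem_toFinset.2 (H.mem_termsAt.2 h))

theorem map_list_sum {E F α : Type*} [AddCommMonoid E] [AddCommMonoid F] (g : E →+ F) (L : List α)
    (f : α → E) : g (L.map f).sum = (L.map fun a => g (f a)).sum := by
  rw [_root_.map_list_sum, List.map_map]
  rfl

/-- The rows with one power increment have the sum that the recursion asks for. -/
theorem sum_kids (hR : R.Valid) (κ : Fin 2) {s : ℕ} (hs : R.stage = s) {c : ℝ}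
    {γ : Fin H.numTerms → ℝ} (hf : ∀ X, R.factor H u X κ = c * γ X) :
    ((R.sup.flatMap fun q => (H.termsAt q).flatMap fun X => R.kids H u κ q X).map
      (Row.result H u)).sum = if R.pow + (κ + 1) ≤ R.cap then
        H.heis u s R.cap (R.pow + (κ + 1)) ((c : ℂ) • H.comm γ R.op) else 0 := by
  split_ifs with h
  · rw [smul_comm_op H hR]
    have key : ∀ {α : Type} (L : List α) (f : α → QOp n),
        H.heis u s R.cap (R.pow + (κ + 1)) (L.map f).sum
          = (L.map fun a => H.heis u s R.cap (R.pow + (κ + 1)) (f a)).sum :=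
      map_list_sum (H.heis u s R.cap (R.pow + (κ + 1))).toAddMonoidHom
    simp only [key, List.sum_map_flatMap]
    congr 1
    refine List.map_congr_left fun q _ => ?_
    congr 1
    refine List.map_congr_left fun X _ => ?_
    simp only [kids, if_pos h, List.map_cons, List.map_nil, List.sum_singleton, result, kid, op,
      hs, hf]
  · have : ∀ q X, R.kids H u κ q X = [] := fun q X => if_neg h
    have h0 : (R.sup.flatMap fun q => (H.termsAt q).flatMap fun X => R.kids H u κ q X) = [] := by
      simp [List.flatMap_eq_nil_iff, this]
    rw [h0, List.map_nil, List.sum_nil]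

theorem sum_commutators :
    ((R.commutators H u).map (Row.result H u)).sum
      = ((R.sup.flatMap fun q => (H.termsAt q).flatMap fun X => R.kids H u 0 q X).map
          (Row.result H u)).sum
        + ((R.sup.flatMap fun q => (H.termsAt q).flatMap fun X => R.kids H u 1 q X).map
          (Row.result H u)).sum := by
  simp only [commutators, List.sum_map_flatMap, List.map_append, List.sum_append]
  simp only [← List.sum_map_add]

/-- This is the recursion `heis_succ` on rows: the first child is the next stage, and the two
families of commutators are the power increments one and two. -/
theorem sum_children (hR : R.Valid) (h0 : R.stage ≠ 0) :
    ((R.children H u).map (Row.result H u)).sum = R.result H u := by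
  obtain ⟨s, hs⟩ := Nat.exists_eq_succ_of_ne_zero h0
  rw [children, if_neg h0, List.map_cons, List.sum_cons, sum_commutators,
    sum_kids H u hR 0 hs (c := u / (R.pow + 1)) (γ := H.coeffAt ((s + 1) * u))
      (fun X => by rw [factor, if_pos rfl, hs]; push_cast; rfl),
    sum_kids H u hR 1 hs (c := u ^ 2 / (R.pow + 2)) (γ := H.coeffSlope)
      (fun X => by rw [factor, if_neg (by decide)])]
  have : R.result H u = H.heis u (s + 1) R.cap R.pow R.op := by rw [result, hs]
  rw [this, H.heis_succ u s R.cap R.pow R.op, add_assoc]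
  congr 1
  simp only [result, next, op, hs, Nat.succ_sub_one, two_mul]

/-- The expectation value of the result of a row. -/
noncomputable def value (ψ : ProductState n) (R : Row n) : ℝ :=
  (inner ℂ ψ.vec (R.result H u ψ.vec)).re

variable (ψ : ProductState n)

theorem value_sum (L : List (Row n)) :
    (L.map (Row.value H u ψ)).sum = (inner ℂ ψ.vec ((L.map (Row.result H u)).sum ψ.vec)).re := by
  induction L with
  | nil => simp
  | cons R L ih =>
    simp only [List.map_cons, List.sum_cons, ih, add_apply, inner_add_right,
      Complex.add_re, value]

/-- The conservation law behind the main loop. For a finished row the expectation value is a product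
over qubits, and qubits outside the list contribute `1` because the state is normalised. -/
theorem value_eq (hR : R.Valid) :
    R.value H u ψ = R.leafValue ψ + ((R.children H u).map (Row.value H u ψ)).sum := by
  by_cases h0 : R.stage = 0
  · rw [value, result, h0, AdiabaticHamiltonian.heis_zero, leafValue, if_pos h0, children,
      if_pos h0]
    simp only [List.map_nil, List.sum_nil, add_zero, op, smul_apply,
      inner_smul_right, inner_tens]
    rw [← List.prod_toFinset _ hR.nodup]
    congr 2
    refine (Finset.prod_subset (Finset.subset_univ _) fun q _ hq => ?_).symm
    rw [hR.fac_eq_one q (by simpa using hq), qubitExpect_one (ψ.norm_factor q)]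
  · rw [value_sum, sum_children H u hR h0, leafValue, if_neg h0, zero_add, value]

/-! ## The number of rows -/

/-- The remaining nesting depth. -/
def rankAux : ℕ → ℕ → ℕ → ℕ
  | 0, _, _ => 0
  | s + 1, c, p => (c - p) + 1 + rankAux s (c + c) 0

/-- The depth is `c + 2 * c + 4 * c + ⋯` over `s` stages, plus `s`. The added `c` on the left makes
the induction close. -/
theorem rankAux_le (s : ℕ) : ∀ c, rankAux s c 0 + c ≤ 2 ^ s * (c + 1) := by
  induction s with
  | zero => intro c; simp [rankAux]
  | succ s ih =>
    intro c
    have h := ih (c + c)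
    have h1 : 1 ≤ 2 ^ s := Nat.one_le_two_pow
    simp only [rankAux, Nat.sub_zero, pow_succ]
    nlinarith

/-- The remaining nesting depth of a row. -/
def rank (R : Row n) : ℕ := rankAux R.stage R.cap R.pow

/-- A valid row whose descendants have at most `W` qubits. -/
structure Bounded (k W : ℕ) (R : Row n) : Prop extends R.Valid where
  le : R.sup.length + k * R.rank ≤ W

theorem rank_lt_of_mem_children {S : Row n} (hS : S ∈ R.children H u) : S.rank < R.rank := by
  unfold children at hS
  split_ifs at hS with h0
  · simp at hS
  obtain ⟨s, hs⟩ := Nat.exists_eq_succ_of_ne_zero h0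
  rw [List.mem_cons] at hS
  rcases hS with rfl | hS
  · simp only [rank, next, hs, Nat.succ_sub_one, rankAux]
    omega
  · simp only [commutators, List.mem_flatMap, List.mem_append, kids] at hS
    obtain ⟨q, -, X, -, hS⟩ := hS
    have : ∀ κ : Fin 2, S ∈ (if R.pow + (κ + 1) ≤ R.cap then [R.kid H u κ q X] else []) →
        S.rank < R.rank := by
      intro κ h
      split_ifs at h with hc
      · rw [List.mem_singleton] at h
        subst h
        simp only [rank, kid, hs, rankAux]
        omega
      · simp at h
    exact hS.elim (this 0) (this 1)

/-- A commutator adds at most `k` qubits and lowers the rank by at least one; passing to the next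
stage adds none. So `R.sup.length + k * R.rank` does not increase. -/
theorem bounded_of_mem_children {W : ℕ} (hR : R.Bounded k W) {S : Row n}
    (hS : S ∈ R.children H u) : S.Bounded k W := by
  have hlt := rank_lt_of_mem_children H u hS
  have hle := hR.le
  have hk : k * S.rank + k ≤ k * R.rank := by
    calc k * S.rank + k = k * (S.rank + 1) := by ring
      _ ≤ _ := Nat.mul_le_mul_left _ hlt
  unfold children at hS
  split_ifs at hS with h0
  · simp at hS
  rw [List.mem_cons] at hS
  rcases hS with rfl | hS
  · refine ⟨hR.toValid.next, ?_⟩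
    have : R.next.sup = R.sup := rfl
    rw [this]
    omega
  · simp only [commutators, List.mem_flatMap, List.mem_append, kids] at hS
    obtain ⟨q, hq, X, -, hS⟩ := hS
    have : ∀ κ : Fin 2, S ∈ (if R.pow + (κ + 1) ≤ R.cap then [R.kid H u κ q X] else []) →
        S.Bounded k W := by
      intro κ h
      split_ifs at h with hc
      · rw [List.mem_singleton] at h
        subst h
        refine ⟨hR.toValid.kid H u κ hq X, ?_⟩
        have h1 := length_appendNew_le R.sup (siteList (H.term X))
        have h2 := H.term_local X
        have : (R.kid H u κ q X).sup = appendNew R.sup (siteList (H.term X)) := rfl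
        rw [this]
        omega
      · simp at h
    exact hS.elim (this 0) (this 1)

theorem length_children_le {W D : ℕ} (hR : R.Bounded k W) (hD : H.maxDegree + 1 ≤ D) :
    (R.children H u).length ≤ 1 + W * (D * 2) := by
  unfold children
  split_ifs
  · simp
  · rw [List.length_cons, add_comm]
    refine Nat.add_le_add_left ?_ 1
    refine (List.length_flatMap_le_mul _ _ (b := D * 2) fun q _ => ?_).trans ?_
    · refine (List.length_flatMap_le_mul _ _ (b := 2) fun X _ => ?_).trans ?_
      · have : ∀ κ, (R.kids H u κ q X).length ≤ 1 := fun κ => by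
          unfold kids; split_ifs <;> simp
        rw [List.length_append]
        have h0 := this 0
        have h1 := this 1
        omega
      · exact Nat.mul_le_mul_right _ ((H.length_termsAt_le q).trans hD)
    · have := hR.le
      exact Nat.mul_le_mul_right _ (by omega)

/-- A row has at most `Q - 1` children, all of smaller rank. Thus `Q ^ rank` bounds the size of the
tree below a row, and processing the row lowers the total potential by at least one. -/
theorem sum_pow_rank_children {W D Q : ℕ} (hR : R.Bounded k W) (hD : H.maxDegree + 1 ≤ D)
    (hQ : 2 + W * (D * 2) ≤ Q) :
    1 + ((R.children H u).map fun S => Q ^ S.rank).sum ≤ Q ^ R.rank := by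
  have hQ1 : 1 ≤ Q := by omega
  rcases Nat.eq_zero_or_pos R.rank with h | h
  · have : R.children H u = [] := by
      rw [List.eq_nil_iff_forall_not_mem]
      intro S hS
      have := rank_lt_of_mem_children H u hS
      omega
    simp [this, h]
  · obtain ⟨r, hr⟩ := Nat.exists_eq_succ_of_ne_zero h.ne'
    have h1 : ((R.children H u).map fun S => Q ^ S.rank).sum ≤ (R.children H u).length * Q ^ r :=
      List.sum_map_le_nsmul _ _ fun S hS => Nat.pow_le_pow_right hQ1 (by
        have := rank_lt_of_mem_children H u hS
        omega)
    have h2 := length_children_le H u hR hD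
    have h3 : 1 ≤ Q ^ r := Nat.one_le_pow _ _ hQ1
    rw [hr, pow_succ]
    calc _ ≤ Q ^ r + (1 + W * (D * 2)) * Q ^ r :=
          add_le_add h3 (h1.trans (Nat.mul_le_mul_right _ h2))
      _ = Q ^ r * (2 + W * (D * 2)) := by ring
      _ ≤ _ := Nat.mul_le_mul_left _ hQ

end Row

/-! ### The main loop -/

section MainLoop

open Sim

variable {n k : ℕ} {H : AdiabaticHamiltonian n k} {O : LocalObservable n k} {ψ : ProductState n}
  {t ε : ℝ} {B J : ℕ} {μ : Mem} {rows : List (Row n)}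

theorem wp_mainLoop {W D Q : ℕ} (hI : InputAt (encode H O ψ t ε) μ) (hQ : QueueAt 0 μ rows)
    (hrows : ∀ R ∈ rows, R.Bounded k W) (hD : H.maxDegree + 1 ≤ D) (hW : 2 + W * (D * 2) ≤ Q)
    (hWB : W ≤ B) (hkB : k ≤ B) (hDB : D ≤ B) (hB : (rows.map fun R => Q ^ R.rank).sum ≤ B) :
    WP B (.loop (.not (.natLe tail head)) (process J)) μ fun ν =>
      ν.real 15 0 0 = μ.real 15 0 0 + (rows.map (Row.value H (t / J) ψ)).sum := by
  -- The queue head equals the number of iterations. That number plus the potential of the queue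
  -- stays at most `B`, and the accumulated sum plus the values of the queue stays constant.
  refine (WP.loop (I := fun i ν => ∃ L : List (Row n), InputAt (encode H O ψ t ε) ν ∧
    QueueAt i ν L ∧ (∀ R ∈ L, R.Bounded k W) ∧ i + (L.map fun R => Q ^ R.rank).sum ≤ B ∧
    ν.real 15 0 0 + (L.map (Row.value H (t / J) ψ)).sum
      = μ.real 15 0 0 + (rows.map (Row.value H (t / J) ψ)).sum) ?_ ?_).mono ?_
  · exact ⟨rows, hI, hQ, hrows, by omega, rfl⟩
  · rintro i ν ⟨L, hIν, hQν, hL, hLB, hval⟩ hb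
    have hb' : i < i + L.length := by
      have := List.length_pos_of_ne_nil (l := L) (by
        simpa [BExp.eval, NExp.eval, hQν.head, hQν.tail] using hb)
      omega
    match L, hQν, hL, hLB, hval with
    | [], _, _, _, _ => simp at hb'
    | R :: L, hQν, hL, hLB, hval =>
      have hR := hL R List.mem_cons_self
      have hsum := Row.sum_pow_rank_children H (t / J) hR hD hW
      simp only [List.map_cons, List.sum_cons] at hLB hval
      refine ⟨by omega, (wp_process hIν hQν hR.toValid ?_ hkB
        fun q => ((H.length_termsAt_le q).trans hD).trans hDB).mono ?_⟩
      · have := hR.le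
        omega
      · rintro ξ - ⟨hIξ, hQξ, hξ⟩
        refine ⟨_, hIξ, hQξ, fun S hS => ?_, ?_, ?_⟩
        · rw [List.mem_append] at hS
          exact hS.elim (fun h => hL S (List.mem_cons_of_mem _ h))
            (Row.bounded_of_mem_children H (t / J) hR)
        · rw [List.map_append, List.sum_append]
          omega
        · rw [List.map_append, List.sum_append, hξ, ← hval, Row.value_eq H (t / J) ψ hR.toValid]
          ring
  · rintro ν - ⟨i, ⟨L, -, hQν, -, -, hval⟩, hb⟩
    have hL : L = [] := by
      simpa [BExp.eval, NExp.eval, hQν.head, hQν.tail] using hb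
    subst hL
    simpa using hval

end MainLoop

end AdiabaticSim

namespace AdiabaticSim

open Function
open scoped Matrix

/-! ## The observable -/

namespace LocalObservable

variable {n k : ℕ} (O : LocalObservable n k)

/-- The factors of the product operator that a matrix unit on the sites gives rise to. -/
noncomputable def unitFac (a b : Fin O.numSites → Fin 2) : Fin n → Matrix (Fin 2) (Fin 2) ℂ :=
  extend O.site (fun l => Matrix.single (a l) (b l) 1) fun _ => 1

theorem unitFac_site (a b : Fin O.numSites → Fin 2) (l : Fin O.numSites) :
    O.unitFac a b (O.site l) = Matrix.single (a l) (b l) 1 := by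
  rw [unitFac, O.site.injective.extend_apply]

theorem unitFac_of_notMem (a b : Fin O.numSites → Fin 2) {q : Fin n}
    (hq : q ∉ Set.range O.site) : O.unitFac a b q = 1 := by
  rw [unitFac, extend_apply' _ _ _ (by simpa using hq)]

theorem prod_unitFac (a b : Fin O.numSites → Fin 2) (x y : Fin n → Fin 2) [Decidable
    ((∀ q, q ∉ Set.range O.site → x q = y q) ∧ a = (fun l => x (O.site l)) ∧
      b = fun l => y (O.site l))] :
    ∏ q, O.unitFac a b q (x q) (y q)
      = if (∀ q, q ∉ Set.range O.site → x q = y q) ∧ a = (fun l => x (O.site l)) ∧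
          b = (fun l => y (O.site l)) then 1 else 0 := by
  split_ifs with h
  · obtain ⟨h, rfl, rfl⟩ := h
    refine Finset.prod_eq_one fun q _ => ?_
    by_cases hq : q ∈ Set.range O.site
    · obtain ⟨l, rfl⟩ := hq
      rw [unitFac_site, Matrix.single_apply_same]
    · rw [unitFac_of_notMem _ _ _ hq, h q hq, Matrix.one_apply_eq]
  · rw [Finset.prod_eq_zero_iff]
    by_contra hc
    push Not at hc
    have hs : ∀ l, a l = x (O.site l) ∧ b l = y (O.site l) := by
      intro l
      have := hc (O.site l) (Finset.mem_univ _)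
      rw [unitFac_site, Matrix.single_apply] at this
      by_contra h'
      exact this (if_neg h')
    refine h ⟨fun q hq => ?_, funext fun l => (hs l).1, funext fun l => (hs l).2⟩
    have := hc q (Finset.mem_univ _)
    rw [unitFac_of_notMem _ _ _ hq, Matrix.one_apply] at this
    by_contra h'
    exact this (if_neg h')

/-- Matrix units on several qubits are tensor products of matrix units, so the observable is a sum
of at most `4 ^ k` product operators and can be put in the queue. -/
theorem op_eq_sum : O.op = ∑ a, ∑ b, O.mat a b • tens (O.unitFac a b) := by
  classical
  simp only [op, tens, ← map_smul, ← map_sum]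
  congr 1
  ext x y
  simp only [Matrix.of_apply, Matrix.sum_apply, Matrix.smul_apply, prod_unitFac, smul_eq_mul,
    mul_ite, mul_one, mul_zero]
  split_ifs with h
  · rw [Finset.sum_eq_single fun l => x (O.site l), Finset.sum_eq_single fun l => y (O.site l),
      if_pos ⟨h, rfl, rfl⟩]
    · exact fun b _ hb => if_neg fun h' => hb h'.2.2
    · simp
    · exact fun a _ ha => Finset.sum_eq_zero fun b _ => if_neg fun h' => ha h'.2.1
    · simp
  · exact (Finset.sum_eq_zero fun a _ => Finset.sum_eq_zero fun b _ =>
      if_neg fun h' => h h'.1).symm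

theorem norm_tens_unitFac_le (a b : Fin O.numSites → Fin 2) : ‖tens (O.unitFac a b)‖ ≤ 1 := by
  refine norm_tens_le_one _ fun q => ?_
  by_cases hq : q ∈ Set.range O.site
  · obtain ⟨l, rfl⟩ := hq
    rw [unitFac_site]
    simp [IsIdempotentElem, Matrix.conjTranspose_single]
  · rw [unitFac_of_notMem _ _ _ hq]
    simp [IsIdempotentElem]

/-- The square of the Frobenius norm of the matrix of the observable. -/
noncomputable def frobSq : ℝ := ∑ a, ∑ b, ‖O.mat a b‖ ^ 2

theorem frobSq_nonneg : 0 ≤ O.frobSq :=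
  Finset.sum_nonneg fun _ _ => Finset.sum_nonneg fun _ _ => sq_nonneg _

theorem card_pairs : (Finset.univ : Finset ((Fin O.numSites → Fin 2) × (Fin O.numSites → Fin 2))).card
    ≤ 4 ^ k := by
  simp only [Finset.card_univ, Fintype.card_prod, Fintype.card_fun, Fintype.card_fin]
  rw [← mul_pow]
  exact Nat.pow_le_pow_right (by norm_num) O.numSites_le

/-- With `frobSq_le` this makes `frobSq` a substitute for the operator norm that field operations
can compute. Here: the triangle inequality over matrix units of norm at most one, then
Cauchy–Schwarz over at most `4 ^ k` entries. -/
theorem norm_op_sq_le : ‖O.op‖ ^ 2 ≤ 4 ^ k * O.frobSq := by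
  have h1 : ‖O.op‖ ≤ ∑ p : (Fin O.numSites → Fin 2) × (Fin O.numSites → Fin 2),
      ‖O.mat p.1 p.2‖ := by
    rw [op_eq_sum, ← Fintype.sum_prod_type' (f := fun a b => O.mat a b • tens (O.unitFac a b))]
    refine (norm_sum_le _ _).trans (Finset.sum_le_sum fun p _ => ?_)
    rw [norm_smul]
    exact mul_le_of_le_one_right (norm_nonneg _) (O.norm_tens_unitFac_le _ _)
  calc ‖O.op‖ ^ 2 ≤ (∑ p : (Fin O.numSites → Fin 2) × (Fin O.numSites → Fin 2),
      ‖O.mat p.1 p.2‖) ^ 2 := by gcongr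
    _ ≤ _ * ∑ p : (Fin O.numSites → Fin 2) × (Fin O.numSites → Fin 2), ‖O.mat p.1 p.2‖ ^ 2 :=
      sq_sum_le_card_mul_sum_sq
    _ ≤ 4 ^ k * ∑ p : (Fin O.numSites → Fin 2) × (Fin O.numSites → Fin 2),
        ‖O.mat p.1 p.2‖ ^ 2 := by
      gcongr
      exact_mod_cast O.card_pairs
    _ = _ := by rw [frobSq, Fintype.sum_prod_type]

/-- A matrix entry is a coordinate of `O.op` applied to a basis vector: `a` and `b` are extended by
the same bits off the sites. -/
theorem norm_mat_le (a b : Fin O.numSites → Fin 2) : ‖O.mat a b‖ ≤ ‖O.op‖ := by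
  classical
  set x : Fin n → Fin 2 := extend O.site a 0 with hx
  set y : Fin n → Fin 2 := extend O.site b 0 with hy
  have hxa : (fun l => x (O.site l)) = a := funext fun l => O.site.injective.extend_apply _ _ l
  have hyb : (fun l => y (O.site l)) = b := funext fun l => O.site.injective.extend_apply _ _ l
  have hxy : ∀ q, q ∉ Set.range O.site → x q = y q := fun q hq => by
    rw [hx, hy, extend_apply' _ _ _ (by simpa using hq), extend_apply' _ _ _ (by simpa using hq)]
  have h : (O.op (EuclideanSpace.single y 1)) x = O.mat a b := by
    rw [op, Matrix.ofLp_toEuclideanCLM, PiLp.ofLp_single, Matrix.mulVec_single_one]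
    simp only [Matrix.col_apply, Matrix.of_apply]
    rw [if_pos hxy, hxa, hyb]
  rw [← h]
  refine (PiLp.norm_apply_le _ x).trans ((O.op.le_opNorm _).trans ?_)
  simp

theorem frobSq_le : O.frobSq ≤ 4 ^ k * ‖O.op‖ ^ 2 := by
  rw [frobSq, ← Fintype.sum_prod_type' (f := fun a b => ‖O.mat a b‖ ^ 2)]
  calc _ ≤ ∑ p : (Fin O.numSites → Fin 2) × (Fin O.numSites → Fin 2), ‖O.op‖ ^ 2 :=
        Finset.sum_le_sum fun p _ => by gcongr; exact O.norm_mat_le _ _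
    _ ≤ _ := by
      rw [Finset.sum_const, nsmul_eq_mul]
      gcongr
      exact_mod_cast O.card_pairs

theorem localSum_op : LocalSum k ‖O.op‖ O.op := by
  classical
  refine .of (Finset.univ.image O.site) (Finset.card_image_le.trans ?_) ?_ le_rfl
  · simpa using O.numSites_le
  · intro P hP
    rw [op_eq_sum]
    refine Commute.sum_right _ _ _ fun a _ => Commute.sum_right _ _ _ fun b _ =>
      Commute.smul_right ?_ _
    refine localOn_tens (S := Finset.univ.image O.site) (fun q hq => ?_) P hP
    exact O.unitFac_of_notMem _ _ (by simpa using hq)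

theorem star_op : star O.op = O.op := by
  rw [op, ← map_star]
  congr 1
  ext x y
  simp only [Matrix.star_apply, Matrix.of_apply]
  have h : (∀ q, q ∉ Set.range O.site → y q = x q) ↔ ∀ q, q ∉ Set.range O.site → x q = y q :=
    forall₂_congr fun q _ => eq_comm
  simp only [h]
  split_ifs
  · exact O.isHermitian.apply _ _
  · exact star_zero _

end LocalObservable

theorem bits_injOn (m : ℕ) : Set.InjOn (bits m) (Finset.range (2 ^ m)) := by
  intro x hx y hy h
  simp only [Finset.coe_range, Set.mem_Iio] at hx hy
  refine Nat.eq_of_testBit_eq fun i => ?_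
  by_cases hi : i < m
  · have := congrFun h ⟨i, hi⟩
    simp only [bits] at this
    by_cases h1 : x.testBit i <;> by_cases h2 : y.testBit i <;> simp_all
  · have h2 : 2 ^ m ≤ 2 ^ i := Nat.pow_le_pow_right (by norm_num) (by omega)
    rw [Nat.testBit_lt_two_pow (by omega), Nat.testBit_lt_two_pow (by omega)]

theorem sum_bits {E : Type*} [AddCommMonoid E] (m : ℕ) (f : (Fin m → Fin 2) → E) :
    ∑ x ∈ Finset.range (2 ^ m), f (bits m x) = ∑ a, f a := by
  classical
  have h : (Finset.range (2 ^ m)).image (bits m) = Finset.univ := by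
    rw [← Finset.card_eq_iff_eq_univ, Finset.card_image_of_injOn (bits_injOn m)]
    simp
  rw [← h, Finset.sum_image (bits_injOn m)]

/-- A sum over pairs of bit strings. -/
theorem sum_range_bits {E : Type*} [AddCommMonoid E] {m k : ℕ} (hm : m ≤ k)
    (f : (Fin m → Fin 2) → (Fin m → Fin 2) → E) {g : ℕ → ℕ → E}
    (hg : ∀ x < 2 ^ m, ∀ y < 2 ^ m, g x y = f (bits m x) (bits m y))
    (hg' : ∀ x y, ¬ (x < 2 ^ m ∧ y < 2 ^ m) → g x y = 0) :
    ∑ x ∈ Finset.range (2 ^ k), ∑ y ∈ Finset.range (2 ^ k), g x y = ∑ a, ∑ b, f a b := by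
  have hsub : Finset.range (2 ^ m) ⊆ Finset.range (2 ^ k) :=
    Finset.range_subset_range.2 (Nat.pow_le_pow_right (by norm_num) hm)
  rw [← sum_bits m, ← Finset.sum_subset hsub]
  · refine Finset.sum_congr rfl fun x hx => ?_
    rw [← sum_bits m, ← Finset.sum_subset hsub]
    · exact Finset.sum_congr rfl fun y hy => hg x (Finset.mem_range.1 hx) y (Finset.mem_range.1 hy)
    · exact fun y _ hy => hg' _ _ fun h => hy (Finset.mem_range.2 h.2)
  · exact fun x _ hx => Finset.sum_eq_zero fun y _ => hg' _ _ fun h => hx (Finset.mem_range.2 h.1)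

/-! ## The error -/

section Error

variable {n k : ℕ} {H : AdiabaticHamiltonian n k} {O : LocalObservable n k} {ψ : ProductState n}

theorem expectation_eq (t : ℝ) : expectation H O ψ t
    = inner ℂ ψ.vec ((star (H.evolution t) * O.op * H.evolution t) ψ.vec) := rfl

theorem expectation_im (t : ℝ) : (expectation H O ψ t).im = 0 := by
  rw [← Complex.conj_eq_iff_im, expectation_eq, inner_conj_symm]
  have h : star (star (H.evolution t) * O.op * H.evolution t)
      = star (H.evolution t) * O.op * H.evolution t := by
    rw [star_mul, star_mul, star_star, O.star_op, mul_assoc]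
  conv_rhs => rw [← h, ContinuousLinearMap.star_eq_adjoint, ContinuousLinearMap.adjoint_inner_right]

/-- The exact expectation is real, so keeping only the real part of the approximate one cannot
increase the error. -/
theorem norm_re_sub_expectation_le (T : QOp n) (t : ℝ) :
    ‖((inner ℂ ψ.vec (T ψ.vec) : ℂ).re : ℂ) - expectation H O ψ t‖
      ≤ ‖T - star (H.evolution t) * O.op * H.evolution t‖ := by
  have h : ((inner ℂ ψ.vec (T ψ.vec) : ℂ).re : ℂ) - expectation H O ψ t
      = ((inner ℂ ψ.vec ((T - star (H.evolution t) * O.op * H.evolution t) ψ.vec) : ℂ).re : ℂ) := by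
    rw [sub_apply, inner_sub_right, ← expectation_eq, Complex.sub_re, Complex.ofReal_sub]
    congr 1
    exact Complex.ext (by simp) (by simp [expectation_im])
  rw [h, Complex.norm_real]
  refine (Complex.abs_re_le_norm _).trans ((norm_inner_le_norm _ _).trans ?_)
  rw [norm_vec, one_mul]
  simpa [norm_vec] using
    (T - star (H.evolution t) * O.op * H.evolution t).le_opNorm ψ.vec

end Error

end AdiabaticSim

/-! ### The whole program: truncation order, initial queue, output -/

namespace AdiabaticSim

open Function

/-- Run `f 0`, …, `f (m - 1)`. -/
def Prog.rep (f : ℕ → Prog) : ℕ → Prog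
  | 0 => .skip
  | m + 1 => .seq (Prog.rep f m) (f m)

theorem WP.rep {B : ℕ} {f : ℕ → Prog} {μ : Mem} (I : ℕ → Mem → Prop) (h0 : I 0 μ) :
    ∀ m, (∀ i < m, ∀ ν, I i ν → WP B (f i) ν (I (i + 1))) → WP B (Prog.rep f m) μ (I m) := by
  intro m
  induction m with
  | zero => exact fun _ => WP.skip h0
  | succ m ih =>
    intro h
    exact WP.seq ((ih fun i hi => h i (by omega)).mono fun ν _ hν => h m (by omega) ν hν)

/-- The sum of `f 0`, …, `f (m - 1)`. -/
def RExp.sum (f : ℕ → RExp) : ℕ → RExp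
  | 0 => .const 0
  | m + 1 => .add (RExp.sum f m) (f m)

theorem RExp.eval_sum (f : ℕ → RExp) (μ : Mem) (m : ℕ) :
    (RExp.sum f m).eval μ = ∑ i ∈ Finset.range m, (f i).eval μ := by
  induction m with
  | zero => simp [RExp.sum, RExp.eval]
  | succ m ih => rw [RExp.sum, RExp.eval, ih, Finset.sum_range_succ]

namespace Sim

/-- The square of the Frobenius norm of the matrix of the observable. -/
def frobExp (k : ℕ) : RExp :=
  .sum (fun x => .sum (fun y =>
    .add (.mul (.get 2 (.const x) (.const y)) (.get 2 (.const x) (.const y)))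
      (.mul (.get 3 (.const x) (.const y)) (.get 3 (.const x) (.const y)))) (2 ^ k)) (2 ^ k)

/-- The time. -/
def timeExp : RExp := .get 0 zero zero

/-- The accuracy. -/
def accuracyExp : RExp := .get 0 zero (.const 1)

/-- Compute the bound for the powers in the first stage: the least positive `M` such that
`c * F * t ^ (2 * M) ≤ ε ^ 2`, where `F` is the square of the Frobenius norm. -/
def findOrder (c k : ℕ) : Prog :=
  .seq (.setReal 16 zero zero (.mul (.mul (.const c) (frobExp k)) (.mul timeExp timeExp)))
    (.seq (.setNat 18 zero zero (.const 1))
      (.loop (.not (.realLe (.get 16 zero zero) (.mul accuracyExp accuracyExp)))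
        (.seq (.setReal 16 zero zero (.mul (.get 16 zero zero) (.mul timeExp timeExp)))
          (.setNat 18 zero zero (.add (.var 18) (.const 1))))))

/-- A matrix unit. -/
def unitExp (a b : Fin 2) : MExp := fun a' b' =>
  if a = a' ∧ b = b' then .const 1 0 else .const 0 0

/-- The digit number `l` of `x`. -/
def digit (x l : ℕ) : Fin 2 := if x.testBit l then 1 else 0

/-- Put a matrix unit on the site number `l` of the observable. -/
def startSite (x y l : ℕ) : Prog :=
  .ite (.natLe (.const (l + 1)) (.get 0 zero (.const 2)))
    (.seq (.setNat 21 zero zero (.get 6 (.const l) zero))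
      (.seq addSite (.setMat tail (.var 21) (unitExp (digit x l) (digit y l)))))
    .skip

/-- Append the row of one matrix entry of the observable. -/
def startRow (J k x y : ℕ) : Prog :=
  .seq (.rep (startSite x y) k)
    (finish (.const J) (.var 18) zero (.get 2 (.const x) (.const y)))

/-- Append the rows of all matrix entries of the observable. -/
def startRows (J k : ℕ) : Prog :=
  .rep (fun x => .rep (fun y => startRow J k x y) (2 ^ k)) (2 ^ k)

/-- The simulation algorithm. -/
def main (c J k : ℕ) : Prog :=
  .seq (findOrder c k) (.seq (startRows J k)
    (.seq (.loop (.not (.natLe tail head)) (process J)) (.setReal 0 zero zero (.get 15 zero zero))))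

end Sim

section Start

open Sim

variable {n k : ℕ} {H : AdiabaticHamiltonian n k} {O : LocalObservable n k} {ψ : ProductState n}
  {t ε : ℝ} {B J : ℕ} {μ : Mem}

theorem encode_matrix (x y : ℕ) : (encode H O ψ t ε).cplx 2 x y
    = if x < 2 ^ O.numSites ∧ y < 2 ^ O.numSites then
        O.mat (bits O.numSites x) (bits O.numSites y) else 0 := by
  have h : ∀ a b : ℝ, (encode H O ψ t ε).real 2 x y = a → (encode H O ψ t ε).real 3 x y = b →
      (encode H O ψ t ε).cplx 2 x y = ⟨a, b⟩ := by
    rintro a b rfl rfl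
    rfl
  rw [h _ _ rfl rfl]
  simp only [encode]
  split_ifs
  · rfl
  · rfl

theorem InputAt.matrix (hI : InputAt (encode H O ψ t ε) μ) (x y : ℕ) : μ.cplx 2 x y
    = if x < 2 ^ O.numSites ∧ y < 2 ^ O.numSites then
        O.mat (bits O.numSites x) (bits O.numSites y) else 0 := by
  rw [← encode_matrix (H := H) (ψ := ψ) (t := t) (ε := ε), Mem.cplx, Mem.cplx,
    hI.real 2 (by omega), hI.real (2 + 1) (by omega)]

theorem eval_frobExp (hI : InputAt (encode H O ψ t ε) μ) : (frobExp k).eval μ = O.frobSq := by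
  have h : ∀ x y, μ.real 2 x y * μ.real 2 x y + μ.real 3 x y * μ.real 3 x y
      = ‖μ.cplx 2 x y‖ ^ 2 := fun x y => by
    rw [Complex.sq_norm, Complex.normSq_apply]
    rfl
  simp only [frobExp, RExp.eval_sum, RExp.eval, NExp.eval, h, hI.matrix]
  refine sum_range_bits O.numSites_le (fun a b => ‖O.mat a b‖ ^ 2) (fun x hx y hy => ?_)
    fun x y hxy => ?_
  · rw [if_pos ⟨hx, hy⟩]
  · rw [if_neg hxy]
    simp

theorem InputAt.refl (E : Mem) : InputAt E E := ⟨fun _ _ => rfl, fun _ _ => rfl⟩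

theorem InputAt.setReal {E μ : Mem} {a i j : ℕ} {v : ℝ} (h : InputAt E μ) (ha : 5 ≤ a) :
    InputAt E (μ.setReal a i j v) where
  nat a' ha' := h.nat a' ha'
  real a' ha' := by rw [Mem.setReal_real_of_ne _ _ _ _ (by omega), h.real a' ha']

theorem wp_findOrder {c M : ℕ}
    (hM : IsLeast {m | 1 ≤ m ∧ c * O.frobSq * t ^ (2 * m) ≤ ε ^ 2} M) (hMB : M ≤ B) :
    WP B (findOrder c k) (encode H O ψ t ε) fun ν => InputAt (encode H O ψ t ε) ν ∧
      ν.nat 18 0 0 = M ∧ (∀ a, a ≠ 18 → ν.nat a = (encode H O ψ t ε).nat a) ∧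
      ∀ a, a ≠ 16 → ν.real a = (encode H O ψ t ε).real a := by
  set E := encode H O ψ t ε with hE
  have ht : ∀ {ν}, InputAt E ν → timeExp.eval ν = t := fun h => by
    simp only [timeExp, RExp.eval, NExp.eval, h.real 0 (by omega)]; rfl
  have hε : ∀ {ν}, InputAt E ν → accuracyExp.eval ν = ε := fun h => by
    simp only [accuracyExp, RExp.eval, NExp.eval, h.real 0 (by omega)]; rfl
  refine WP.seq (WP.setReal (WP.seq (WP.setNat ?_)))
  refine (WP.loop (I := fun i ν => InputAt E ν ∧ ν.nat 18 0 0 = i + 1 ∧ i + 1 ≤ M ∧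
    ν.real 16 0 0 = c * O.frobSq * t ^ (2 * (i + 1)) ∧ (∀ a, a ≠ 18 → ν.nat a = E.nat a) ∧
    ∀ a, a ≠ 16 → ν.real a = E.real a) ?_ ?_).mono ?_
  · refine ⟨((InputAt.refl E).setReal (by omega)).setNat (by omega), ?_, hM.1.1, ?_,
      fun a ha => ?_, fun a ha => ?_⟩
    · simp [NExp.eval]
    · simp only [RExp.eval, NExp.eval, Mem.setNat_real, Mem.setReal_real_self,
        ht (InputAt.refl E),
        show (frobExp k).eval E = O.frobSq from
          eval_frobExp (H := H) (ψ := ψ) (t := t) (ε := ε) (InputAt.refl _)]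
      push_cast
      ring
    · rw [Mem.setNat_nat_of_ne _ _ _ _ ha, Mem.setReal_nat]
    · rw [Mem.setNat_real, Mem.setReal_real_of_ne _ _ _ _ ha]
  · rintro i ν ⟨hI, h18, hiM, h16, hn, hr⟩ hb
    -- At order `M` the test fails by the choice of `M`; conversely a failed test stops no earlier
    -- than `M`, since `M` is least. Squares are compared because the machine has no square roots.
    have hlt : i + 1 < M := by
      refine lt_of_le_of_ne hiM fun h => ?_
      have := hM.1.2
      rw [← h, ← h16] at this
      refine hb ?_
      simp only [BExp.eval, RExp.eval, NExp.eval, hε hI]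
      nlinarith
    refine ⟨by omega, WP.seq (WP.setReal (WP.setNat ?_))⟩
    refine ⟨(hI.setReal (by omega)).setNat (by omega), ?_, hlt, ?_, fun a ha => ?_, fun a ha => ?_⟩
    · simp [NExp.eval, h18]
    · simp only [RExp.eval, NExp.eval, Mem.setNat_real, Mem.setReal_real_self, ht hI, h16]
      ring
    · rw [Mem.setNat_nat_of_ne _ _ _ _ ha, Mem.setReal_nat, hn a ha]
    · rw [Mem.setNat_real, Mem.setReal_real_of_ne _ _ _ _ ha, hr a ha]
  · rintro ν - ⟨i, ⟨hI, h18, hiM, h16, hn, hr⟩, hb⟩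
    refine ⟨hI, ?_, hn, hr⟩
    rw [h18]
    refine le_antisymm hiM (hM.2 ⟨by omega, ?_⟩)
    simp only [BExp.eval, RExp.eval, NExp.eval, hε hI, not_not, h16] at hb
    nlinarith

/-- The sites of the observable. -/
def LocalObservable.sites (O : LocalObservable n k) : List (Fin n) := List.ofFn O.site

theorem LocalObservable.length_sites (O : LocalObservable n k) : O.sites.length = O.numSites :=
  List.length_ofFn

theorem LocalObservable.getElem_sites (O : LocalObservable n k) {l : ℕ} (hl : l < O.numSites) :
    O.sites[l]'(by rwa [O.length_sites]) = O.site ⟨l, hl⟩ := by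
  simp [sites]

theorem LocalObservable.mem_sites (O : LocalObservable n k) {q : Fin n} :
    q ∈ O.sites ↔ q ∈ Set.range O.site := by
  simp [sites, List.mem_ofFn]

theorem LocalObservable.nodup_sites (O : LocalObservable n k) : O.sites.Nodup :=
  List.nodup_ofFn.2 O.site.injective

/-- The row of one matrix entry of the observable. -/
noncomputable def LocalObservable.row (O : LocalObservable n k) (J M x y : ℕ) : Row n where
  stage := J
  cap := M
  pow := 0
  coef := if x < 2 ^ O.numSites ∧ y < 2 ^ O.numSites then
    O.mat (bits O.numSites x) (bits O.numSites y) else 0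
  fac := O.unitFac (bits O.numSites x) (bits O.numSites y)
  sup := O.sites

theorem LocalObservable.row_valid (O : LocalObservable n k) (J M x y : ℕ) :
    (O.row J M x y).Valid :=
  ⟨O.nodup_sites, fun _ hq => O.unitFac_of_notMem _ _ fun h => hq (O.mem_sites.2 h)⟩

theorem eval_unitExp (μ : Mem) (a b : Fin 2) : (unitExp a b).eval μ = Matrix.single a b 1 := by
  ext a' b'
  simp only [MExp.eval, unitExp, Matrix.of_apply, Matrix.single_apply]
  split_ifs <;> apply Complex.ext <;> simp [CExp.eval, CExp.const, RExp.eval]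

theorem QueueAt.sameOff {h T : ℕ} {μ ν : Mem} {rows : List (Row n)} (hQ : QueueAt h μ rows)
    (hT : T = h + rows.length) (hso : SameOff T μ ν) :
    ν.nat 8 0 0 = h ∧ ν.nat 7 0 0 = T := by
  rw [hso.nat _ _ _ (by omega) (by omega) (by omega),
    hso.nat _ _ _ (by omega) (by omega) (by omega), hQ.head, hQ.tail, hT]
  exact ⟨rfl, rfl⟩

theorem wp_startRow {h M : ℕ} {rows : List (Row n)} (x y : ℕ) (hI : InputAt (encode H O ψ t ε) μ)
    (hQ : QueueAt h μ rows) (h18 : μ.nat 18 0 0 = M) :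
    WP B (startRow J k x y) μ fun ν => QueueAt h ν (rows ++ [O.row J M x y]) := by
  set T := h + rows.length with hT
  set R := O.row J M x y with hR
  have hin : ∀ {ν}, SameOff T μ ν → ν.nat 0 0 2 = O.numSites ∧
      ∀ l (hl : l < O.numSites), ν.nat 6 l 0 = O.site ⟨l, hl⟩ := fun hso => by
    refine ⟨?_, fun l hl => ?_⟩
    · rw [hso.nat _ _ _ (by omega) (by omega) (by omega), hI.nat 0 (by omega)]; rfl
    · rw [hso.nat _ _ _ (by omega) (by omega) (by omega), hI.nat 6 (by omega)]
      exact entry_fin (fun l => (O.site l : ℕ)) ⟨l, hl⟩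
  refine WP.seq ((WP.rep (fun i ν => SameOff T μ ν ∧ SupAt ν T (O.sites.take i)
    fun q => if q ∈ O.sites.take i then R.fac q else 1) ?_ k ?_).mono ?_)
  · refine ⟨SameOff.refl _ _, ?_⟩
    simpa using hQ.fresh T le_rfl
  · rintro i - ν ⟨hso, hsup⟩
    refine WP.ite (fun hb => ?_) fun hb => ?_
    · have hi : i < O.numSites := by
        simpa [BExp.eval, NExp.eval, (hin hso).1] using hb
      have hi' : i < O.sites.length := by rwa [O.length_sites]
      refine WP.seq (WP.setNat ?_)
      simp only [NExp.eval, (hin hso).2 i hi]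
      set q := O.site ⟨i, hi⟩ with hq
      have hqi : O.sites[i] = q := O.getElem_sites hi
      set ν₁ := ν.setNat 21 0 0 q with hν₁
      have hso₁ : SameOff T μ ν₁ := hso.trans (SameOff.setNat _ (by omega))
      have hsup₁ : SupAt ν₁ T (O.sites.take i) fun q => if q ∈ O.sites.take i then R.fac q else 1 :=
        hsup.congr (fun a j _ _ => by rw [hν₁, Mem.setNat_nat_of_ne _ _ _ _ (by omega)])
          fun _ _ _ _ => rfl
      refine WP.seq ((wp_addSite (q := q) (hQ.sameOff hT hso₁).2 (by simp [hν₁]) hsup₁).mono ?_)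
      rintro ν₂ ha ⟨hso₂, hsup₂⟩
      have h21 : ν₂.nat 21 0 0 = q := by
        rw [ha.1 21 (by decide)]; simp [hν₁]
      have hso₂' := hso₁.trans hso₂
      refine (wp_setMat_row (M := R.fac q) (hQ.sameOff hT hso₂').2 h21 hsup₂ ?_ ?_).mono ?_
      · intro ξ _ _ a b
        unfold unitExp
        split_ifs <;> exact CExp.same_const _ _ _ _
      · rw [eval_unitExp, hq, hR]
        exact (O.unitFac_site (bits O.numSites x) (bits O.numSites y) ⟨i, hi⟩).symm
      · rintro ξ - ⟨hso₃, hsup₃⟩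
        refine ⟨hso₂'.trans hso₃, ?_⟩
        have hmem : q ∉ O.sites.take i := by
          intro hm
          have := O.nodup_sites.sublist (List.take_sublist (i + 1) O.sites)
          rw [take_succ_of_lt hi', List.nodup_append, hqi] at this
          exact this.2.2 _ hm _ (List.mem_singleton_self _) rfl
        rw [insertEnd, if_neg hmem] at hsup₃
        rw [take_succ_of_lt hi', hqi]
        convert hsup₃ using 1
        funext q'
        by_cases hqq : q' = q
        · rw [hqq, update_self, if_pos (List.mem_append_right _ (List.mem_singleton_self _))]
        · rw [update_of_ne hqq]
          have : q' ∈ O.sites.take i ++ [q] ↔ q' ∈ O.sites.take i := by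
            rw [List.mem_append, List.mem_singleton, or_iff_left hqq]
          simp only [this]
    · have hi : O.numSites ≤ i := by
        have : ¬ i < O.numSites := by
          simpa [BExp.eval, NExp.eval, (hin hso).1] using hb
        omega
      refine WP.skip ⟨hso, ?_⟩
      have e : O.sites.take (i + 1) = O.sites.take i := by
        rw [List.take_of_length_le (by rw [O.length_sites]; omega),
          List.take_of_length_le (by rwa [O.length_sites])]
      rwa [e]
  · rintro ν - ⟨hso, hsup⟩
    have e : O.sites.take k = O.sites :=
      List.take_of_length_le (by rw [O.length_sites]; exact O.numSites_le)
    rw [e] at hsup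
    refine wp_finish (R := R) hQ hT hso ?_ (fun ξ _ => rfl) (fun ξ hξ => ?_) (fun ξ _ => rfl)
      (fun ξ hξ => ?_) ?_
    · have hF : (fun q => if q ∈ O.sites then R.fac q else 1) = R.fac := ?_
      · rwa [hF] at hsup
      funext q
      split_ifs with hq
      · rfl
      · exact ((O.row_valid J M x y).fac_eq_one q hq).symm
    · exact (hξ.nat _ _ _ (by omega) (by omega) (by omega)).trans h18
    · exact ⟨hξ.real _ _ _ (by omega), hξ.real _ _ _ (by omega)⟩
    · rw [CExp.eval_get]
      exact hI.matrix x y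

/-- The rows of the matrix entries of the observable. -/
noncomputable def LocalObservable.rows (O : LocalObservable n k) (J M : ℕ) : List (Row n) :=
  (List.range (2 ^ k)).flatMap fun x => (List.range (2 ^ k)).map fun y => O.row J M x y

theorem natW_startRow (x y : ℕ) : ∀ a ∈ (startRow J k x y).natW,
    a = 7 ∨ a = 21 ∨ 12 ≤ a ∧ a ≤ 17 := by
  have h1 : ∀ m, ∀ a ∈ (Prog.rep (startSite x y) m).natW, a = 7 ∨ a = 21 ∨ 12 ≤ a ∧ a ≤ 17 := by
    intro m
    induction m with
    | zero => intro a ha; simp [Prog.rep, Prog.natW] at ha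
    | succ m ih =>
      intro a ha
      rw [Prog.rep, Prog.natW, List.mem_append] at ha
      refine ha.elim (ih a) fun h => ?_
      have : ∀ a ∈ [21, 17, 16, 15], a = 7 ∨ a = 21 ∨ 12 ≤ a ∧ a ≤ 17 := by decide
      exact this a h
  have h2 : ∀ a ∈ (finish (.const J) (.var 18) zero (.get 2 (.const x) (.const y))).natW,
      a = 7 ∨ a = 21 ∨ 12 ≤ a ∧ a ≤ 17 := by
    have : ∀ a ∈ [12, 13, 14, 7], a = 7 ∨ a = 21 ∨ 12 ≤ a ∧ a ≤ 17 := by decide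
    exact this
  intro a ha
  rw [startRow, Prog.natW, List.mem_append] at ha
  exact ha.elim (h1 k a) (h2 a)

theorem realW_startRow (x y : ℕ) : ∀ a ∈ (startRow J k x y).realW, 5 ≤ a ∧ a ≤ 14 := by
  have h1 : ∀ m, ∀ a ∈ (Prog.rep (startSite x y) m).realW, 5 ≤ a ∧ a ≤ 14 := by
    intro m
    induction m with
    | zero => intro a ha; simp [Prog.rep, Prog.realW] at ha
    | succ m ih =>
      intro a ha
      rw [Prog.rep, Prog.realW, List.mem_append] at ha
      refine ha.elim (ih a) fun h => ?_
      have : ∀ a ∈ [7, 8, 9, 10, 11, 12, 13, 14], 5 ≤ a ∧ a ≤ 14 := by decide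
      exact this a h
  have h2 : ∀ a ∈ (finish (.const J) (.var 18) zero (.get 2 (.const x) (.const y))).realW,
      5 ≤ a ∧ a ≤ 14 := by
    have : ∀ a ∈ [5, 6], 5 ≤ a ∧ a ≤ 14 := by decide
    exact this
  intro a ha
  rw [startRow, Prog.realW, List.mem_append] at ha
  exact ha.elim (h1 k a) (h2 a)

theorem wp_startRows {h M : ℕ} (hI : InputAt (encode H O ψ t ε) μ)
    (hQ : QueueAt h μ ([] : List (Row n))) (h18 : μ.nat 18 0 0 = M) :
    WP B (startRows J k) μ fun ν => InputAt (encode H O ψ t ε) ν ∧ ν.real 15 0 0 = μ.real 15 0 0 ∧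
      QueueAt h ν (O.rows J M) := by
  set I : List (Row n) → Mem → Prop := fun L ν => InputAt (encode H O ψ t ε) ν ∧
    ν.real 15 0 0 = μ.real 15 0 0 ∧ QueueAt h ν L ∧ ν.nat 18 0 0 = M with hIdef
  refine (WP.rep (fun x => I ((List.range x).flatMap fun x => (List.range (2 ^ k)).map fun y =>
    O.row J M x y)) ⟨hI, rfl, hQ, h18⟩ (2 ^ k) ?_).mono ?_
  · intro x _ ν hν
    set L := (List.range x).flatMap fun x => (List.range (2 ^ k)).map fun y => O.row J M x y
    have := WP.rep (B := B) (f := fun y => startRow J k x y) (μ := ν)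
      (fun y => I (L ++ (List.range y).map fun y => O.row J M x y)) (by simpa using hν) (2 ^ k) ?_
    · refine this.mono fun ξ _ hξ => ?_
      simpa [List.range_succ, L] using hξ
    · rintro y - ξ ⟨h1, h2, h3, h4⟩
      refine (wp_startRow (J := J) x y h1 h3 h4).mono fun ζ hA hζ => ⟨?_, ?_, ?_, ?_⟩
      · exact h1.agree hA (fun a ha => by have := natW_startRow x y a ha; omega)
          fun a ha => (realW_startRow x y a ha).1
      · rw [hA.2 15 fun ha => by have := realW_startRow x y _ ha; omega, h2]
      · simpa [List.range_succ] using hζ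
      · rw [hA.1 18 fun ha => by have := natW_startRow x y _ ha; omega, h4]
  · rintro ν - ⟨h1, h2, h3, -⟩
    exact ⟨h1, h2, h3⟩

/-- The program runs through all `4 ^ k` index pairs, whatever the number of sites; the input is
zero beyond the matrix, so the surplus rows contribute nothing. -/
theorem sum_result_rows (u : ℝ) (M : ℕ) :
    ((O.rows J M).map (Row.result H u)).sum = H.heis u J M 0 O.op := by
  have key : ∀ {m : ℕ} (f : ℕ → QOp n), ((List.range m).map f).sum = ∑ x ∈ Finset.range m, f x :=
    fun {m} f => by
      induction m with
      | zero => simp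
      | succ m ih => simp [List.range_succ, ih, Finset.sum_range_succ]
  have h : O.op = ∑ x ∈ Finset.range (2 ^ k), ∑ y ∈ Finset.range (2 ^ k), (O.row J M x y).op := by
    rw [sum_range_bits O.numSites_le (fun a b => O.mat a b • tens (O.unitFac a b)), O.op_eq_sum]
    · intro x hx y hy
      simp only [Row.op, LocalObservable.row, if_pos (And.intro hx hy)]
    · intro x y hxy
      simp only [Row.op, LocalObservable.row, if_neg hxy]
      exact zero_smul ℂ (tens (O.unitFac (bits O.numSites x) (bits O.numSites y)))
  rw [h, map_sum, LocalObservable.rows, List.sum_map_flatMap, key]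
  refine Finset.sum_congr rfl fun x _ => ?_
  rw [map_sum, List.map_map, key]
  rfl

/-- Storing matrices as differences from the identity makes the zero memory an unlimited supply of
identity rows; nothing has to be initialised for the `n` qubits. -/
theorem queueAt_nil {μ : Mem} (hn : ∀ a, 7 ≤ a → a ≠ 18 → μ.nat a = 0)
    (hr : ∀ a, 5 ≤ a → a ≠ 16 → μ.real a = 0) : QueueAt 0 μ ([] : List (Row n)) := by
  refine ⟨?_, ?_, fun i hi => absurd hi (by simp), fun e _ => ⟨?_, fun l hl => absurd hl (by simp),
    fun q => ?_, fun q => ?_⟩⟩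
  · rw [hn 8 (by omega) (by omega)]; rfl
  · rw [hn 7 (by omega) (by omega)]; rfl
  · rw [hn 15 (by omega) (by omega)]; rfl
  · rw [hn 17 (by omega) (by omega)]; simp
  · have : ∀ a, 7 ≤ a → a ≤ 13 → μ.cplx a e q = 0 := fun a h1 h2 => by
      rw [Mem.cplx, hr a (by omega) (by omega), hr (a + 1) (by omega) (by omega)]
      rfl
    rw [Mem.mat, this 7 (by omega) (by omega), this 9 (by omega) (by omega),
      this 11 (by omega) (by omega), this 13 (by omega) (by omega)]
    ext a b
    fin_cases a <;> fin_cases b <;> simp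

theorem encode_nat_of_le {a : ℕ} (ha : 7 ≤ a) : (encode H O ψ t ε).nat a = 0 := by
  funext i j
  obtain ⟨b, rfl⟩ := Nat.exists_eq_add_of_le ha
  rw [add_comm]
  rfl

theorem encode_real_of_le {a : ℕ} (ha : 5 ≤ a) : (encode H O ψ t ε).real a = 0 := by
  funext i j
  obtain ⟨b, rfl⟩ := Nat.exists_eq_add_of_le ha
  rw [add_comm]
  rfl

theorem sum_rank_rows (J M Q : ℕ) : ((O.rows J M).map fun R => Q ^ R.rank).sum
    ≤ 4 ^ k * Q ^ Row.rankAux J M 0 := by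
  refine (List.sum_map_le_nsmul _ _ (b := Q ^ Row.rankAux J M 0) fun R hR => ?_).trans ?_
  · simp only [LocalObservable.rows, List.mem_flatMap, List.mem_map] at hR
    obtain ⟨x, -, y, -, rfl⟩ := hR
    exact le_rfl
  · refine Nat.mul_le_mul_right _ ((List.length_flatMap_le_mul _ _ (b := 2 ^ k)
      fun x _ => by simp).trans ?_)
    rw [List.length_range, ← mul_pow, two_mul]

theorem wp_main {c M W D Q : ℕ}
    (hM : IsLeast {m | 1 ≤ m ∧ c * O.frobSq * t ^ (2 * m) ≤ ε ^ 2} M) (hMB : M ≤ B)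
    (hD : H.maxDegree + 1 ≤ D) (hW : k + k * Row.rankAux J M 0 ≤ W) (hQ : 2 + W * (D * 2) ≤ Q)
    (hWB : W ≤ B) (hDB : D ≤ B) (hB : 4 ^ k * Q ^ Row.rankAux J M 0 ≤ B) :
    WP B (main c J k) (encode H O ψ t ε) fun ν =>
      ν.output = (inner ℂ ψ.vec (H.heis (t / J) J M 0 O.op ψ.vec)).re := by
  refine WP.seq ((wp_findOrder hM hMB).mono ?_)
  rintro ν₁ - ⟨hI₁, h18, hn, hr⟩
  have hQ₁ : QueueAt 0 ν₁ ([] : List (Row n)) := queueAt_nil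
    (fun a ha ha' => by rw [hn a ha', encode_nat_of_le ha])
    (fun a ha ha' => by rw [hr a ha', encode_real_of_le ha])
  have h15 : ν₁.real 15 0 0 = 0 := by
    rw [hr 15 (by omega), encode_real_of_le (by omega)]; rfl
  refine WP.seq ((wp_startRows (J := J) hI₁ hQ₁ h18).mono ?_)
  rintro ν₂ - ⟨hI₂, h15', hQ₂⟩
  refine WP.seq ((wp_mainLoop (J := J) (W := W) hI₂ hQ₂ ?_ hD hQ hWB (by omega) hDB
    ((sum_rank_rows J M Q).trans hB)).mono ?_)
  · intro R hR
    simp only [LocalObservable.rows, List.mem_flatMap, List.mem_map] at hR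
    obtain ⟨x, -, y, -, rfl⟩ := hR
    refine ⟨O.row_valid J M x y, le_trans ?_ hW⟩
    refine add_le_add ?_ le_rfl
    exact O.length_sites.le.trans O.numSites_le
  · intro ν₃ _ h
    refine WP.setReal ?_
    simp only [Mem.output, NExp.eval, Mem.setReal_real_self, RExp.eval]
    rw [h, h15', h15, zero_add, Row.value_sum, sum_result_rows]

end Start

end AdiabaticSim

namespace AdiabaticSim

/-! ## The running time -/

theorem criticalTime_pos {𝔡 : ℕ} (h𝔡 : 1 ≤ 𝔡) : 0 < criticalTime 𝔡 := by
  have : (0 : ℝ) < 𝔡 := by exact_mod_cast h𝔡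
  unfold criticalTime
  positivity

theorem criticalTime_le_half {𝔡 : ℕ} (h𝔡 : 1 ≤ 𝔡) : criticalTime 𝔡 ≤ 1 / 2 := by
  have h1 : (1 : ℝ) ≤ 𝔡 := by exact_mod_cast h𝔡
  have h2 : (1 : ℝ) ≤ Real.exp 1 := Real.one_le_exp zero_le_one
  have h3 : (1 : ℝ) ≤ √(Real.exp 1 * 𝔡) := Real.one_le_sqrt.2 (by nlinarith)
  unfold criticalTime
  exact one_div_le_one_div_of_le (by norm_num) (by linarith)

theorem runtimeScale_nonneg (𝔡 : ℕ) {N t ε : ℝ} (hN : 0 ≤ N) (hε : 0 < ε) :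
    0 ≤ runtimeScale 𝔡 N t ε := by
  unfold runtimeScale
  positivity

/-- Put `l = log (1 / t)`, so `l ≥ log 2` as `t < 1 / 2`. The hypothesis gives `log (N / ε) ≥ (M - 1
- C) * l`, since `log C ≤ C * log 2`. The logarithm of the base is then at least `(M - 3 - C) * l ≥
(M / 2) * log 2`. The exponent is at least `log (N / ε) / l ≥ M / 2`, because `t* ≤ 1` gives `log
(t* / t) ≤ l`. Their product is at least `(M ^ 2 / 4) * log 2`, which explains the fourth power. The
factors `1 - t / t*` and `exp (t ^ 2)` only help. -/
theorem two_pow_sq_le_runtimeScale {𝔡 C M : ℕ} {N t ε : ℝ} (h𝔡 : 1 ≤ 𝔡) (hN : 0 ≤ N) (hε : 0 < ε)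
    (ht0 : 0 ≤ t) (ht : t < criticalTime 𝔡) (hM : 2 * C + 6 ≤ M)
    (h : ε < C * N * t ^ (M - 1)) : (2 : ℝ) ^ (M ^ 2) ≤ runtimeScale 𝔡 N t ε ^ 4 := by
  have hN0 : 0 < N := by
    rcases hN.eq_or_lt with h0 | h0
    · rw [← h0] at h
      simp at h
      linarith
    · exact h0
  have ht1 : 0 < t := by
    rcases ht0.eq_or_lt with h0 | h0
    · rw [← h0, zero_pow (by omega)] at h
      simp at h
      linarith
    · exact h0
  have hC0 : (0 : ℝ) < C := by
    rcases Nat.eq_zero_or_pos C with h0 | h0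
    · rw [h0] at h
      simp at h
      linarith
    · exact_mod_cast h0
  have hc := criticalTime_pos h𝔡
  have hch := criticalTime_le_half h𝔡
  set s := criticalTime 𝔡 with hs
  have hl2 : 0 < Real.log 2 := Real.log_pos one_lt_two
  set l := -Real.log t with hl
  have hl2l : Real.log 2 ≤ l := by
    have := Real.log_le_log ht1 (ht.le.trans hch)
    rw [one_div, Real.log_inv] at this
    linarith
  have hlogC : Real.log C ≤ C * Real.log 2 := by
    have h1 : (C : ℝ) ≤ 2 ^ C := by exact_mod_cast (Nat.lt_two_pow_self (n := C)).le
    have := Real.log_le_log hC0 h1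
    rwa [Real.log_pow] at this
  have hMr : 2 * (C : ℝ) + 6 ≤ M := by exact_mod_cast hM
  have hx : ((M : ℝ) - 1 - C) * l ≤ Real.log (N / ε) := by
    have h1 := Real.log_le_log hε h.le
    rw [Real.log_mul (by positivity) (by positivity), Real.log_mul (by positivity) (by positivity),
      Real.log_pow, Nat.cast_sub (by omega), Nat.cast_one] at h1
    rw [Real.log_div hN0.ne' hε.ne']
    have h2 : (C : ℝ) * Real.log 2 ≤ C * l := mul_le_mul_of_nonneg_left hl2l hC0.le
    have h3 : Real.log t = -l := by rw [hl, neg_neg]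
    rw [h3] at h1
    nlinarith
  have hl0 : 0 < l := hl2.trans_le hl2l
  set base := N / ε * t ^ 2 * Real.exp (t ^ 2) with hbase
  have hbase0 : 0 < base := by positivity
  have hb : (M / 2 : ℝ) * Real.log 2 ≤ Real.log base := by
    rw [hbase, Real.log_mul (by positivity) (by positivity),
      Real.log_mul (by positivity) (by positivity), Real.log_pow, Real.log_exp]
    have h3 : Real.log t = -l := by rw [hl, neg_neg]
    rw [h3]
    have h4 : (M / 2 : ℝ) * Real.log 2 ≤ (M / 2 : ℝ) * l := by gcongr
    have h5 : (M / 2 : ℝ) * l ≤ (M - 3 - C) * l := by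
      refine mul_le_mul_of_nonneg_right ?_ hl0.le
      linarith
    push_cast
    nlinarith [sq_nonneg t]
  have he : (M / 2 : ℝ) ≤ Real.log (ε / N * (1 - t / s)) / Real.log (t / s) := by
    have hτ0 : 0 < t / s := by positivity
    have hτ1 : t / s < 1 := (div_lt_one hc).2 ht
    have hτ2 : 0 < 1 - t / s := by linarith
    have hlogτ : Real.log (t / s) < 0 := Real.log_neg hτ0 hτ1
    have h1 : Real.log (ε / N * (1 - t / s)) ≤ -Real.log (N / ε) := by
      rw [Real.log_mul (by positivity) hτ2.ne', ← Real.log_inv, inv_div]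
      have := Real.log_nonpos hτ2.le (by linarith)
      linarith
    have h2 : -l ≤ Real.log (t / s) := by
      rw [Real.log_div ht1.ne' hc.ne', hl, neg_neg]
      have := Real.log_nonpos hc.le (by linarith)
      linarith
    -- Numerator and denominator of the exponent are both negative, so the inequality is reversed
    -- here.
    rw [le_div_iff_of_neg hlogτ]
    have h5 : (M / 2 : ℝ) * l ≤ (M - 1 - C) * l := by
      refine mul_le_mul_of_nonneg_right ?_ hl0.le
      linarith
    have h6 : (M / 2 : ℝ) * -l ≤ M / 2 * Real.log (t / s) := by gcongr
    linarith
  have hexp : runtimeScale 𝔡 N t ε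
      = Real.exp (Real.log base * (Real.log (ε / N * (1 - t / s)) / Real.log (t / s))) := by
    rw [runtimeScale, ← Real.rpow_def_of_pos hbase0]
  rw [hexp, ← Real.exp_nat_mul, ← Real.rpow_natCast, Real.rpow_def_of_pos two_pos]
  refine Real.exp_le_exp.2 ?_
  have hM0 : (0 : ℝ) ≤ M / 2 := by positivity
  have h7 : (M / 2 : ℝ) * Real.log 2 * (M / 2)
      ≤ Real.log base * (Real.log (ε / N * (1 - t / s)) / Real.log (t / s)) :=
    mul_le_mul hb he hM0 ((by positivity : 0 ≤ (M / 2 : ℝ) * Real.log 2).trans hb)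
  push_cast
  nlinarith

/-- The running time of a program whose number of iterations is that of the simulation. -/
theorem exists_bnd_le_two_pow (p : Prog) (J k D : ℕ) : ∃ C : ℕ, ∀ M : ℕ, 1 ≤ M →
    ∃ B W Q : ℕ, M ≤ B ∧ k + k * Row.rankAux J M 0 ≤ W ∧ 2 + W * (D * 2) ≤ Q ∧ W ≤ B ∧ D ≤ B ∧
      4 ^ k * Q ^ Row.rankAux J M 0 ≤ B ∧ p.bnd B ≤ 2 ^ (C * M ^ 2) := by
  obtain ⟨c, d, hp⟩ := p.exists_bnd_le
  set a := 2 ^ J * 2 with ha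
  set w := k + k * a with hw
  set b := 2 + w * (D * 2) with hb
  set E := 1 + w + D + 2 * k + b * a with hE
  refine ⟨c + (E + 3) * d, fun M hM => ?_⟩
  set r := Row.rankAux J M 0 with hr
  have hra : r ≤ a * M := by
    have h1 := Row.rankAux_le J M
    have h2 : 2 ^ J * (M + 1) ≤ a * M := by
      rw [ha, mul_assoc]
      exact Nat.mul_le_mul_left _ (by omega)
    omega
  have hW : k + k * r ≤ w * M := by
    have h1 : k * r ≤ k * (a * M) := Nat.mul_le_mul_left _ hra
    have h2 : k ≤ k * M := Nat.le_mul_of_pos_right _ hM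
    rw [hw, add_mul]
    nlinarith
  have hQ : 2 + w * M * (D * 2) ≤ b * M := by
    have h1 : w * M * (D * 2) = w * (D * 2) * M := by ring
    rw [hb, add_mul 2, h1]
    omega
  have hMM : M ≤ M ^ 2 := by nlinarith
  have hM2 : 1 ≤ M ^ 2 := hM.trans hMM
  have two : ∀ {x e : ℕ}, x ≤ e → e ≤ E * M ^ 2 → x ≤ 2 ^ (E * M ^ 2) := fun hx he =>
    hx.trans (he.trans (Nat.lt_two_pow_self).le)
  have hE1 : ∀ e, e ≤ E → e * M ≤ E * M ^ 2 := fun e he => Nat.mul_le_mul he hMM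
  have h1 : M ≤ 2 ^ (E * M ^ 2) := two le_rfl (by simpa using hE1 1 (by omega))
  have h2 : w * M ≤ 2 ^ (E * M ^ 2) := two le_rfl (hE1 w (by omega))
  have h3 : D ≤ 2 ^ (E * M ^ 2) :=
    two (Nat.le_mul_of_pos_right D hM) (hE1 D (by omega))
  -- The crude `b * M ≤ 2 ^ (b * M)` is affordable: branching `O(M)` to the depth `O(M)` still has
  -- an exponent quadratic in `M`.
  have h4 : 4 ^ k * (b * M) ^ r ≤ 2 ^ (E * M ^ 2) := by
    calc 4 ^ k * (b * M) ^ r ≤ 4 ^ k * (2 ^ (b * M)) ^ (a * M) := by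
          refine Nat.mul_le_mul_left _ ?_
          exact (Nat.pow_le_pow_left (Nat.lt_two_pow_self).le r).trans
            (Nat.pow_le_pow_right (by positivity) hra)
      _ = 2 ^ (2 * k + b * M * (a * M)) := by
          rw [pow_add, pow_mul 2 (b * M), pow_mul 2 2 k]; norm_num
      _ ≤ _ := by
          refine Nat.pow_le_pow_right two_pos ?_
          calc 2 * k + b * M * (a * M) = 2 * k + b * a * M ^ 2 := by ring
            _ ≤ 2 * k * M ^ 2 + b * a * M ^ 2 :=
              Nat.add_le_add_right (Nat.le_mul_of_pos_right _ hM2) _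
            _ = (2 * k + b * a) * M ^ 2 := by ring
            _ ≤ _ := Nat.mul_le_mul_right _ (by omega)
  have h5 : 1 ≤ 2 ^ (E * M ^ 2) := Nat.one_le_two_pow
  refine ⟨M + w * M + D + 4 ^ k * (b * M) ^ r, w * M, b * M, by omega, hW, hQ, by omega, by omega,
    by omega, (hp _).trans ?_⟩
  calc c * (M + w * M + D + 4 ^ k * (b * M) ^ r + 1) ^ d
      ≤ 2 ^ (c * M ^ 2) * (2 ^ ((E + 3) * M ^ 2)) ^ d := by
        refine Nat.mul_le_mul ?_ (Nat.pow_le_pow_left ?_ d)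
        · exact (Nat.le_mul_of_pos_right c hM2).trans (Nat.lt_two_pow_self).le
        · calc _ ≤ 2 ^ (E * M ^ 2) * 2 ^ 3 := by omega
            _ = 2 ^ (E * M ^ 2 + 3) := (pow_add _ _ _).symm
            _ ≤ _ := Nat.pow_le_pow_right two_pos (by nlinarith)
    _ = _ := by rw [← pow_mul, ← pow_add]; congr 1; ring

/-! ## The theorem -/

theorem exists_order {c : ℕ} {F t ε : ℝ} (ht0 : 0 ≤ t) (ht1 : t < 1) (hε : 0 < ε) (hF : 0 ≤ F) :
    ∃ M, IsLeast {m | 1 ≤ m ∧ c * F * t ^ (2 * m) ≤ ε ^ 2} M := by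
  have hne : {m | 1 ≤ m ∧ c * F * t ^ (2 * m) ≤ ε ^ 2}.Nonempty := by
    have h1 : 0 < ε ^ 2 / (c * F + 1) := by positivity
    obtain ⟨m, hm⟩ := exists_pow_lt_of_lt_one h1 ht1
    refine ⟨m + 1, by omega, ?_⟩
    have h2 : t ^ (2 * (m + 1)) ≤ t ^ m := pow_le_pow_of_le_one ht0 ht1.le (by omega)
    have h3 : t ^ (2 * (m + 1)) * (c * F + 1) ≤ ε ^ 2 :=
      (le_div_iff₀ (by positivity)).1 (h2.trans hm.le)
    have h4 : 0 ≤ t ^ (2 * (m + 1)) := by positivity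
    nlinarith
  exact ⟨sInf _, Nat.sInf_mem hne, fun m hm => Nat.sInf_le hm⟩

/-- The value of `J` is chosen so that the smallness condition on the stage duration becomes exactly
`t ≤ 1`; the error then decays at least as fast as `t ^ M`. Using `k + 1` for the locality keeps it
positive when `k = 0`. -/
theorem norm_heis_op_sub_le {n k : ℕ} {H : AdiabaticHamiltonian n k} {O : LocalObservable n k}
    {t : ℝ} {D A J M : ℕ} (hD : H.maxDegree + 1 ≤ D) (hA : A = 6 * D * (k + 1))
    (hJ : J = 8 * A * 64 ^ (k + 1)) (ht0 : 0 ≤ t) (ht1 : t ≤ 1) (hM : 1 ≤ M) :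
    ‖H.heis (t / J) J M 0 O.op - star (H.evolution t) * O.op * H.evolution t‖
      ≤ 3 * A * J * ‖O.op‖ * t ^ M := by
  have hA1 : 1 ≤ A := by
    rw [hA]
    have : 1 ≤ D := by omega
    nlinarith
  have hA0 : (0 : ℝ) < A := by exact_mod_cast hA1
  have hJr : (J : ℝ) = 8 * A * 64 ^ (k + 1) := by rw [hJ]; push_cast; ring
  have hJ0 : (0 : ℝ) < J := by rw [hJr]; positivity
  have hAr : (6 * D * ((k + 1 : ℕ) : ℝ) : ℝ) = A := by rw [hA]; push_cast; ring
  have h64 : (64 : ℝ) ^ (k + 1) = 4 ^ (k + 1) * 16 ^ (k + 1) := by rw [← mul_pow]; norm_num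
  -- `8 * 64 ^ (k + 1)` collects the factors `2 * 4 ^ (k + 1)`, `16 ^ (k + 1)` and `4`.
  have hρ : 2 * 4 ^ (k + 1) * (16 ^ (k + 1) * (4 * (A : ℝ) * (t / J))) = t := by
    rw [hJr, h64]
    field_simp
    ring
  have hs : (J : ℝ) * (t / J) = t := by field_simp
  have h4 : (1 : ℝ) ≤ 4 ^ (k + 1) := one_le_pow₀ (by norm_num)
  have hρ0 : 0 ≤ 16 ^ (k + 1) * (4 * (A : ℝ) * (t / J)) := by positivity
  have hρt : 16 ^ (k + 1) * (4 * (A : ℝ) * (t / J)) ≤ t := by nlinarith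
  have h := H.norm_heis_sub_le hD (Nat.le_succ k) (Nat.succ_pos k) (u := t / J) (by positivity)
    (by rw [hAr, hρ]; exact ht1) J (by rw [hs]; exact ht1) M k ‖O.op‖ O.op hM
    (by nlinarith) O.localSum_op
  rw [hAr, hs] at h
  refine h.trans ?_
  calc (J : ℝ) * (3 * A * ‖O.op‖ * (16 ^ (k + 1) * (4 * A * (t / J))) ^ M)
      ≤ J * (3 * A * ‖O.op‖ * t ^ M) := by gcongr
    _ = _ := by ring

end AdiabaticSim

open AdiabaticSim
theorem mainTheorem2 (𝔡 k : ℕ) (h𝔡 : 1 ≤ 𝔡) :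
    ∃ (prog : Prog) (poly : Polynomial ℝ),
      ∀ (n : ℕ) (H : AdiabaticHamiltonian n k) (O : LocalObservable n k) (ψ : ProductState n)
        (t ε : ℝ), H.maxDegree ≤ 𝔡 → 0 ≤ t → t < criticalTime 𝔡 → 0 < ε →
        ∃ (μ : Mem) (steps : ℕ),
          Exec prog (encode H O ψ t ε) μ steps ∧
          (steps : ℝ) ≤ poly.eval (runtimeScale 𝔡 ‖O.op‖ t ε) ∧
          ‖(μ.output : ℂ) - expectation H O ψ t‖ ≤ ε := by
  obtain ⟨A, hA⟩ : ∃ A, A = 6 * (𝔡 + 1) * (k + 1) := ⟨_, rfl⟩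
  obtain ⟨J, hJ⟩ : ∃ J, J = 8 * A * 64 ^ (k + 1) := ⟨_, rfl⟩
  -- `c * frobSq * t ^ (2 * M)` dominates the square of the error bound, by `‖O‖ ^ 2 ≤ 4 ^ k *
  -- frobSq`. The `C` below satisfies `c * 4 ^ k = C ^ 2`, which absorbs the return from `frobSq` to
  -- `‖O‖ ^ 2`.
  obtain ⟨c, hc⟩ : ∃ c, c = (3 * A * J) ^ 2 * 4 ^ k := ⟨_, rfl⟩
  obtain ⟨C, hC⟩ : ∃ C, C = 3 * A * J * 4 ^ k := ⟨_, rfl⟩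
  obtain ⟨E, hE⟩ := exists_bnd_le_two_pow (Sim.main c J k) J k (𝔡 + 1)
  -- The constant covers the orders `M < 2 * C + 6`, among them `M = 1`, which occurs for `t = 0`
  -- and for `O = 0`. For larger `M` the monomial covers `2 ^ (E * M ^ 2)`, by the fourth-power
  -- comparison.
  refine ⟨Sim.main c J k, Polynomial.C (2 ^ (E * (2 * C + 6) ^ 2)) + Polynomial.X ^ (4 * E), ?_⟩
  intro n H O ψ t ε hdeg ht0 ht hε
  have ht1 : t < 1 := by
    have := criticalTime_le_half h𝔡
    linarith
  obtain ⟨M, hM⟩ := exists_order (c := c) ht0 ht1 hε O.frobSq_nonneg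
  obtain ⟨B, W, Q, hMB, hW, hQ, hWB, hDB, hB, hbnd⟩ := hE M hM.1.1
  obtain ⟨μ, steps, hexec, hsteps, hout⟩ := wp_main (H := H) (ψ := ψ) hM hMB
    (Nat.succ_le_succ hdeg) hW hQ hWB hDB hB
  have hN := norm_nonneg O.op
  refine ⟨μ, steps, hexec, ?_, ?_⟩
  · have hs : (steps : ℝ) ≤ 2 ^ (E * M ^ 2) := by exact_mod_cast hsteps.trans hbnd
    have hR := runtimeScale_nonneg 𝔡 (t := t) hN hε
    simp only [Polynomial.eval_add, Polynomial.eval_C, Polynomial.eval_pow, Polynomial.eval_X]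
    rcases Nat.lt_or_ge M (2 * C + 6) with hlt | hge
    · have h1 : (2 : ℝ) ^ (E * M ^ 2) ≤ 2 ^ (E * (2 * C + 6) ^ 2) :=
        pow_le_pow_right₀ one_le_two (Nat.mul_le_mul_left _ (Nat.pow_le_pow_left hlt.le 2))
      have h2 : 0 ≤ runtimeScale 𝔡 ‖O.op‖ t ε ^ (4 * E) := by positivity
      linarith
    · have hlt : ε < C * ‖O.op‖ * t ^ (M - 1) := by
        -- Minimality of `M`: the order `M - 1` is still positive and hence fails the test.
        have h1 : ε ^ 2 < c * O.frobSq * t ^ (2 * (M - 1)) := by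
          by_contra h
          have := hM.2 ⟨by omega, not_lt.1 h⟩
          omega
        refine lt_of_pow_lt_pow_left₀ 2 (by positivity) (h1.trans_le ?_)
        have h2 := O.frobSq_le
        have hcC : (c : ℝ) * 4 ^ k = (C : ℝ) ^ 2 := by
          rw [hc, hC]; push_cast; ring
        calc c * O.frobSq * t ^ (2 * (M - 1))
            ≤ c * (4 ^ k * ‖O.op‖ ^ 2) * t ^ (2 * (M - 1)) := by gcongr
          _ = (c * 4 ^ k) * ‖O.op‖ ^ 2 * t ^ (2 * (M - 1)) := by ring
          _ = _ := by rw [hcC]; ring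
      have h1 := two_pow_sq_le_runtimeScale h𝔡 hN hε ht0 ht hge hlt
      have h2 : (2 : ℝ) ^ (E * M ^ 2) ≤ runtimeScale 𝔡 ‖O.op‖ t ε ^ (4 * E) := by
        rw [mul_comm E, pow_mul 2, pow_mul _ 4]
        exact pow_le_pow_left₀ (by positivity) h1 E
      have h3 : (0 : ℝ) ≤ 2 ^ (E * (2 * C + 6) ^ 2) := by positivity
      linarith
  · rw [hout]
    refine (norm_re_sub_expectation_le _ t).trans ((norm_heis_op_sub_le (Nat.succ_le_succ hdeg) hA
      hJ ht0 ht1.le hM.1.1).trans ?_)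
    refine le_of_sq_le_sq ?_ hε.le
    have h1 := O.norm_op_sq_le
    calc (3 * A * J * ‖O.op‖ * t ^ M) ^ 2 = (3 * A * J) ^ 2 * ‖O.op‖ ^ 2 * t ^ (2 * M) := by ring
      _ ≤ (3 * A * J) ^ 2 * (4 ^ k * O.frobSq) * t ^ (2 * M) := by gcongr
      _ = c * O.frobSq * t ^ (2 * M) := by rw [hc]; push_cast; ring
      _ ≤ ε ^ 2 := hM.1.2
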